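/- Let $(M,g)$ be a compact connected Riemannian manifold ($C^\infty$, without boundary) with Levi-Civita connection $\nabla$ and Riemannian distance $\mathrm{dist}$. Let $\tau:M\to\mathbb R$ be a Morse–Bott function: $\tau$ is $C^\infty$, the connected components of its set of critical points are mutually isolated submanifolds of $M$ (the critical manifolds), and the rank of the Hessian of $\tau$ at every critical point equals the codimension of the critical manifold containing it. Suppose that $\tau$ has a geodesic gradient, that is, $v=\nabla\tau$ satisfies $\nabla_v v=\psi v$ wherever $v\ne 0$, for some function $\psi$, and that all critical manifolds of $\tau$ have codimension greater than $1$. Put $\tau_{\min}=\min\tau$, $\tau_{\max}=\max\tau$, $I=[\tau_{\min},\tau_{\max}]$, $I^\circ=(\tau_{\min},\tau_{\max})$ and $Q=g(\nabla\tau,\nabla\tau)$. Then $\tau$ is nonconstant, with range $I$, and: (i) $Q$ is a $C^\infty$ function of $\tau$: there is a $C^\infty$ function $\chi:I\to\mathbb R$ with $Q=\chi\circ\tau$; from now on $Q$ is also regarded as the function $\tau\mapsto\chi(\tau)$ on $I$. (ii) At every critical point $y$ the Hessian $\nabla d\tau$ has exactly one nonzero eigenvalue $a$, and $dQ/d\tau=2a$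 at $\tau(y)$ (a one-sided derivative if $\tau(y)$ is an endpoint of $I$). (iii) $Q>0$ on $I^\circ$, and the integral $\lambda=\int_I Q^{-1/2}\,d\tau$ is finite. (iv) $\lambda$ is the distance between the levels $\tau^{-1}(\tau_{\min})$ and $\tau^{-1}(\tau_{\max})$, that is, the infimum of $\mathrm{dist}(x,y)$ over $x,y\in M$ with $\tau(x)=\tau_{\min}$, $\tau(y)=\tau_{\max}$. (v) The assignment $\tau\mapsto s$ characterized by $ds/d\tau=Q^{-1/2}$ on $I^\circ$, continuity on $I$, and $s=0$ at $\tau=\tau_{\min}$ exists, and is a homeomorphism $I\to[0,\lambda]$ that maps $I^\circ$ $C^\infty$-diffeomorphically onto $(0,\lambda)$. (vi) For every $x\in M$, $s(\tau(x))$ is the distance from $x$ to the minimum level $\tau^{-1}(\tau_{\min})$. -/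

import Mathlib

open Bundle
open scoped Manifold ContDiff Topology

noncomputable section

namespace RiemGeom

set_option linter.unusedSectionVars false

section LeviCivita

variable {E : Type*} [NormedAddCommGroup E] [NormedSpace ℝ E] [FiniteDimensional ℝ E]
  {M : Type*} [TopologicalSpace M] [ChartedSpace E M]
  [RiemannianBundle (fun x : M ↦ TangentSpace 𝓘(ℝ, E) x)]

theorem complete_tangent (x : M) : CompleteSpace (TangentSpace 𝓘(ℝ, E) x) :=
  haveI : FiniteDimensional ℝ (TangentSpace 𝓘(ℝ, E) x) := inferInstanceAs (FiniteDimensional ℝ E)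
  FiniteDimensional.complete ℝ _

variable [IsManifold 𝓘(ℝ, E) ∞ M]
  [IsContMDiffRiemannianBundle 𝓘(ℝ, E) ∞ E (fun x : M ↦ TangentSpace 𝓘(ℝ, E) x)]

theorem mdiff_inner {X Y : Π x : M, TangentSpace 𝓘(ℝ, E) x} {x : M}
    (hX : MDiffAt (T% X) x) (hY : MDiffAt (T% Y) x) :
    MDiffAt (fun p ↦ inner ℝ (X p) (Y p)) x :=
  MDifferentiableAt.inner_bundle (IB := 𝓘(ℝ, E)) (F := E)
    (E := fun x : M ↦ TangentSpace 𝓘(ℝ, E) x) (b := fun p : M ↦ p) hX hY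

/-- Koszul's expression for `2 g(∇_X Y, Z)` at `x`. -/
def koszul (Y X Z : Π x : M, TangentSpace 𝓘(ℝ, E) x) (x : M) : ℝ :=
  mvfderiv 𝓘(ℝ, E) (fun p ↦ inner ℝ (Y p) (Z p)) x (X x)
    + mvfderiv 𝓘(ℝ, E) (fun p ↦ inner ℝ (X p) (Z p)) x (Y x)
    - mvfderiv 𝓘(ℝ, E) (fun p ↦ inner ℝ (X p) (Y p)) x (Z x)
    + inner ℝ (VectorField.mlieBracket 𝓘(ℝ, E) X Y x) (Z x)
    - inner ℝ (VectorField.mlieBracket 𝓘(ℝ, E) X Z x) (Y x)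
    - inner ℝ (VectorField.mlieBracket 𝓘(ℝ, E) Y Z x) (X x)

theorem koszul_tensorial_left {Y Z : Π x : M, TangentSpace 𝓘(ℝ, E) x} {x : M}
    (hY : MDiffAt (T% Y) x) (hZ : MDiffAt (T% Z) x) :
    TensorialAt 𝓘(ℝ, E) E (fun X ↦ koszul Y X Z x) x where
  smul {f X} hf hX := by
    have e1 : (fun p ↦ inner ℝ ((f • X) p) (Z p)) = f * (fun p ↦ inner ℝ (X p) (Z p)) := by
      ext p; simp [inner_smul_left]
    have e2 : (fun p ↦ inner ℝ ((f • X) p) (Y p)) = f * (fun p ↦ inner ℝ (X p) (Y p)) := by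
      ext p; simp [inner_smul_left]
    simp only [koszul, e1, e2]
    rw [mvfderiv_mul hf (mdiff_inner hX hZ), mvfderiv_mul hf (mdiff_inner hX hY),
      VectorField.mlieBracket_smul_left hf hX, VectorField.mlieBracket_smul_left hf hX]
    simp [inner_add_left, inner_smul_left, inner_smul_right]
    ring
  add {X X'} hX hX' := by
    have e1 : (fun p ↦ inner ℝ ((X + X') p) (Z p)) =
        (fun p ↦ inner ℝ (X p) (Z p)) + (fun p ↦ inner ℝ (X' p) (Z p)) := by
      ext p; simp [inner_add_left]
    have e2 : (fun p ↦ inner ℝ ((X + X') p) (Y p)) =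
        (fun p ↦ inner ℝ (X p) (Y p)) + (fun p ↦ inner ℝ (X' p) (Y p)) := by
      ext p; simp [inner_add_left]
    simp only [koszul, e1, e2]
    rw [mvfderiv_add (mdiff_inner hX hZ) (mdiff_inner hX' hZ),
      mvfderiv_add (mdiff_inner hX hY) (mdiff_inner hX' hY),
      VectorField.mlieBracket_add_left hX hX', VectorField.mlieBracket_add_left hX hX']
    simp [inner_add_left, inner_add_right]
    ring

theorem koszul_tensorial_right {Y X : Π x : M, TangentSpace 𝓘(ℝ, E) x} {x : M}
    (hY : MDiffAt (T% Y) x) (hX : MDiffAt (T% X) x) :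
    TensorialAt 𝓘(ℝ, E) E (fun Z ↦ koszul Y X Z x) x where
  smul {f Z} hf hZ := by
    have e1 : (fun p ↦ inner ℝ (X p) ((f • Z) p)) = f * (fun p ↦ inner ℝ (X p) (Z p)) := by
      ext p; simp [inner_smul_right]
    have e2 : (fun p ↦ inner ℝ (Y p) ((f • Z) p)) = f * (fun p ↦ inner ℝ (Y p) (Z p)) := by
      ext p; simp [inner_smul_right]
    simp only [koszul, e1, e2]
    rw [mvfderiv_mul hf (mdiff_inner hX hZ), mvfderiv_mul hf (mdiff_inner hY hZ),
      VectorField.mlieBracket_smul_right hf hZ, VectorField.mlieBracket_smul_right hf hZ]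
    simp [inner_add_left, inner_smul_left, inner_smul_right]
    rw [real_inner_comm (Y x) (Z x), real_inner_comm (X x) (Z x)]
    ring
  add {Z Z'} hZ hZ' := by
    have e1 : (fun p ↦ inner ℝ (X p) ((Z + Z') p)) =
        (fun p ↦ inner ℝ (X p) (Z p)) + (fun p ↦ inner ℝ (X p) (Z' p)) := by
      ext p; simp [inner_add_right]
    have e2 : (fun p ↦ inner ℝ (Y p) ((Z + Z') p)) =
        (fun p ↦ inner ℝ (Y p) (Z p)) + (fun p ↦ inner ℝ (Y p) (Z' p)) := by
      ext p; simp [inner_add_right]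
    simp only [koszul, e1, e2]
    rw [mvfderiv_add (mdiff_inner hX hZ) (mdiff_inner hX hZ'),
      mvfderiv_add (mdiff_inner hY hZ) (mdiff_inner hY hZ'),
      VectorField.mlieBracket_add_right hZ hZ', VectorField.mlieBracket_add_right hZ hZ']
    simp [inner_add_left, inner_add_right]
    ring

/-- The bilinear form `(u, w) ↦ g(∇_u Y, w)` on `T_x M`, for a field `Y` differentiable at `x`. -/
def covForm (Y : Π x : M, TangentSpace 𝓘(ℝ, E) x) (x : M) (hY : MDiffAt (T% Y) x) :
    TangentSpace 𝓘(ℝ, E) x →L[ℝ] TangentSpace 𝓘(ℝ, E) x →L[ℝ] ℝ :=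
  (1 / 2 : ℝ) • TensorialAt.mkHom₂ (I := 𝓘(ℝ, E)) (F := E) (F' := E) (fun X Z ↦ koszul Y X Z x) x
    (fun _ hZ ↦ koszul_tensorial_left hY hZ) (fun _ hX ↦ koszul_tensorial_right hY hX)

open scoped Classical in
/-- The endomorphism `u ↦ ∇_u Y` of `T_x M`, obtained from `covForm` by the Riesz isomorphism
(and `0` if `Y` is not differentiable at `x`). -/
def leviCivitaFun (Y : Π x : M, TangentSpace 𝓘(ℝ, E) x) (x : M) :
    TangentSpace 𝓘(ℝ, E) x →L[ℝ] TangentSpace 𝓘(ℝ, E) x :=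
  haveI := complete_tangent (E := E) x
  if hY : MDiffAt (T% Y) x then
    InnerProductSpace.continuousLinearMapOfBilin (𝕜 := ℝ) (covForm Y x hY) else 0

theorem inner_leviCivitaFun {Y X Z : Π x : M, TangentSpace 𝓘(ℝ, E) x} {x : M}
    (hY : MDiffAt (T% Y) x) (hX : MDiffAt (T% X) x) (hZ : MDiffAt (T% Z) x) :
    inner ℝ (leviCivitaFun Y x (X x)) (Z x) = koszul Y X Z x / 2 := by
  have := complete_tangent (E := E) x
  have h := TensorialAt.mkHom₂_apply (I := 𝓘(ℝ, E)) (F := E) (F' := E)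
    (Φ := fun X Z ↦ koszul Y X Z x)
    (fun _ hZ ↦ koszul_tensorial_left hY hZ) (fun _ hX ↦ koszul_tensorial_right hY hX) hX hZ
  simp only [leviCivitaFun, hY, dif_pos]
  erw [InnerProductSpace.continuousLinearMapOfBilin_apply]
  simp [covForm, h]
  ring

/-- Two endomorphisms of `T_x M` agree if they pair equally with all differentiable fields. -/
theorem clm_ext {x : M} {A B : TangentSpace 𝓘(ℝ, E) x →L[ℝ] TangentSpace 𝓘(ℝ, E) x}
    (h : ∀ X Z : Π x : M, TangentSpace 𝓘(ℝ, E) x, MDiffAt (T% X) x → MDiffAt (T% Z) x →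
      inner ℝ (A (X x)) (Z x) = inner ℝ (B (X x)) (Z x)) : A = B := by
  ext u
  refine ext_inner_right ℝ fun w ↦ ?_
  simpa using h (FiberBundle.extend E u) (FiberBundle.extend E w)
    (FiberBundle.mdifferentiableAt_extend ..) (FiberBundle.mdifferentiableAt_extend ..)

/-- The Levi-Civita connection, `leviCivita Y x u = (∇_u Y)(x)`. -/
def leviCivita : CovariantDerivative 𝓘(ℝ, E) E (fun x : M ↦ TangentSpace 𝓘(ℝ, E) x) where
  toFun := leviCivitaFun
  isCovariantDerivativeOnUniv :=
    { add := by
        intro Y Y' x hY hY' _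
        refine clm_ext fun X Z hX hZ ↦ ?_
        have e1 : (fun p ↦ inner ℝ ((Y + Y') p) (Z p)) =
            (fun p ↦ inner ℝ (Y p) (Z p)) + (fun p ↦ inner ℝ (Y' p) (Z p)) := by
          ext p; simp [inner_add_left]
        have e2 : (fun p ↦ inner ℝ (X p) ((Y + Y') p)) =
            (fun p ↦ inner ℝ (X p) (Y p)) + (fun p ↦ inner ℝ (X p) (Y' p)) := by
          ext p; simp [inner_add_right]
        rw [inner_leviCivitaFun (mdifferentiableAt_add_section hY hY') hX hZ,
          add_apply, inner_add_left,
          inner_leviCivitaFun hY hX hZ, inner_leviCivitaFun hY' hX hZ]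
        simp only [koszul, e1, e2]
        rw [mvfderiv_add (mdiff_inner hY hZ) (mdiff_inner hY' hZ),
          mvfderiv_add (mdiff_inner hX hY) (mdiff_inner hX hY'),
          VectorField.mlieBracket_add_left hY hY', VectorField.mlieBracket_add_right hY hY']
        simp [inner_add_left, inner_add_right]
        ring
      leibniz := by
        intro Y f x hY hf _
        refine clm_ext fun X Z hX hZ ↦ ?_
        have e1 : (fun p ↦ inner ℝ ((f • Y) p) (Z p)) = f * (fun p ↦ inner ℝ (Y p) (Z p)) := by
          ext p; simp [inner_smul_left]
        have e2 : (fun p ↦ inner ℝ (X p) ((f • Y) p)) = f * (fun p ↦ inner ℝ (X p) (Y p)) := by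
          ext p; simp [inner_smul_right]
        rw [inner_leviCivitaFun (hf.smul_section hY) hX hZ,
          add_apply, inner_add_left, smul_apply,
          inner_smul_left, inner_leviCivitaFun hY hX hZ]
        simp only [koszul, e1, e2]
        rw [mvfderiv_mul hf (mdiff_inner hY hZ), mvfderiv_mul hf (mdiff_inner hX hY),
          VectorField.mlieBracket_smul_left hf hY, VectorField.mlieBracket_smul_right hf hY]
        simp [inner_add_left, inner_smul_left, inner_smul_right]
        rw [real_inner_comm (Y x) (X x)]
        ring }

/-- `∇` is compatible with the metric: `X g(Y, Z) = g(∇_X Y, Z) + g(Y, ∇_X Z)`. -/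
theorem leviCivita_metric {X Y Z : Π x : M, TangentSpace 𝓘(ℝ, E) x} {x : M}
    (hX : MDiffAt (T% X) x) (hY : MDiffAt (T% Y) x) (hZ : MDiffAt (T% Z) x) :
    mvfderiv 𝓘(ℝ, E) (fun p ↦ inner ℝ (Y p) (Z p)) x (X x) =
      inner ℝ (leviCivita Y x (X x)) (Z x) + inner ℝ (Y x) (leviCivita Z x (X x)) := by
  have h1 := inner_leviCivitaFun hY hX hZ
  have h2 := inner_leviCivitaFun hZ hX hY
  change _ = inner ℝ (leviCivitaFun Y x (X x)) (Z x) + inner ℝ (Y x) (leviCivitaFun Z x (X x))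
  rw [real_inner_comm (leviCivitaFun Z x (X x)), h1, h2]
  have c : (fun p ↦ inner ℝ (Z p) (Y p)) = (fun p ↦ inner ℝ (Y p) (Z p)) := by
    ext p; exact real_inner_comm _ _
  simp only [koszul, c, VectorField.mlieBracket_swap_apply (V := Z) (W := Y), inner_neg_left]
  ring

/-- `∇` is torsion-free. -/
theorem leviCivita_torsion : (leviCivita (E := E) (M := M)).torsion = 0 := by
  have : CompleteSpace E := FiniteDimensional.complete ℝ E
  rw [CovariantDerivative.torsion_eq_zero_iff]
  intro X Y x hX hY
  refine ext_inner_right ℝ fun w ↦ ?_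
  obtain ⟨Z, hZ, rfl⟩ : ∃ Z : Π x : M, TangentSpace 𝓘(ℝ, E) x, MDiffAt (T% Z) x ∧ Z x = w :=
    ⟨FiberBundle.extend E w, FiberBundle.mdifferentiableAt_extend .., by simp⟩
  change inner ℝ (leviCivitaFun Y x (X x) - leviCivitaFun X x (Y x)) (Z x) = _
  rw [inner_sub_left, inner_leviCivitaFun hY hX hZ, inner_leviCivitaFun hX hY hZ]
  have c : (fun p ↦ inner ℝ (Y p) (X p)) = (fun p ↦ inner ℝ (X p) (Y p)) := by
    ext p; exact real_inner_comm _ _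
  simp only [koszul, c, VectorField.mlieBracket_swap_apply (V := Y) (W := X), inner_neg_left]
  ring

end LeviCivita

section Functions

variable (E : Type*) [NormedAddCommGroup E] [NormedSpace ℝ E] [FiniteDimensional ℝ E]
  {M : Type*} [TopologicalSpace M] [ChartedSpace E M]

/-- The set of critical points of `τ`. -/
def critSet (τ : M → ℝ) : Set M := {x | mvfderiv 𝓘(ℝ, E) τ x = 0}

/-- The connected component of the critical set of `τ` that contains the critical point `x`. -/
def critComponent (τ : M → ℝ) (x : M) : Set M := connectedComponentIn (critSet E τ) x

/-- `S` is an (embedded, `C^∞`) submanifold of `M` of codimension `k` at each of its points: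
near each point it is, in some chart of the smooth structure, an affine subspace of
codimension `k`. -/
def IsSubmanifoldOfCodim (k : ℕ) (S : Set M) : Prop :=
  ∀ y ∈ S, ∃ φ ∈ IsManifold.maximalAtlas 𝓘(ℝ, E) ∞ M, y ∈ φ.source ∧
    ∃ F : Submodule ℝ E, Module.finrank ℝ (E ⧸ F) = k ∧
      ∀ x ∈ φ.source, x ∈ S ↔ φ x - φ y ∈ F

variable [RiemannianBundle (fun x : M ↦ TangentSpace 𝓘(ℝ, E) x)]

/-- The gradient of `τ`: `g(grad τ, w) = dτ(w)`. -/
def grad (τ : M → ℝ) (x : M) : TangentSpace 𝓘(ℝ, E) x :=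
  haveI := complete_tangent (E := E) x
  (InnerProductSpace.toDual ℝ (TangentSpace 𝓘(ℝ, E) x)).symm (mvfderiv 𝓘(ℝ, E) τ x)

/-- `Q = g(grad τ, grad τ)`. -/
def gradSq (τ : M → ℝ) (x : M) : ℝ := inner ℝ (grad E τ x) (grad E τ x)

variable [IsManifold 𝓘(ℝ, E) ∞ M]
  [IsContMDiffRiemannianBundle 𝓘(ℝ, E) ∞ E (fun x : M ↦ TangentSpace 𝓘(ℝ, E) x)]

/-- The Hessian `∇dτ` at `x`, as the endomorphism `u ↦ ∇_u (grad τ)` of `T_x M` that corresponds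
to it via `g`. -/
def hess (τ : M → ℝ) (x : M) : TangentSpace 𝓘(ℝ, E) x →L[ℝ] TangentSpace 𝓘(ℝ, E) x :=
  leviCivita (grad E τ) x

/-- `v = grad τ` is a geodesic vector field: `∇_v v = ψ v` wherever `v ≠ 0`, for some
function `ψ`. -/
def HasGeodesicGradient (τ : M → ℝ) : Prop :=
  ∃ ψ : M → ℝ, ∀ x, grad E τ x ≠ 0 →
    leviCivita (grad E τ) x (grad E τ x) = ψ x • grad E τ x

/-- Morse–Bott functions: `C^∞` functions for which the connected components of the critical set
are mutually isolated submanifolds, the rank of the Hessian at each critical point being the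
codimension of the component that contains the point. -/
def IsMorseBott (τ : M → ℝ) : Prop :=
  ContMDiff 𝓘(ℝ, E) 𝓘(ℝ, ℝ) ∞ τ ∧
  ∀ x ∈ critSet E τ,
    (∃ U : Set M, IsOpen U ∧ U ∩ critSet E τ = critComponent E τ x) ∧
    ∃ k : ℕ, IsSubmanifoldOfCodim E k (critComponent E τ x) ∧
      ∀ y ∈ critComponent E τ x,
        Module.finrank ℝ (hess E τ y : TangentSpace 𝓘(ℝ, E) y →ₗ[ℝ] TangentSpace 𝓘(ℝ, E) y).range = k

end Functions

/-- `f` maps `A` homeomorphically onto `B`. -/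
def IsHomeoOn (f : ℝ → ℝ) (A B : Set ℝ) : Prop :=
  ∃ h : ℝ → ℝ, Set.MapsTo f A B ∧ Set.MapsTo h B A ∧ Set.InvOn h f A B ∧
    ContinuousOn f A ∧ ContinuousOn h B

/-- `f` maps `A` `C^∞`-diffeomorphically onto `B`. -/
def IsDiffeoOn (f : ℝ → ℝ) (A B : Set ℝ) : Prop :=
  ∃ h : ℝ → ℝ, Set.MapsTo f A B ∧ Set.MapsTo h B A ∧ Set.InvOn h f A B ∧
    ContDiffOn ℝ ∞ f A ∧ ContDiffOn ℝ ∞ h B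

end RiemGeom

end

open RiemGeom

set_option linter.unusedSectionVars false

/-! The condition `∇_v v = ψ v` says that `dQ = 2ψ dτ` off the critical set, so `dQ` and `dτ` are
proportional everywhere. Hence `Q` is locally constant on regular levels, and it is a function of
`τ` once levels are known to be connected.

Critical points. Let `H` be the Hessian endomorphism at a critical point. To second order `τ` is
given by `g(Hw, w)` and `Q` by `2 g(Hw, Hw)`. Dividing the proportionality of `dQ` and `dτ` by `r²`
along a line `r ↦ y + r w` and letting `r → 0` shows that `H(Hw)` is parallel to `Hw` for each `w`.
A nonzero symmetric `H` with this property satisfies `H² = aH` with `a ≠ 0`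
(`exists_apply_apply_eq_smul`), and `H ≠ 0` because its rank is the codimension. So `a` is the only
nonzero eigenvalue, every critical manifold consists of local minima or of local maxima, and along
transverse lines `Q / (τ - τ(y))` tends to `2a`.

Connected levels. Near a local maximum the strict sublevel set is the complement of a submanifold of
codimension at least `2`, hence connected; this is where the codimension enters. A separation of a
level into two closed pieces therefore propagates upward through all slabs, and downward by the same
argument for `-τ`, until it disconnects `M` (`isPreconnected_level`). No flow and no Morse normal
form is used. Since the critical set is open and closed in its level, a critical level consists of
critical points only, all of one type; then the sublevel or superlevel set it bounds is open and
closed, so the only critical values are the two extremes.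

The profile. Inside the interval `χ` is smooth because `τ` is a local coordinate on a suitable line.
At an endpoint `±(τ - τ(y))` is the square of a local coordinate on a transverse line, `Q` is an
even function of that coordinate, and Whitney's theorem on even functions applies.

Distance. The endpoint zeros of `χ` are simple, so `χ^(-1/2)` is integrable and has a primitive `s`.
Formally `s ∘ τ` has unit gradient. That `s ∘ τ` is `1`-Lipschitz follows by approximating `s` with
`C^1` functions, and gives one inequality for the distance. The other follows by minimizing `k
s(τ(y)) + dist(x, y)` over `y` with `k > 1`: moving along the negative gradient shows that a
minimizer can only lie on the minimum level (`infDist_le`). -/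

section

open Filter Set

/-! ### One variable: Hadamard's lemma, even functions, smoothness of a factor `χ` in `q = χ ∘ T`.
-/

namespace RealCalculus

theorem hasDerivAt_integral_pow_mul_comp_mul {k : ℝ → ℝ} (hk : ContDiff ℝ 1 k) (m : ℕ) (x : ℝ) :
    HasDerivAt (fun x ↦ ∫ t in (0 : ℝ)..1, t ^ m * k (t * x))
      (∫ t in (0 : ℝ)..1, t ^ (m + 1) * deriv k (t * x)) x := by
  have hk' : Continuous (deriv k) := hk.continuous_deriv le_rfl
  obtain ⟨C, hC⟩ := ((isCompact_Icc (a := (0 : ℝ)) (b := 1)).prod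
    (isCompact_closedBall x 1)).exists_bound_of_continuousOn
    (f := fun p : ℝ × ℝ ↦ p.1 ^ (m + 1) * deriv k (p.1 * p.2)) (by fun_prop)
  refine (intervalIntegral.hasDerivAt_integral_of_dominated_loc_of_deriv_le
    (F := fun x t ↦ t ^ m * k (t * x)) (F' := fun x t ↦ t ^ (m + 1) * deriv k (t * x))
    (bound := fun _ ↦ C) (s := Metric.closedBall x 1) (Metric.closedBall_mem_nhds x one_pos)
    ?_ ?_ ?_ ?_ ?_ ?_).2
  · refine Eventually.of_forall fun y ↦ Continuous.aestronglyMeasurable ?_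
    have := hk.continuous
    fun_prop
  · refine Continuous.intervalIntegrable ?_ _ _
    have := hk.continuous
    fun_prop
  · exact Continuous.aestronglyMeasurable (by fun_prop)
  · refine Eventually.of_forall fun t ht y hy ↦ hC (t, y) ⟨?_, hy⟩
    rw [uIoc_of_le zero_le_one] at ht
    exact ⟨ht.1.le, ht.2⟩
  · exact intervalIntegrable_const
  · refine Eventually.of_forall fun t _ y _ ↦ ?_
    have h1 : HasDerivAt (fun y ↦ k (t * y)) (deriv k (t * y) * (t * 1)) y :=
      HasDerivAt.comp y ((hk.differentiable one_ne_zero (t * y)).hasDerivAt)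
        ((hasDerivAt_id y).const_mul t)
    exact (h1.const_mul (t ^ m)).congr_deriv (by ring)

/-- Each differentiation in `x` brings out one more factor `t`; the weight `t ^ m` is carried along
to make the induction on `n` close. -/
theorem contDiff_integral_pow_mul_comp_mul (n : ℕ) {k : ℝ → ℝ} (hk : ContDiff ℝ n k) (m : ℕ) :
    ContDiff ℝ n (fun x ↦ ∫ t in (0 : ℝ)..1, t ^ m * k (t * x)) := by
  induction n generalizing k m with
  | zero =>
    refine contDiff_zero.2 (intervalIntegral.continuous_parametric_intervalIntegral_of_continuous'
      ?_ _ _)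
    have := hk.continuous
    fun_prop
  | succ n ih =>
    have h1 : ContDiff ℝ 1 k := hk.of_le (by exact_mod_cast Nat.le_add_left 1 n)
    push_cast at hk ⊢
    rw [contDiff_succ_iff_deriv] at hk ⊢
    refine ⟨fun x ↦ (hasDerivAt_integral_pow_mul_comp_mul h1 m x).differentiableAt, by simp, ?_⟩
    rw [show deriv (fun x ↦ ∫ t in (0 : ℝ)..1, t ^ m * k (t * x)) = _ from
      funext fun x ↦ (hasDerivAt_integral_pow_mul_comp_mul h1 m x).deriv]
    exact ih hk.2.2 (m + 1)

theorem dslope_eq_integral {f : ℝ → ℝ} (hf : ContDiff ℝ 1 f) (x : ℝ) :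
    dslope f 0 x = ∫ t in (0 : ℝ)..1, t ^ 0 * deriv f (t * x) := by
  rcases eq_or_ne x 0 with rfl | hx
  · simp
  · rw [dslope_of_ne _ hx, slope_def_field]
    have h := intervalIntegral.integral_comp_mul_right (a := 0) (b := 1) (deriv f) hx
    simp only [pow_zero, one_mul, h, zero_mul, smul_eq_mul]
    rw [intervalIntegral.integral_deriv_eq_sub
      (fun y _ ↦ hf.differentiable one_ne_zero y)
      ((hf.continuous_deriv le_rfl).intervalIntegrable _ _)]
    field_simp
    ring

/-- A cutoff by a bump function. It allows the integral formula for `dslope`, which needs a globally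
`C^1` function, to be used for germs at `0`. -/
theorem exists_contDiff_eventuallyEq {n : ℕ} {f : ℝ → ℝ} (hf : ContDiffAt ℝ n f 0) :
    ∃ g : ℝ → ℝ, ContDiff ℝ n g ∧ g =ᶠ[𝓝 0] f := by
  obtain ⟨u, hu, hfu⟩ := hf.contDiffOn le_rfl (by simp)
  obtain ⟨ε, hε, hball⟩ := Metric.mem_nhds_iff.1 hu
  let φ : ContDiffBump (0 : ℝ) := ⟨ε / 4, ε / 2, by positivity, by linarith⟩
  refine ⟨fun x ↦ φ x * f x, ?_, ?_⟩
  · rw [contDiff_iff_contDiffAt]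
    intro x
    by_cases hx : x ∈ Metric.ball (0 : ℝ) ε
    · exact φ.contDiffAt.mul ((hfu.mono hball).contDiffAt (Metric.isOpen_ball.mem_nhds hx))
    · have : (fun x ↦ φ x * f x) =ᶠ[𝓝 x] fun _ ↦ 0 := by
        have hx' : x ∈ (Metric.closedBall (0 : ℝ) (ε / 2))ᶜ := fun h ↦
          hx (Metric.closedBall_subset_ball (by linarith) h)
        filter_upwards [Metric.isClosed_closedBall.isOpen_compl.mem_nhds hx'] with y hy
        have hy' : ¬ dist y 0 ≤ ε / 2 := hy
        rw [φ.zero_of_le_dist (not_le.1 hy').le, zero_mul]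
      exact contDiffAt_const.congr_of_eventuallyEq this
  · filter_upwards [φ.eventuallyEq_one] with x hx
    simp [hx]

/-- Hadamard's lemma. -/
theorem contDiffAt_dslope {f : ℝ → ℝ} (hf : ContDiffAt ℝ ∞ f 0) :
    ContDiffAt ℝ ∞ (dslope f 0) 0 := by
  rw [contDiffAt_infty] at hf ⊢
  intro n
  obtain ⟨g, hg, hgf⟩ := exists_contDiff_eventuallyEq (hf (n + 1))
  have h1 : ContDiff ℝ 1 g := hg.of_le (by exact_mod_cast Nat.le_add_left 1 n)
  have e : dslope f 0 =ᶠ[𝓝 0] fun x ↦ ∫ t in (0 : ℝ)..1, t ^ 0 * deriv g (t * x) := by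
    filter_upwards [hgf] with x hx
    rw [← dslope_eq_integral h1]
    rcases eq_or_ne x 0 with rfl | hx0
    · simp [hgf.deriv_eq]
    · rw [dslope_of_ne _ hx0, dslope_of_ne _ hx0, slope_def_field, slope_def_field, hx, hgf.eq_of_nhds]
  refine ContDiffAt.congr_of_eventuallyEq ?_ e
  refine (contDiff_integral_pow_mul_comp_mul n ?_ 0).contDiffAt
  push_cast at hg
  exact (contDiff_succ_iff_deriv.1 hg).2.2

theorem mul_dslope_zero {f : ℝ → ℝ} (hf : f 0 = 0) (x : ℝ) : x * dslope f 0 x = f x := by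
  have := sub_smul_dslope f 0 x
  simpa [hf] using this

theorem contDiffAt_deriv_infty {f : ℝ → ℝ} {x : ℝ} (hf : ContDiffAt ℝ ∞ f x) :
    ContDiffAt ℝ ∞ (deriv f) x := by
  have := (hf.fderiv_right (m := ∞) (by simp)).clm_apply (contDiffAt_const (c := (1 : ℝ)))
  simpa only [fderiv_apply_one_eq_deriv] using this

/-- The second difference quotient of a function vanishing to second order. -/
theorem deriv_dslope_zero {f : ℝ → ℝ} (hf : ContDiffAt ℝ ∞ f 0) (h0 : f 0 = 0) :
    deriv (dslope f 0) 0 = deriv (deriv f) 0 / 2 := by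
  have hs := contDiffAt_dslope hf
  have hd : ∀ᶠ x in 𝓝 0, DifferentiableAt ℝ (dslope f 0) x :=
    ((hs.of_le (m := 1) (by simp)).eventually (by simp)).mono
      fun x hx ↦ hx.differentiableAt one_ne_zero
  have e : deriv f =ᶠ[𝓝 0] fun x ↦ dslope f 0 x + x * deriv (dslope f 0) x := by
    filter_upwards [hd] with x hx
    have := ((hasDerivAt_id x).mul hx.hasDerivAt).deriv
    rw [show (id * dslope f 0) = f from funext fun y ↦ mul_dslope_zero h0 y] at this
    simpa using this
  rw [e.deriv_eq]
  have h1 := (hs.differentiableAt (by simp)).hasDerivAt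
  have h2 := ((contDiffAt_deriv_infty hs).differentiableAt (by simp)).hasDerivAt
  have := h1.add ((hasDerivAt_id 0).mul h2)
  have h3 := this.deriv
  simp only [id, one_mul, zero_mul, add_zero] at h3
  have h4 : deriv (fun x ↦ dslope f 0 x + x * deriv (dslope f 0) x) 0
    = deriv (dslope f 0) 0 + deriv (dslope f 0) 0 := h3
  rw [h4]; ring

theorem tendsto_div_sq {f : ℝ → ℝ} (hf : ContDiffAt ℝ ∞ f 0) (h0 : f 0 = 0)
    (h1 : deriv f 0 = 0) :
    Tendsto (fun x ↦ f x / x ^ 2) (𝓝[≠] 0) (𝓝 (deriv (deriv f) 0 / 2)) := by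
  have hs := contDiffAt_dslope (contDiffAt_dslope hf)
  have h2 : dslope f 0 0 = 0 := by simpa using h1
  have := hs.continuousAt.tendsto.mono_left (nhdsWithin_le_nhds (s := {0}ᶜ))
  rw [dslope_same, deriv_dslope_zero hf h0] at this
  refine this.congr' ?_
  filter_upwards [self_mem_nhdsWithin] with x hx
  have hx : x ≠ 0 := hx
  rw [← mul_dslope_zero h0 x, ← mul_dslope_zero h2 x]
  field_simp

/-- The derivative of `f(√u)` is `h(√u)` with `h(x) = f'(x) / (2x)`. As `f'` is odd, `h` is smooth
by Hadamard's lemma and again even, so the induction continues. At `u = 0`, where `√` is not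
differentiable, the one-sided derivative is obtained as the limit of the derivatives from the right.
-/
theorem contDiffWithinAt_comp_sqrt_nat (n : ℕ) {f : ℝ → ℝ} (hf : ContDiffAt ℝ ∞ f 0)
    (he : ∀ᶠ x in 𝓝 0, f (-x) = f x) :
    ContDiffWithinAt ℝ n (fun u ↦ f (√u)) (Ici 0) 0 := by
  have hsq : Tendsto Real.sqrt (𝓝 0) (𝓝 0) := by
    simpa using Real.continuous_sqrt.tendsto 0
  induction n generalizing f with
  | zero =>
    have : ∀ᶠ x in 𝓝 (0 : ℝ), ContinuousAt f x :=
      ((hf.of_le (m := 1) (by simp)).eventually (by simp)).mono fun x hx ↦ hx.continuousAt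
    refine (contDiffWithinAt_zero (by simp)).2 ⟨{u | ContinuousAt f (√u)},
      mem_nhdsWithin_of_mem_nhds (hsq.eventually this), fun u hu ↦ ?_⟩
    exact (ContinuousAt.comp (f := Real.sqrt) hu.2
      Real.continuous_sqrt.continuousAt).continuousWithinAt
  | succ n ih =>
    have hd : ∀ᶠ x in 𝓝 0, DifferentiableAt ℝ f x :=
      ((hf.of_le (m := 1) (by simp)).eventually (by simp)).mono
        fun x hx ↦ hx.differentiableAt one_ne_zero
    have hodd : ∀ᶠ x in 𝓝 0, deriv f (-x) = - deriv f x := by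
      filter_upwards [he.eventually_nhds] with x hx
      have h2 : deriv (fun y ↦ f (-y)) x = deriv f x := EventuallyEq.deriv_eq hx
      rw [deriv_comp_neg] at h2
      linarith
    have hd0 : deriv f 0 = 0 := by
      have := hodd.self_of_nhds
      simp only [neg_zero] at this
      linarith
    set h : ℝ → ℝ := fun x ↦ dslope (deriv f) 0 x / 2 with hh
    have hsm : ContDiffAt ℝ ∞ h 0 :=
      (contDiffAt_dslope (contDiffAt_deriv_infty hf)).div_const 2
    have heven : ∀ᶠ x in 𝓝 0, h (-x) = h x := by
      filter_upwards [hodd] with x hx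
      rcases eq_or_ne x 0 with rfl | hx0
      · simp
      · simp only [hh]
        rw [dslope_of_ne _ hx0, dslope_of_ne _ (neg_ne_zero.2 hx0), slope_def_field,
          slope_def_field, hx, hd0]
        simp only [sub_zero, neg_div_neg_eq]
    have key : ∀ u > 0, DifferentiableAt ℝ f (√u) →
        HasDerivAt (fun u ↦ f (√u)) (h (√u)) u := by
      intro u hu hdu
      refine (hdu.hasDerivAt.comp u (Real.hasDerivAt_sqrt hu.ne')).congr_deriv ?_
      have hs := (Real.sqrt_pos.2 hu).ne'
      have h3 := mul_dslope_zero hd0 (√u)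
      simp only [hh]
      rw [← h3]
      field_simp
    have hev : ∀ᶠ u in 𝓝[>] (0 : ℝ), HasDerivAt (fun u ↦ f (√u)) (h (√u)) u := by
      filter_upwards [self_mem_nhdsWithin, mem_nhdsWithin_of_mem_nhds (hsq.eventually hd)]
        with u hu hdu using key u hu hdu
    have hzero : HasDerivWithinAt (fun u ↦ f (√u)) (h (√0)) (Ici 0) 0 := by
      refine hasDerivWithinAt_Ici_of_tendsto_deriv
        (s := {u | HasDerivAt (fun u ↦ f (√u)) (h (√u)) u})
        (fun u hu ↦ (HasDerivAt.differentiableAt hu).differentiableWithinAt) ?_ hev ?_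
      · refine ContinuousAt.continuousWithinAt (ContinuousAt.comp (f := Real.sqrt) ?_
          Real.continuous_sqrt.continuousAt)
        rw [Real.sqrt_zero]
        exact hf.continuousAt
      · have : Tendsto (fun u ↦ h (√u)) (𝓝[>] 0) (𝓝 (h (√0))) := by
          have hc : ContinuousAt h (√0) := by
            rw [Real.sqrt_zero]
            exact hsm.continuousAt
          exact Tendsto.mono_left (ContinuousAt.comp (f := Real.sqrt) hc
            Real.continuous_sqrt.continuousAt).tendsto nhdsWithin_le_nhds
        exact this.congr' (hev.mono fun u hu ↦ hu.deriv.symm)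
    push_cast
    rw [contDiffWithinAt_succ_iff_hasFDerivWithinAt (by simp)]
    refine ⟨{u | 0 ≤ u ∧ DifferentiableAt ℝ f (√u)}, ?_, by simp,
      fun u ↦ ContinuousLinearMap.toSpanSingleton ℝ (h (√u)), ?_, ?_⟩
    · rw [insert_eq_of_mem (by simp)]
      filter_upwards [self_mem_nhdsWithin, mem_nhdsWithin_of_mem_nhds (hsq.eventually hd)]
        with u hu hdu using ⟨hu, hdu⟩
    · rintro u ⟨hu, hdu⟩
      have hmono : {u | 0 ≤ u ∧ DifferentiableAt ℝ f (√u)} ⊆ Ici 0 := fun v hv ↦ hv.1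
      rcases hu.eq_or_lt with rfl | hu
      · exact (hzero.mono hmono).hasFDerivWithinAt
      · exact ((key u hu hdu).hasDerivWithinAt).hasFDerivWithinAt
    · have h4 := ih hsm heven
      have h5 : ContDiffWithinAt ℝ n
          (fun u ↦ (ContinuousLinearMap.smulRightL ℝ ℝ ℝ (ContinuousLinearMap.id ℝ ℝ)) (h (√u)))
          (Ici 0) 0 :=
        (ContinuousLinearMap.contDiff _).contDiffAt.comp_contDiffWithinAt 0 h4
      refine (h5.congr (fun u _ ↦ ?_) ?_).mono fun v hv ↦ hv.1
      all_goals
        ext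
        simp

/-- Whitney's theorem on even functions. -/
theorem contDiffWithinAt_comp_sqrt {f : ℝ → ℝ} (hf : ContDiffAt ℝ ∞ f 0)
    (he : ∀ᶠ x in 𝓝 0, f (-x) = f x) :
    ContDiffWithinAt ℝ ∞ (fun u ↦ f (√u)) (Ici 0) 0 :=
  contDiffWithinAt_infty.2 fun n ↦ contDiffWithinAt_comp_sqrt_nat n hf he

/-- A smooth local inverse at a point where the derivative does not vanish. -/
theorem exists_local_inverse {σ : ℝ → ℝ} {x : ℝ} (hσ : ContDiffAt ℝ ∞ σ x) (h : deriv σ x ≠ 0) :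
    ∃ ρ : ℝ → ℝ, ContDiffAt ℝ ∞ ρ (σ x) ∧ ρ (σ x) = x ∧ ∀ᶠ s in 𝓝 (σ x), σ (ρ s) = s := by
  have hd : HasFDerivAt σ ((ContinuousLinearEquiv.unitsEquivAut ℝ (Units.mk0 _ h) :
      ℝ ≃L[ℝ] ℝ) : ℝ →L[ℝ] ℝ) x := by
    have := (hσ.differentiableAt (by simp)).hasDerivAt.hasFDerivAt
    refine this.congr_fderiv ?_
    ext
    simp
  refine ⟨hσ.localInverse hd (by simp), hσ.to_localInverse hd (by simp),
    hσ.localInverse_apply_image hd (by simp), ?_⟩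
  exact (hσ.hasStrictFDerivAt' hd (by simp)).eventually_right_inverse

theorem contDiffAt_of_comp_regular {T q χ : ℝ → ℝ} {x : ℝ} (hT : ContDiffAt ℝ ∞ T x)
    (hq : ContDiffAt ℝ ∞ q x) (h : deriv T x ≠ 0) (he : ∀ᶠ y in 𝓝 x, q y = χ (T y)) :
    ContDiffAt ℝ ∞ χ (T x) := by
  obtain ⟨ρ, hρ, hρx, hinv⟩ := exists_local_inverse hT h
  have h1 : ContDiffAt ℝ ∞ (q ∘ ρ) (T x) := ContDiffAt.comp _ (by rwa [hρx]) hρ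
  refine h1.congr_of_eventuallyEq ?_
  have hc : Tendsto ρ (𝓝 (T x)) (𝓝 x) := by simpa [ContinuousAt, hρx] using hρ.continuousAt
  filter_upwards [hinv, hc.eventually he] with s hs hes
  simp [hes, hs]

/-- If `q = χ ∘ T` near a nondegenerate zero minimum of `T`, with `q` and `T` smooth, then `χ` is
smooth up to the boundary. -/
theorem contDiffWithinAt_of_comp_min {T q χ : ℝ → ℝ} (hT : ContDiffAt ℝ ∞ T 0)
    (hq : ContDiffAt ℝ ∞ q 0) (h0 : T 0 = 0) (h1 : deriv T 0 = 0) (h2 : 0 < deriv (deriv T) 0)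
    (he : ∀ᶠ y in 𝓝 0, q y = χ (T y)) :
    ContDiffWithinAt ℝ ∞ χ (Ici 0) 0 := by
  set k := dslope (dslope T 0) 0 with hk
  have hks : ContDiffAt ℝ ∞ k 0 := contDiffAt_dslope (contDiffAt_dslope hT)
  have hk0 : 0 < k 0 := by
    rw [hk, dslope_same, deriv_dslope_zero hT h0]; positivity
  have hTk : ∀ x, T x = x ^ 2 * k x := fun x ↦ by
    rw [← mul_dslope_zero h0 x, ← mul_dslope_zero (f := dslope T 0) (by simpa using h1) x, hk]
    ring
  -- As `T = x² k` with `k(0) > 0`, one has `T = σ²` near `0`, and `σ` is a local coordinate.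
  -- Written in terms of `σ`, the function `q` depends only on `σ²`, so it is even.
  set σ : ℝ → ℝ := fun x ↦ x * √(k x) with hσ
  have hsq : ContDiffAt ℝ ∞ (fun x ↦ √(k x)) 0 := hks.sqrt hk0.ne'
  have hσs : ContDiffAt ℝ ∞ σ 0 := contDiffAt_id.mul hsq
  have hσ0 : σ 0 = 0 := by simp [hσ]
  have hσd : deriv σ 0 ≠ 0 := by
    have := ((hasDerivAt_id (0 : ℝ)).mul (hsq.differentiableAt (by simp)).hasDerivAt).deriv
    have e : deriv σ 0 = 1 * √(k 0) + 0 * deriv (fun x ↦ √(k x)) 0 := this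
    rw [one_mul, zero_mul, add_zero] at e
    rw [e]
    exact (Real.sqrt_pos.2 hk0).ne'
  obtain ⟨ρ, hρ, hρ0, hinv⟩ := exists_local_inverse hσs hσd
  rw [hσ0] at hρ hρ0 hinv
  have hc : Tendsto ρ (𝓝 0) (𝓝 0) := by simpa [ContinuousAt, hρ0] using hρ.continuousAt
  have hkpos : ∀ᶠ x in 𝓝 0, 0 < k x := hks.continuousAt.eventually (lt_mem_nhds hk0)
  have key : ∀ᶠ s in 𝓝 (0 : ℝ), q (ρ s) = χ (s ^ 2) := by
    filter_upwards [hinv, hc.eventually hkpos, hc.eventually he] with s hs hp hes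
    rw [hes, hTk, ← Real.sq_sqrt hp.le, ← mul_pow]
    congr 2
  have heven : ∀ᶠ s in 𝓝 (0 : ℝ), (q ∘ ρ) (-s) = (q ∘ ρ) s := by
    have hneg : Tendsto (fun s : ℝ ↦ -s) (𝓝 0) (𝓝 0) := by simpa using tendsto_neg (0 : ℝ)
    filter_upwards [key, hneg.eventually key] with s h1 h2
    simp only [Function.comp, h1, h2, neg_sq]
  have hqρ : ContDiffAt ℝ ∞ (q ∘ ρ) 0 := ContDiffAt.comp _ (by rwa [hρ0]) hρ
  refine (contDiffWithinAt_comp_sqrt hqρ heven).congr_of_eventuallyEq_of_mem ?_ (by simp)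
  have hsqrt : Tendsto Real.sqrt (𝓝 0) (𝓝 0) := by
    simpa using Real.continuous_sqrt.tendsto 0
  filter_upwards [self_mem_nhdsWithin, mem_nhdsWithin_of_mem_nhds (hsqrt.eventually key)]
    with u hu h3
  simp only [Function.comp, h3, Real.sq_sqrt (mem_Ici.1 hu)]

section Line

variable {E : Type*} [NormedAddCommGroup E] [NormedSpace ℝ E]

theorem contDiffAt_line {F : E → ℝ} {x : E} (hF : ContDiffAt ℝ ∞ F x) (w : E) :
    ContDiffAt ℝ ∞ (fun r : ℝ ↦ F (x + r • w)) 0 := by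
  refine ContDiffAt.comp (0 : ℝ) (by simpa using hF) ?_
  fun_prop

theorem hasDerivAt_line {F : E → ℝ} {x w : E} {r : ℝ} (hF : DifferentiableAt ℝ F (x + r • w)) :
    HasDerivAt (fun r : ℝ ↦ F (x + r • w)) (fderiv ℝ F (x + r • w) w) r := by
  have h1 : HasDerivAt (fun r : ℝ ↦ x + r • w) w r := by
    simpa using ((hasDerivAt_id r).smul_const w).const_add x
  exact hF.hasFDerivAt.comp_hasDerivAt r h1

theorem deriv_line {F : E → ℝ} {x : E} (hF : ContDiffAt ℝ ∞ F x) (w : E) :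
    deriv (fun r : ℝ ↦ F (x + r • w)) 0 = fderiv ℝ F x w := by
  simpa using (hasDerivAt_line (x := x) (w := w) (r := 0)
    (by simpa using hF.differentiableAt (by simp))).deriv

theorem deriv_deriv_line {F : E → ℝ} {x : E} (hF : ContDiffAt ℝ ∞ F x) (w : E) :
    deriv (deriv (fun r : ℝ ↦ F (x + r • w))) 0 = fderiv ℝ (fderiv ℝ F) x w w := by
  have hlim : Tendsto (fun r : ℝ ↦ x + r • w) (𝓝 0) (𝓝 x) := by
    have : Continuous fun r : ℝ ↦ x + r • w := by fun_prop
    simpa using this.tendsto 0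
  have hd : ∀ᶠ y in 𝓝 x, DifferentiableAt ℝ F y :=
    ((hF.of_le (m := 1) (by simp)).eventually (by simp)).mono
      fun x hx ↦ hx.differentiableAt one_ne_zero
  have e : deriv (fun r : ℝ ↦ F (x + r • w)) =ᶠ[𝓝 0] fun r ↦ fderiv ℝ F (x + r • w) w := by
    filter_upwards [hlim.eventually hd] with r hr using (hasDerivAt_line hr).deriv
  rw [e.deriv_eq]
  have h2 : HasFDerivAt (fun y ↦ fderiv ℝ F y w) ((fderiv ℝ (fderiv ℝ F) x).flip w) x := by
    have h3 := ((hF.fderiv_right (m := ∞) (by simp)).differentiableAt (by simp)).hasFDerivAt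
    simpa using h3.clm_apply (hasFDerivAt_const w x)
  have := (hasDerivAt_line (F := fun y ↦ fderiv ℝ F y w) (x := x) (w := w) (r := 0)
    (by simpa using h2.differentiableAt)).deriv
  rw [this]
  simp [h2.fderiv]

theorem tendsto_line_div_sq {F : E → ℝ} {x : E} (hF : ContDiffAt ℝ ∞ F x) (h0 : F x = 0)
    (h1 : fderiv ℝ F x = 0) (w : E) :
    Tendsto (fun r : ℝ ↦ F (x + r • w) / r ^ 2) (𝓝[≠] 0)
      (𝓝 (fderiv ℝ (fderiv ℝ F) x w w / 2)) := by
  rw [← deriv_deriv_line hF w]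
  exact tendsto_div_sq (contDiffAt_line hF w) (by simpa using h0) (by rw [deriv_line hF, h1]; rfl)

end Line

end RealCalculus

/-! ### Connectedness of levels from local connectedness of strict sublevel sets. -/

namespace LevelConnected

variable {M : Type*} [TopologicalSpace M]

/-- Near `p`, either `τ` has a local minimum, or the strict sublevel set of `τ` at level `τ p` is
locally connected at `p` and dense in the sublevel set; all local minima of `τ` near `p` are on
the level of `p`. -/
def SublevelConnectedAt (τ : M → ℝ) (p : M) : Prop :=
  (IsLocalMin τ p ∨
    ((∀ U ∈ 𝓝 p, ∃ W ∈ 𝓝 p, W ⊆ U ∧ IsPreconnected (W ∩ {q | τ q < τ p})) ∧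
      ∀ᶠ q in 𝓝 p, τ q ≤ τ p → q ∈ closure {z | τ z < τ p})) ∧
  ∀ᶠ q in 𝓝 p, IsLocalMin τ q → τ q = τ p

/-- The slab `t₀ ≤ τ ≤ t`. -/
def slab (τ : M → ℝ) (t₀ t : ℝ) : Set M := {x | t₀ ≤ τ x ∧ τ x ≤ t}

/-- `B` is a relatively clopen subset of the slab `t₀ ≤ τ ≤ t` that contains `P'`, does not
meet `P`, and contains no local minima of `τ` above the level `t₀`. -/
structure IsSplitting (τ : M → ℝ) (t₀ : ℝ) (P P' : Set M) (t : ℝ) (B : Set M) : Prop where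
  closed : IsClosed B
  closed' : IsClosed (slab τ t₀ t \ B)
  sub : B ⊆ slab τ t₀ t
  right : P' ⊆ B
  left : Disjoint P B
  notMin : ∀ p ∈ B, t₀ < τ p → ¬ IsLocalMin τ p

variable {τ : M → ℝ} {t₀ t s : ℝ} {P P' B C : Set M}

theorem isClosed_slab (hτ : Continuous τ) : IsClosed (slab τ t₀ t) :=
  (isClosed_le continuous_const hτ).inter (isClosed_le hτ continuous_const)

theorem IsSplitting.restrict (hτ : Continuous τ) (h : IsSplitting τ t₀ P P' t B)
    (hP' : P' ⊆ {x | τ x = t₀}) (h0 : t₀ ≤ s) (hs : s ≤ t) :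
    IsSplitting τ t₀ P P' s (B ∩ {x | τ x ≤ s}) where
  closed := h.closed.inter (isClosed_le hτ continuous_const)
  closed' := by
    convert h.closed'.inter (isClosed_le hτ (continuous_const (y := s))) using 1
    ext x
    simp only [slab, Set.mem_sdiff, mem_inter_iff, mem_ofPred_eq]
    constructor
    · rintro ⟨⟨a, b⟩, c⟩
      exact ⟨⟨⟨a, b.trans hs⟩, fun h ↦ c ⟨h, b⟩⟩, b⟩
    · rintro ⟨⟨⟨a, b⟩, c⟩, d⟩
      exact ⟨⟨a, d⟩, fun h ↦ c h.1⟩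
  sub := fun x hx ↦ ⟨(h.sub hx.1).1, hx.2⟩
  right := fun x hx ↦ ⟨h.right hx, (hP' hx).le.trans h0⟩
  left := h.left.mono_right inter_subset_left
  notMin := fun p hp ↦ h.notMin p hp.1

theorem IsSplitting.eventually_mem (h : IsSplitting τ t₀ P P' t B) {a : M} (ha : a ∈ B) :
    ∀ᶠ q in 𝓝 a, q ∈ slab τ t₀ t → q ∈ B := by
  have : a ∈ (slab τ t₀ t \ B)ᶜ := fun h' ↦ h'.2 ha
  filter_upwards [h.closed'.isOpen_compl.mem_nhds this] with q hq hq'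
  by_contra hqB
  exact hq ⟨hq', hqB⟩

/-- A lowest point of `B \ C` lies above `t₀`, because on the level `t₀` both sets are determined by
`P` and `P'`. As `B \ C` is relatively open in the slab, that point is a local minimum of `τ`, which
`notMin` forbids. Thus a splitting of a given slab is unique, and splittings of different slabs are
compatible. -/
theorem IsSplitting.subset [CompactSpace M] (hτ : Continuous τ)
    (hL : {x | τ x = t₀} ⊆ P ∪ P')
    (hB : IsSplitting τ t₀ P P' t B) (hC : IsSplitting τ t₀ P P' t C) : B ⊆ C := by
  by_contra hne
  obtain ⟨x, hxB, hxC⟩ := not_subset.1 hne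
  have hcl : IsClosed (B ∩ (slab τ t₀ t \ C)) := hB.closed.inter hC.closed'
  obtain ⟨p, hp, hmin⟩ := hcl.isCompact.exists_isMinOn
    ⟨x, hxB, hB.sub hxB, hxC⟩ hτ.continuousOn
  have hpt : t₀ < τ p := by
    refine lt_of_le_of_ne hp.2.1.1 fun he ↦ ?_
    rcases hL he.symm with h | h
    · exact disjoint_left.1 hB.left h hp.1
    · exact hp.2.2 (hC.right h)
  refine hB.notMin p hp.1 hpt ?_
  have h2 : ∀ᶠ q in 𝓝 p, q ∉ C := hC.closed.isOpen_compl.mem_nhds hp.2.2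
  filter_upwards [hB.eventually_mem hp.1, h2, hτ.continuousAt.eventually (lt_mem_nhds hpt)]
    with q hq1 hq2 hq3
  by_contra hlt
  have hlt : τ q < τ p := not_le.1 hlt
  have hslab : q ∈ slab τ t₀ t := ⟨hq3.le, hlt.le.trans hp.2.1.2⟩
  exact absurd (hmin ⟨hq1 hslab, hslab, hq2⟩) (not_le.2 hlt)

/-- The splittings below `t` fit together by uniqueness; the closure of their union is the splitting
at `t`. The only issue is relative openness on the new level `τ = t`, which is where local
connectedness of the strict sublevel set is used. -/
theorem IsSplitting.exists_limit [CompactSpace M] (hτ : Continuous τ)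
    (hL : {x | τ x = t₀} = P ∪ P') (hloc : ∀ p, SublevelConnectedAt τ p) (ht : t₀ < t)
    (h : ∀ s, t₀ ≤ s → s < t → ∃ B, IsSplitting τ t₀ P P' s B) :
    ∃ B, IsSplitting τ t₀ P P' t B := by
  choose! F hF using h
  have hP' : P' ⊆ {x | τ x = t₀} := hL ▸ subset_union_right
  have hP : P ⊆ {x | τ x = t₀} := hL ▸ subset_union_left
  have hcompat : ∀ r s, t₀ ≤ r → r ≤ s → s < t → F r = F s ∩ {x | τ x ≤ r} := fun r s h1 h2 h3 ↦
    Subset.antisymm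
      ((hF r h1 (h2.trans_lt h3)).subset hτ hL.subset ((hF s (h1.trans h2) h3).restrict hτ hP' h1 h2))
      (((hF s (h1.trans h2) h3).restrict hτ hP' h1 h2).subset hτ hL.subset
        (hF r h1 (h2.trans_lt h3)))
  set B₀ : Set M := {x | t₀ ≤ τ x ∧ τ x < t ∧ x ∈ F (τ x)} with hB₀
  have hmem : ∀ x s, τ x ≤ s → s < t → t₀ ≤ τ x → (x ∈ B₀ ↔ x ∈ F s) := by
    intro x s h1 h2 h3
    have := hcompat (τ x) s h3 h1 h2
    constructor
    · rintro ⟨-, -, h⟩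
      rw [this] at h
      exact h.1
    · intro h
      refine ⟨h3, h1.trans_lt h2, ?_⟩
      rw [this]
      exact ⟨h, le_refl (τ x)⟩
  -- `B₀` and its complement are open in the half-open slab
  have hopen : ∀ a ∈ B₀, ∀ᶠ q in 𝓝 a, t₀ ≤ τ q → q ∈ B₀ := by
    rintro a ⟨h1, h2, h3⟩
    obtain ⟨s, hs1, hs2⟩ := exists_between h2
    have haF := (hmem a s hs1.le hs2 h1).1 ⟨h1, h2, h3⟩
    filter_upwards [(hF s (h1.trans hs1.le) hs2).eventually_mem haF,
      hτ.continuousAt.eventually (gt_mem_nhds hs1)] with q hq1 hq2 hq3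
    exact (hmem q s hq2.le hs2 hq3).2 (hq1 ⟨hq3, hq2.le⟩)
  have hopen' : ∀ a, a ∉ B₀ → t₀ ≤ τ a → τ a < t → ∀ᶠ q in 𝓝 a, q ∉ B₀ := by
    intro a ha h1 h2
    obtain ⟨s, hs1, hs2⟩ := exists_between h2
    have haF : a ∉ F s := fun h ↦ ha ((hmem a s hs1.le hs2 h1).2 h)
    filter_upwards [(hF s (h1.trans hs1.le) hs2).closed.isOpen_compl.mem_nhds haF,
      hτ.continuousAt.eventually (gt_mem_nhds hs1)] with q hq1 hq2 hq3
    exact hq1 ((hmem q s hq2.le hs2 hq3.1).1 hq3)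
  have hclB : ∀ a ∈ closure B₀, t₀ ≤ τ a ∧ τ a ≤ t := by
    intro a ha
    have : closure B₀ ⊆ slab τ t₀ t :=
      closure_minimal (fun x hx ↦ ⟨hx.1, hx.2.1.le⟩) (isClosed_slab hτ)
    exact this ha
  have hcl : ∀ a ∈ closure B₀, τ a < t → a ∈ B₀ := by
    intro a ha hat
    by_contra hB
    obtain ⟨q, hq, hqB⟩ := ((mem_closure_iff_frequently.1 ha).and_eventually
      (hopen' a hB (hclB a ha).1 hat)).exists
    exact hqB hq
  -- A limit of points of `B₀` on the level `t` has strictly lower points arbitrarily near, so no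
  -- new local minimum enters the closure.
  have hnm : ∀ a ∈ closure B₀, τ a = t → ¬ IsLocalMin τ a := by
    intro a ha hat hmin
    obtain ⟨q, hq, hqB⟩ := ((mem_closure_iff_frequently.1 ha).and_eventually hmin).exists
    have := hq.2.1
    linarith
  refine ⟨closure B₀, isClosed_closure, ?_, fun a ha ↦ hclB a ha, ?_, ?_, ?_⟩
  · rw [← isOpen_compl_iff, isOpen_iff_mem_nhds]
    intro a ha
    by_cases haK : a ∈ slab τ t₀ t
    swap
    · filter_upwards [(isClosed_slab hτ).isOpen_compl.mem_nhds haK] with q hq hq'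
      exact hq hq'.1
    have haB : a ∈ closure B₀ := by
      by_contra h
      exact ha ⟨haK, h⟩
    rcases haK.2.lt_or_eq with hat | hat
    · filter_upwards [hopen a (hcl a haB hat)] with q hq hq'
      exact hq'.2 (subset_closure (hq hq'.1.1))
    · obtain ⟨hcon, hden⟩ := (hloc a).1.resolve_left (hnm a haB hat)
      rw [hat] at hcon hden
      obtain ⟨W, hW, hWU, hWc⟩ := hcon {q | t₀ < τ q}
        (hτ.continuousAt.eventually (lt_mem_nhds (hat ▸ ht)))
      -- `B₀` is open and closed relative to the connected set `W ∩ {τ < t}` and meets it, so it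
      -- contains all of it. The density half of the hypothesis then covers the points near `a` on
      -- the level `t` itself.
      have hWB : W ∩ {q | τ q < t} ⊆ B₀ := by
        obtain ⟨b, hb, hbW⟩ := ((mem_closure_iff_frequently.1 haB).and_eventually hW).exists
        have hint : ∀ z ∈ B₀, z ∈ W → z ∈ interior B₀ := fun z hz hzW ↦ by
          refine mem_interior_iff_mem_nhds.2 ?_
          filter_upwards [hopen z hz, hτ.continuousAt.eventually (lt_mem_nhds (hWU hzW))]
            with q hq1 hq2 using hq1 hq2.le
        refine (hWc.subset_of_closure_inter_subset isOpen_interior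
          ⟨b, ⟨hbW, hb.2.1⟩, hint b hb hbW⟩ ?_).trans interior_subset
        rintro z ⟨hz, hzW, hzt⟩
        exact hint z (hcl z (closure_mono interior_subset hz) hzt) hzW
      filter_upwards [hden, interior_mem_nhds.2 hW] with q hq1 hqW hq'
      refine hq'.2 (closure_mono hWB ?_)
      have := hq1 hq'.1.2
      rw [mem_closure_iff_nhds] at this ⊢
      intro V hV
      obtain ⟨z, hz1, hz2⟩ := this (V ∩ W) (inter_mem hV (mem_interior_iff_mem_nhds.1 hqW))
      exact ⟨z, hz1.1, hz1.2, hz2⟩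
  · intro x hx
    have hx0 : τ x = t₀ := hP' hx
    exact subset_closure ((hmem x t₀ hx0.le ht hx0.ge).2 ((hF t₀ le_rfl ht).right hx))
  · rw [disjoint_left]
    intro x hx hxB
    have hx0 : τ x = t₀ := hP hx
    have := (hmem x t₀ hx0.le ht hx0.ge).1 (hcl x hxB (hx0 ▸ ht))
    exact disjoint_left.1 (hF t₀ le_rfl ht).left hx this
  · intro p hp hpt
    rcases (hclB p hp).2.lt_or_eq with h | h
    · exact (hF (τ p) hpt.le h).notMin p (hcl p hp h).2.2 hpt
    · exact hnm p hp h

/-- `B` and its complement in the slab are disjoint compact sets, so disjoint open sets separate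
them, and a slightly higher slab is still covered by these. Local minima near the level `t` lie on
that level or below it, so `notMin` survives. -/
theorem IsSplitting.exists_extend [CompactSpace M] [T2Space M] (hτ : Continuous τ)
    (hloc : ∀ p, SublevelConnectedAt τ p) (ht : t₀ ≤ t) (hP : P ⊆ {x | τ x = t₀})
    (h : IsSplitting τ t₀ P P' t B) : ∃ t', t < t' ∧ ∃ B', IsSplitting τ t₀ P P' t' B' := by
  obtain ⟨U, V, hU, hV, hBU, hAV, hUV⟩ := SeparatedNhds.of_isCompact_isCompact
    h.closed.isCompact h.closed'.isCompact (disjoint_left.2 fun x hx hx' ↦ hx'.2 hx)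
  -- a neighbourhood of the level `t` without local minima at other levels
  set N : Set M := interior {q | IsLocalMin τ q → τ q ≤ t} ∪ {q | τ q < t} with hN
  have hNo : IsOpen N := isOpen_interior.union (isOpen_lt hτ continuous_const)
  have hNt : ∀ q, τ q ≤ t → q ∈ N := by
    intro q hq
    rcases hq.lt_or_eq with hq | hq
    · exact Or.inr hq
    · refine Or.inl (mem_interior_iff_mem_nhds.2 ?_)
      filter_upwards [(hloc q).2] with z hz hz'
      exact (hz hz').le.trans hq.le
  obtain ⟨t', htt', ht'⟩ : ∃ t', t < t' ∧ slab τ t₀ t' ⊆ (U ∪ V) ∩ N := by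
    have hK : IsCompact ({x | t₀ ≤ τ x} ∩ ((U ∪ V) ∩ N)ᶜ) :=
      ((isClosed_le continuous_const hτ).inter
        ((hU.union hV).inter hNo).isClosed_compl).isCompact
    -- The part of `{t₀ ≤ τ}` outside the open set is compact and lies strictly above `t`; any `t'`
    -- between `t` and the minimum of `τ` there will do.
    rcases eq_empty_or_nonempty ({x | t₀ ≤ τ x} ∩ ((U ∪ V) ∩ N)ᶜ) with he | hne
    · refine ⟨t + 1, by linarith, fun x hx ↦ ?_⟩
      by_contra hx'
      exact (he ▸ (⟨hx.1, hx'⟩ : x ∈ {x | t₀ ≤ τ x} ∩ ((U ∪ V) ∩ N)ᶜ) : x ∈ (∅ : Set M))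
    · obtain ⟨p, hp, hmin⟩ := hK.exists_isMinOn hne hτ.continuousOn
      have hpt : t < τ p := by
        by_contra hle
        have hle : τ p ≤ t := not_lt.1 hle
        refine hp.2 ⟨?_, hNt p hle⟩
        by_cases hpB : p ∈ B
        · exact Or.inl (hBU hpB)
        · exact Or.inr (hAV ⟨⟨hp.1, hle⟩, hpB⟩)
      obtain ⟨t', h1, h2⟩ := exists_between hpt
      refine ⟨t', h1, fun x hx ↦ ?_⟩
      by_contra hx'
      have : τ p ≤ τ x := hmin ⟨hx.1, hx'⟩
      linarith [hx.2]
  refine ⟨t', htt', slab τ t₀ t' ∩ U, ?_, ?_, inter_subset_left, ?_, ?_, ?_⟩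
  · have : slab τ t₀ t' ∩ U = slab τ t₀ t' ∩ Vᶜ := by
      ext x
      refine and_congr_right fun hx ↦ ⟨fun h1 h2 ↦ disjoint_left.1 hUV h1 h2, fun h1 ↦ ?_⟩
      exact (ht' hx).1.resolve_right h1
    rw [this]
    exact (isClosed_slab hτ).inter hV.isClosed_compl
  · rw [sdiff_self_inter, sdiff_eq]
    exact (isClosed_slab hτ).inter hU.isClosed_compl
  · intro x hx
    have := h.sub (h.right hx)
    exact ⟨⟨this.1, this.2.trans htt'.le⟩, hBU (h.right hx)⟩
  · rw [disjoint_left]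
    rintro x hx ⟨hx1, hxU⟩
    have hx0 : τ x = t₀ := hP hx
    have : x ∈ V := hAV ⟨⟨hx0.ge, hx0.le.trans ht⟩, fun hB ↦ disjoint_left.1 h.left hx hB⟩
    exact disjoint_left.1 hUV hxU this
  · rintro p ⟨hp, hpU⟩ hpt hmin
    have hle : τ p ≤ t := by
      rcases (ht' hp).2 with h1 | h1
      · exact (interior_subset h1) hmin
      · exact le_of_lt h1
    have hpB : p ∈ B := by
      by_contra hpB
      exact disjoint_left.1 hUV hpU (hAV ⟨⟨hp.1, hle⟩, hpB⟩)
    exact h.notMin p hpB hpt hmin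

/-- Continuity method: the levels up to which a splitting exists form an interval starting at `t₀`,
where `P'` itself is a splitting. The interval contains its supremum and can be extended beyond it,
so it is unbounded. -/
theorem exists_isSplitting [CompactSpace M] [T2Space M] (hτ : Continuous τ)
    (hloc : ∀ p, SublevelConnectedAt τ p) (hL : {x | τ x = t₀} = P ∪ P') (hP : IsClosed P)
    (hP' : IsClosed P') (hd : Disjoint P P') (ht : t₀ ≤ t) :
    ∃ B, IsSplitting τ t₀ P P' t B := by
  have hPs : P ⊆ {x | τ x = t₀} := hL ▸ subset_union_left
  have hPs' : P' ⊆ {x | τ x = t₀} := hL ▸ subset_union_right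
  have h0 : ∃ B, IsSplitting τ t₀ P P' t₀ B := by
    refine ⟨P', hP', ?_, fun x hx ↦ ⟨(hPs' hx).ge, (hPs' hx).le⟩, Subset.rfl, hd,
      fun p hp hpt ↦ absurd (hPs' hp) hpt.ne'⟩
    convert hP using 1
    ext x
    constructor
    · rintro ⟨⟨h1, h2⟩, h3⟩
      exact (hL.subset (le_antisymm h2 h1)).resolve_right h3
    · exact fun hx ↦ ⟨⟨(hPs hx).ge, (hPs hx).le⟩, disjoint_left.1 hd hx⟩
  by_contra hne
  set S : Set ℝ := {s | t₀ ≤ s ∧ ∃ B, IsSplitting τ t₀ P P' s B} with hS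
  have hdown : ∀ s ∈ S, ∀ r, t₀ ≤ r → r ≤ s → r ∈ S := fun s ⟨_, B, hB⟩ r h1 h2 ↦
    ⟨h1, _, hB.restrict hτ hPs' h1 h2⟩
  have hbd : ∀ s ∈ S, s ≤ t := fun s hs ↦ by
    by_contra hlt
    exact hne (hdown s hs t ht (not_le.1 hlt).le).2
  have hSne : S.Nonempty := ⟨t₀, le_rfl, h0⟩
  have hSbd : BddAbove S := ⟨t, hbd⟩
  have h0s : t₀ ≤ sSup S := le_csSup hSbd ⟨le_rfl, h0⟩
  have hmem : ∃ B, IsSplitting τ t₀ P P' (sSup S) B := by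
    rcases h0s.eq_or_lt with he | hlt
    · rwa [← he]
    · refine IsSplitting.exists_limit hτ hL hloc hlt fun s hs1 hs2 ↦ ?_
      obtain ⟨r, hr, hsr⟩ := exists_lt_of_lt_csSup hSne hs2
      exact (hdown r hr s hs1 hsr.le).2
  obtain ⟨B, hB⟩ := hmem
  obtain ⟨t', h1, h2⟩ := hB.exists_extend hτ hloc h0s hPs
  exact absurd (le_csSup hSbd ⟨h0s.trans h1.le, h2⟩) (not_le.2 h1)

/-- If the strict sublevel and superlevel sets of `τ` are locally connected, then the levels of
`τ` are connected. -/
theorem isPreconnected_level [CompactSpace M] [T2Space M] [ConnectedSpace M] (hτ : Continuous τ)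
    (hloc : ∀ p, SublevelConnectedAt τ p) (hloc' : ∀ p, SublevelConnectedAt (fun x ↦ -τ x) p)
    (t₀ : ℝ) : IsPreconnected {x | τ x = t₀} := by
  have hcl : IsClosed {x | τ x = t₀} := isClosed_eq hτ continuous_const
  rw [isPreconnected_iff_subset_of_fully_disjoint_closed hcl]
  intro u v hu hv huv hd
  by_contra! hcon
  obtain ⟨⟨x, hx, hxu⟩, ⟨y, hy, hyv⟩⟩ := And.imp not_subset.1 not_subset.1 hcon
  set P := {x | τ x = t₀} ∩ u with hPdef
  set P' := {x | τ x = t₀} ∩ v with hPdef'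
  have hL : {x | τ x = t₀} = P ∪ P' := by
    rw [hPdef, hPdef', ← inter_union_distrib_left, inter_eq_left.2 huv]
  have hP : IsClosed P := hcl.inter hu
  have hP' : IsClosed P' := hcl.inter hv
  have hdd : Disjoint P P' := hd.mono inter_subset_right inter_subset_right
  have hxP : x ∈ P' := ⟨hx, (huv hx).resolve_left hxu⟩
  have hyP : y ∈ P := ⟨hy, (huv hy).resolve_right hyv⟩
  obtain ⟨m, hm⟩ := (isCompact_univ (X := M)).bddAbove_image hτ.continuousOn
  obtain ⟨m', hm'⟩ := (isCompact_univ (X := M)).bddAbove_image hτ.neg.continuousOn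
  have hm : ∀ z, τ z ≤ m := fun z ↦ hm ⟨z, mem_univ _, rfl⟩
  have hm' : ∀ z, -τ z ≤ m' := fun z ↦ hm' ⟨z, mem_univ _, rfl⟩
  obtain ⟨B, hB⟩ := exists_isSplitting hτ hloc hL hP hP' hdd (t := m) ((hx : τ x = t₀) ▸ hm x)
  have hL' : {x | -τ x = -t₀} = P ∪ P' := by simpa using hL
  obtain ⟨C, hC⟩ := exists_isSplitting hτ.neg hloc' hL' hP hP' hdd (t := m')
    ((hx : τ x = t₀) ▸ hm' x)
  have hlev : ∀ z, z ∈ P → τ z = t₀ := fun z hz ↦ hz.1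
  -- The splitting of the upper part and that of the lower part agree on the level `t₀`, where both
  -- equal `P'`. Their union is clopen in `M`, contains `P'` and misses `P`.
  have hclopen : IsClopen (B ∪ C) := by
    refine ⟨hB.closed.union hC.closed, ?_⟩
    have : (B ∪ C)ᶜ = (slab τ t₀ m \ B) ∪ (slab (fun x ↦ -τ x) (-t₀) m' \ C) := by
      ext z
      constructor
      · intro hz
        rcases le_total t₀ (τ z) with h | h
        · exact Or.inl ⟨⟨h, hm z⟩, fun h' ↦ hz (Or.inl h')⟩
        · exact Or.inr ⟨⟨neg_le_neg h, hm' z⟩, fun h' ↦ hz (Or.inr h')⟩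
      · rintro (⟨h1, h2⟩ | ⟨h1, h2⟩) (h3 | h3)
        · exact h2 h3
        · have h4 : τ z = t₀ := le_antisymm (neg_le_neg_iff.1 (hC.sub h3).1) h1.1
          rcases hL.subset h4 with h | h
          · exact disjoint_left.1 hC.left h h3
          · exact h2 (hB.right h)
        · have h4 : τ z = t₀ := le_antisymm (neg_le_neg_iff.1 h1.1) (hB.sub h3).1
          rcases hL.subset h4 with h | h
          · exact disjoint_left.1 hB.left h h3
          · exact h2 (hC.right h)
        · exact h2 h3
    rw [← isClosed_compl_iff, this]
    exact hB.closed'.union hC.closed'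
  rcases isClopen_iff.1 hclopen with he | he
  · exact (he ▸ (Or.inl (hB.right hxP) : x ∈ B ∪ C) : x ∈ (∅ : Set M))
  · rcases (he ▸ mem_univ y : y ∈ B ∪ C) with h | h
    · exact disjoint_left.1 hB.left hyP h
    · exact disjoint_left.1 hC.left hyP h

end LevelConnected

/-- A shortcut for instance search. -/
noncomputable instance bilinNormedAddCommGroup {E : Type*} [NormedAddCommGroup E] [NormedSpace ℝ E] :
    NormedAddCommGroup (E →L[ℝ] E →L[ℝ] ℝ) := ContinuousLinearMap.toNormedAddCommGroup

/-- A shortcut for instance search. -/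
noncomputable instance bilinNormedSpace {E : Type*} [NormedAddCommGroup E] [NormedSpace ℝ E] :
    NormedSpace ℝ (E →L[ℝ] E →L[ℝ] ℝ) := ContinuousLinearMap.toNormedSpace

/-! ### Sublevel sets in a vector space near regular points and near nondegenerate critical
subspaces. -/

namespace LevelConnected

variable {E : Type*} [NormedAddCommGroup E] [NormedSpace ℝ E]

theorem eventually_norm_sub_lt {X V : Type*} [TopologicalSpace X] [NormedAddCommGroup V]
    {f : X → V} {x : X} (hf : ContinuousAt f x) {c : ℝ} (hc : 0 < c) :
    ∀ᶠ y in 𝓝 x, ‖f y - f x‖ < c := by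
  simpa [dist_eq_norm] using Metric.tendsto_nhds.1 hf.tendsto c hc

/-- The map `z ↦ x + r z / (1 + ‖z‖)` takes the space onto the ball and only rescales each vector,
so it carries the complement of `F`, connected in codimension greater than `1`, onto the set in
question. -/
theorem isPreconnected_ball_diff {F : Submodule ℝ E} (hF : 1 < Module.rank ℝ (E ⧸ F)) (x : E)
    {r : ℝ} (hr : 0 < r) : IsPreconnected {y | y ∈ Metric.ball x r ∧ y - x ∉ F} := by
  have h := (isConnected_compl_of_one_lt_codim hF).isPreconnected
  set g : E → E := fun z ↦ x + (r * (1 + ‖z‖)⁻¹) • z with hg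
  have hpos : ∀ z : E, 0 < 1 + ‖z‖ := fun z ↦ by positivity
  have hgc : Continuous g := by
    have : Continuous fun z : E ↦ (1 + ‖z‖)⁻¹ :=
      (continuous_const.add continuous_norm).inv₀ fun z ↦ (hpos z).ne'
    fun_prop
  convert h.image g hgc.continuousOn using 1
  ext y
  constructor
  · rintro ⟨hy, hyF⟩
    have hu : ‖y - x‖ < r := by simpa [dist_eq_norm] using hy
    have hu' : 0 < r - ‖y - x‖ := by linarith
    refine ⟨(r - ‖y - x‖)⁻¹ • (y - x), fun hF' ↦ hyF ?_, ?_⟩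
    · simpa [smul_smul, hu'.ne'] using F.smul_mem (r - ‖y - x‖) hF'
    · simp only [hg, norm_smul, norm_inv, Real.norm_eq_abs, abs_of_pos hu', smul_smul]
      have : r * (1 + (r - ‖y - x‖)⁻¹ * ‖y - x‖)⁻¹ * (r - ‖y - x‖)⁻¹ = 1 := by
        have h3 : 1 + (r - ‖y - x‖)⁻¹ * ‖y - x‖ = r * (r - ‖y - x‖)⁻¹ := by
          field_simp
          ring
        rw [h3]
        field_simp
      rw [this]
      simp
  · rintro ⟨z, hz, rfl⟩
    have hc : 0 < r * (1 + ‖z‖)⁻¹ := mul_pos hr (inv_pos.2 (hpos z))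
    refine ⟨?_, fun hF' ↦ hz ?_⟩
    · simp only [hg, Metric.mem_ball, dist_eq_norm, add_sub_cancel_left, norm_smul,
        Real.norm_eq_abs, abs_of_pos hc]
      rw [mul_assoc, inv_mul_eq_div]
      have : ‖z‖ / (1 + ‖z‖) < 1 := by
        rw [div_lt_one (hpos z)]; linarith
      nlinarith
    · have := F.smul_mem (r * (1 + ‖z‖)⁻¹)⁻¹ hF'
      simpa only [hg, add_sub_cancel_left, smul_smul, inv_mul_cancel₀ hc.ne', one_smul,
        SetLike.mem_coe] using this

/-- In the coordinates of the implicit function theorem `f` is the first coordinate, so a small ball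
is cut by the sublevel condition in a convex set. -/
theorem exists_nhds_isPreconnected_of_regular [CompleteSpace E] [FiniteDimensional ℝ E]
    {f : E → ℝ} {x : E} {f' : E →L[ℝ] ℝ}
    (hf : HasStrictFDerivAt f f' x) (hf' : f' ≠ 0) {U : Set E} (hU : U ∈ 𝓝 x) :
    ∃ W ∈ 𝓝 x, W ⊆ U ∧ IsPreconnected (W ∩ {q | f q < f x}) := by
  have hsurj : (f' : E →ₗ[ℝ] ℝ).range = ⊤ := by
    refine LinearMap.range_eq_top.2 (LinearMap.surjective ?_)
    intro h
    exact hf' (by ext v; exact LinearMap.congr_fun h v)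
  set e := hf.implicitToOpenPartialHomeomorph f f' hsurj with he
  have hxs : x ∈ e.source := hf.mem_implicitToOpenPartialHomeomorph_source hsurj
  have hfst : ∀ y, (e y).1 = f y := fun y ↦ hf.implicitToOpenPartialHomeomorph_fst hsurj y
  have hV : e.symm ⁻¹' U ∩ e.target ∈ 𝓝 (e x) := by
    refine inter_mem ?_ (e.open_target.mem_nhds (e.map_source hxs))
    have := e.symm.continuousAt (e.map_source hxs)
    refine this.preimage_mem_nhds ?_
    rw [e.left_inv hxs]
    exact hU
  obtain ⟨r, hr, hball⟩ := Metric.mem_nhds_iff.1 hV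
  have hbt : Metric.ball (e x) r ⊆ e.target := fun y hy ↦ (hball hy).2
  refine ⟨e.symm '' Metric.ball (e x) r, ?_, ?_, ?_⟩
  · exact (e.symm.isOpen_image_of_subset_source Metric.isOpen_ball hbt).mem_nhds
      ⟨e x, Metric.mem_ball_self hr, e.left_inv hxs⟩
  · rintro _ ⟨y, hy, rfl⟩
    exact (hball hy).1
  · have : e.symm '' Metric.ball (e x) r ∩ {q | f q < f x} =
        e.symm '' (Metric.ball (e x) r ∩ {p | p.1 < f x}) := by
      ext q
      constructor
      · rintro ⟨⟨y, hy, rfl⟩, hq⟩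
        refine ⟨y, ⟨hy, ?_⟩, rfl⟩
        have h1 : f (e.symm y) < f x := hq
        rw [← hfst, e.right_inv (hbt hy)] at h1
        exact h1
      · rintro ⟨y, ⟨hy, hy1⟩, rfl⟩
        refine ⟨⟨y, hy, rfl⟩, ?_⟩
        change f (e.symm y) < f x
        rw [← hfst, e.right_inv (hbt hy)]
        exact hy1
    rw [this]
    refine IsPreconnected.image (Convex.isPreconnected ?_) _
      (e.symm.continuousOn.mono fun y hy ↦ hbt hy.1)
    refine (convex_ball _ _).inter ?_
    exact convex_halfSpace_lt (IsLinearMap.mk (fun _ _ ↦ rfl) fun _ _ ↦ rfl) _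

theorem exists_pos_forall_le_of_neg [FiniteDimensional ℝ E] {G : Submodule ℝ E} {B : E →L[ℝ] E →L[ℝ] ℝ}
    (hB : ∀ g ∈ G, g ≠ 0 → B g g < 0) : ∃ c > 0, ∀ g ∈ G, B g g ≤ -c * ‖g‖ ^ 2 := by
  have hK : IsCompact (Metric.sphere (0 : E) 1 ∩ G) :=
    (isCompact_sphere 0 1).inter_right G.closed_of_finiteDimensional
  have hcont : ContinuousOn (fun g ↦ B g g) (Metric.sphere (0 : E) 1 ∩ G) :=
    (B.continuous.clm_apply continuous_id).continuousOn
  rcases (Metric.sphere (0 : E) 1 ∩ G).eq_empty_or_nonempty with he | hne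
  · refine ⟨1, one_pos, fun g hg ↦ ?_⟩
    rcases eq_or_ne g 0 with rfl | hg0
    · simp
    · have hn : ‖g‖ ≠ 0 := norm_ne_zero_iff.2 hg0
      have : ‖g‖⁻¹ • g ∈ Metric.sphere (0 : E) 1 ∩ G :=
        ⟨by simp [norm_smul, hn], G.smul_mem _ hg⟩
      exact (he ▸ this : _ ∈ (∅ : Set E)).elim
  · obtain ⟨m, hm, hmax⟩ := hK.exists_isMaxOn hne hcont
    have hm0 : m ≠ 0 := by
      rintro rfl
      simpa using hm.1
    refine ⟨-(B m m), neg_pos.2 (hB m hm.2 hm0), fun g hg ↦ ?_⟩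
    rcases eq_or_ne g 0 with rfl | hg0
    · simp
    · have hn : ‖g‖ ≠ 0 := norm_ne_zero_iff.2 hg0
      have h1 : ‖g‖⁻¹ • g ∈ Metric.sphere (0 : E) 1 ∩ G :=
        ⟨by simp [norm_smul, hn], G.smul_mem _ hg⟩
      have h2 : B (‖g‖⁻¹ • g) (‖g‖⁻¹ • g) ≤ B m m := hmax h1
      have h3 : B g g = ‖g‖ ^ 2 * B (‖g‖⁻¹ • g) (‖g‖⁻¹ • g) := by
        simp only [map_smul, smul_apply, smul_eq_mul]
        field_simp
      rw [h3]
      nlinarith [sq_nonneg ‖g‖]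

/-- A substitute for the Morse–Bott normal form. Along `F` the derivative vanishes, so `f` is
constant. Along a complement `G` the second derivative is uniformly negative, and stays so near `x`;
starting from a critical point of `x + F`, the function strictly decreases in the directions of `G`.
-/
theorem eventually_eq_or_lt_of_critical [FiniteDimensional ℝ E] {f : E → ℝ} {x : E} {F : Submodule ℝ E}
    (hf : ContDiffAt ℝ ∞ f x) (hcrit : ∀ᶠ y in 𝓝 x, (fderiv ℝ f y = 0 ↔ y - x ∈ F))
    (hneg : ∀ w ∉ F, fderiv ℝ (fderiv ℝ f) x w w < 0) :
    ∀ᶠ y in 𝓝 x, (y - x ∈ F → f y = f x) ∧ (y - x ∉ F → f y < f x) := by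
  obtain ⟨G, hFG⟩ := F.exists_isCompl
  obtain ⟨c, hc, hB⟩ := exists_pos_forall_le_of_neg (G := G) (B := fderiv ℝ (fderiv ℝ f) x)
    fun g hg hg0 ↦ hneg g fun hgF ↦ hg0 (by
      simpa using hFG.disjoint.le_bot (⟨hgF, hg⟩ : g ∈ F ⊓ G))
  have hf2 : ContDiffAt ℝ ∞ (fderiv ℝ f) x := hf.fderiv_right (by simp)
  have hf3 : ContinuousAt (fderiv ℝ (fderiv ℝ f)) x :=
    (hf2.fderiv_right (m := ∞) (by simp)).continuousAt
  have e1 : ∀ᶠ y in 𝓝 x, DifferentiableAt ℝ f y :=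
    ((hf.of_le (m := 1) (by simp)).eventually (by simp)).mono
      fun x hx ↦ hx.differentiableAt one_ne_zero
  have e2 : ∀ᶠ y in 𝓝 x, DifferentiableAt ℝ (fderiv ℝ f) y :=
    ((hf2.of_le (m := 1) (by simp)).eventually (by simp)).mono
      fun x hx ↦ hx.differentiableAt one_ne_zero
  have e3 : ∀ᶠ y in 𝓝 x, ‖fderiv ℝ (fderiv ℝ f) y - fderiv ℝ (fderiv ℝ f) x‖ < c :=
    eventually_norm_sub_lt (V := E →L[ℝ] E →L[ℝ] ℝ) hf3 hc
  obtain ⟨r, hr, hball⟩ := Metric.eventually_nhds_iff_ball.1 (e1.and (e2.and (e3.and hcrit)))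
  -- the function is constant on the critical subspace
  have hconst : ∀ y, y - x ∈ F → y ∈ Metric.ball x r → f y = f x := by
    intro y hy hyr
    have hline : ∀ t ∈ Icc (0 : ℝ) 1, x + t • (y - x) ∈ Metric.ball x r := by
      intro t ht
      rw [Metric.mem_ball, dist_eq_norm] at hyr ⊢
      simp only [add_sub_cancel_left, norm_smul, Real.norm_eq_abs, abs_of_nonneg ht.1]
      nlinarith [norm_nonneg (y - x), ht.2]
    have hd : ∀ t ∈ Icc (0 : ℝ) 1, HasDerivAt (fun t : ℝ ↦ f (x + t • (y - x))) 0 t := by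
      intro t ht
      have h1 := hball _ (hline t ht)
      have h2 := RealCalculus.hasDerivAt_line h1.1
      rwa [h1.2.2.2.2 (by simpa using F.smul_mem t hy)] at h2
    have := constant_of_has_deriv_right_zero
      (fun t ht ↦ (hd t ht).continuousAt.continuousWithinAt)
      (fun t ht ↦ (hd t ⟨ht.1, ht.2.le⟩).hasDerivWithinAt) 1 (right_mem_Icc.2 zero_le_one)
    simpa using this
  -- projections to `F` and `G`
  let pr : E →L[ℝ] E := LinearMap.toContinuousLinearMap (F.projection G hFG)
  have hprF : ∀ v, pr v ∈ F := fun v ↦ Submodule.projection_apply_mem hFG v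
  have hprG : ∀ v, v - pr v ∈ G := fun v ↦
    Submodule.sub_projection_mem hFG v
  -- Bounding the two components separately keeps the whole segment from `x + u` to `y` inside the
  -- ball.
  have hsmall : ∀ᶠ y in 𝓝 x, ‖pr (y - x)‖ + ‖(y - x) - pr (y - x)‖ < r := by
    have : Continuous fun y ↦ ‖pr (y - x)‖ + ‖(y - x) - pr (y - x)‖ := by fun_prop
    exact this.continuousAt.eventually (gt_mem_nhds (by simpa using hr))
  filter_upwards [Metric.ball_mem_nhds x hr, hsmall] with y hy hys
  refine ⟨fun h ↦ hconst y h hy, fun hyF ↦ ?_⟩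
  set u := pr (y - x) with hu
  set g := (y - x) - u with hg
  have hg0 : g ≠ 0 := fun h ↦ hyF (by rw [sub_eq_zero.1 h]; exact hprF _)
  have hgG : g ∈ G := hprG _
  have hline : ∀ t ∈ Icc (0 : ℝ) 1, (x + u) + t • g ∈ Metric.ball x r := by
    intro t ht
    rw [Metric.mem_ball, dist_eq_norm, add_assoc, add_sub_cancel_left]
    refine (norm_add_le _ _).trans_lt (lt_of_le_of_lt ?_ hys)
    rw [norm_smul, Real.norm_eq_abs, abs_of_nonneg ht.1]
    nlinarith [norm_nonneg g, ht.2]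
  have hxu : x + u ∈ Metric.ball x r := by simpa using hline 0 (by simp)
  have hd1 : ∀ t ∈ Icc (0 : ℝ) 1, HasDerivAt (fun t : ℝ ↦ f ((x + u) + t • g))
      (fderiv ℝ f ((x + u) + t • g) g) t := fun t ht ↦
    RealCalculus.hasDerivAt_line (hball _ (hline t ht)).1
  have hd2 : ∀ t ∈ Icc (0 : ℝ) 1, HasDerivAt (fun t : ℝ ↦ fderiv ℝ f ((x + u) + t • g) g)
      (fderiv ℝ (fderiv ℝ f) ((x + u) + t • g) g g) t := by
    intro t ht
    have h2 : HasFDerivAt (fun y ↦ fderiv ℝ f y g)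
        ((fderiv ℝ (fderiv ℝ f) ((x + u) + t • g)).flip g) ((x + u) + t • g) := by
      simpa using (hball _ (hline t ht)).2.1.hasFDerivAt.clm_apply (hasFDerivAt_const g _)
    have := RealCalculus.hasDerivAt_line (x := x + u) (w := g) (r := t) h2.differentiableAt
    rwa [h2.fderiv] at this
  have hneg2 : ∀ t ∈ Icc (0 : ℝ) 1, fderiv ℝ (fderiv ℝ f) ((x + u) + t • g) g g < 0 := by
    intro t ht
    have h1 := (hball _ (hline t ht)).2.2.1
    set D := fderiv ℝ (fderiv ℝ f) ((x + u) + t • g) - fderiv ℝ (fderiv ℝ f) x with hD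
    have h2 : D g g ≤ ‖D‖ * ‖g‖ * ‖g‖ := (le_abs_self _).trans (D.le_opNorm₂ g g)
    have h3 : fderiv ℝ (fderiv ℝ f) ((x + u) + t • g) g g =
      fderiv ℝ (fderiv ℝ f) x g g + D g g := by simp [hD]
    have h4 := hB g hgG
    have h5 : 0 < ‖g‖ := norm_pos_iff.2 hg0
    have h6 : ‖D‖ * ‖g‖ * ‖g‖ < c * ‖g‖ * ‖g‖ := by gcongr
    rw [h3]
    nlinarith
  have hanti : StrictAntiOn (fun t : ℝ ↦ fderiv ℝ f ((x + u) + t • g) g) (Icc 0 1) := by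
    refine strictAntiOn_of_deriv_neg (convex_Icc 0 1)
      (fun t ht ↦ (hd2 t ht).continuousAt.continuousWithinAt) fun t ht ↦ ?_
    rw [interior_Icc] at ht
    rw [(hd2 t ⟨ht.1.le, ht.2.le⟩).deriv]
    exact hneg2 t ⟨ht.1.le, ht.2.le⟩
  have hcr : fderiv ℝ f (x + u) = 0 := (hball _ hxu).2.2.2.2 (by rw [add_sub_cancel_left]; exact hprF _)
  have hanti2 : StrictAntiOn (fun t : ℝ ↦ f ((x + u) + t • g)) (Icc 0 1) := by
    refine strictAntiOn_of_deriv_neg (convex_Icc 0 1)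
      (fun t ht ↦ (hd1 t ht).continuousAt.continuousWithinAt) fun t ht ↦ ?_
    rw [interior_Icc] at ht
    rw [(hd1 t ⟨ht.1.le, ht.2.le⟩).deriv]
    have := hanti (left_mem_Icc.2 zero_le_one) ⟨ht.1.le, ht.2.le⟩ ht.1
    simpa [hcr] using this
  have h1 := hanti2 (left_mem_Icc.2 zero_le_one) (right_mem_Icc.2 zero_le_one) zero_lt_one
  have h2 := hconst (x + u) (by rw [add_sub_cancel_left]; exact hprF _) hxu
  simp only [one_smul, zero_smul, add_zero] at h1
  rw [h2, show x + u + g = y by simp [hg]] at h1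
  exact h1

theorem exists_nhds_isPreconnected_of_critical {f : E → ℝ} {x : E} {F : Submodule ℝ E}
    (hF : 1 < Module.rank ℝ (E ⧸ F))
    (h : ∀ᶠ y in 𝓝 x, (y - x ∈ F → f y = f x) ∧ (y - x ∉ F → f y < f x))
    {U : Set E} (hU : U ∈ 𝓝 x) :
    ∃ W ∈ 𝓝 x, W ⊆ U ∧ IsPreconnected (W ∩ {q | f q < f x}) := by
  obtain ⟨r, hr, hball⟩ := Metric.eventually_nhds_iff_ball.1 (h.and hU)
  refine ⟨Metric.ball x r, Metric.ball_mem_nhds x hr, fun y hy ↦ (hball y hy).2, ?_⟩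
  convert isPreconnected_ball_diff hF x hr using 1
  ext y
  refine and_congr_right fun hy ↦ ⟨fun h1 h2 ↦ ?_, (hball y hy).1.2⟩
  exact (h1 : f y < f x).ne ((hball y hy).1.1 h2)

/-- A point of `x + F` is approached along any direction outside `F`, where the strict inequality
holds. -/
theorem eventually_mem_closure_of_critical {f : E → ℝ} {x : E} {F : Submodule ℝ E}
    (hF : 1 < Module.rank ℝ (E ⧸ F))
    (h : ∀ᶠ y in 𝓝 x, (y - x ∈ F → f y = f x) ∧ (y - x ∉ F → f y < f x)) :
    ∀ᶠ y in 𝓝 x, y ∈ closure {z | f z < f x} := by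
  obtain ⟨g, hg⟩ : ∃ g, g ∉ F := by
    by_contra! hcon
    have : F = ⊤ := eq_top_iff.2 fun v _ ↦ hcon v
    subst this
    rw [rank_subsingleton'] at hF
    · exact absurd hF (by simp)
  filter_upwards [h, h.eventually_nhds] with y hy hy'
  by_cases hyF : y - x ∈ F
  · rw [mem_closure_iff_frequently]
    have hlim : Tendsto (fun t : ℝ ↦ y + t • g) (𝓝[≠] 0) (𝓝 y) := by
      have : Continuous fun t : ℝ ↦ y + t • g := by fun_prop
      simpa using (this.tendsto 0).mono_left nhdsWithin_le_nhds
    refine hlim.frequently (Eventually.frequently ?_)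
    filter_upwards [hlim.eventually hy', self_mem_nhdsWithin] with t ht ht0
    refine ht.2 fun hmem ↦ hg ?_
    have h1 : t • g ∈ F := by
      have := F.sub_mem hmem hyF
      simpa using this
    simpa [smul_smul, inv_mul_cancel₀ (show t ≠ 0 from ht0)] using F.smul_mem t⁻¹ h1
  · exact subset_closure (hy.2 hyF)

end LevelConnected

/-! ### Coordinate fields, gradient and Hessian in a chart. -/

namespace ChartCoordinates

variable {E : Type*} [NormedAddCommGroup E] [NormedSpace ℝ E]
  {M : Type*} [TopologicalSpace M] [ChartedSpace E M]

/-- The vector field with the components `n` in the chart `φ`. -/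
noncomputable def chartField (φ : OpenPartialHomeomorph M E) (n : E → E) (x : M) :
    TangentSpace 𝓘(ℝ, E) x :=
  VectorField.mpullback 𝓘(ℝ, E) 𝓘(ℝ, E) φ
    (fun z : E ↦ (show TangentSpace 𝓘(ℝ, E) z from n z)) x

/-- The coordinate field of the chart `φ` in the direction `w`. -/
noncomputable def coordField (φ : OpenPartialHomeomorph M E) (w : E) :
    Π x : M, TangentSpace 𝓘(ℝ, E) x :=
  chartField φ fun _ ↦ w

theorem chartField_eq_coordField (φ : OpenPartialHomeomorph M E) (n : E → E) (x : M) :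
    chartField φ n x = coordField φ (n (φ x)) x := rfl

theorem coordField_apply (φ : OpenPartialHomeomorph M E) (w : E) (x : M) :
    coordField φ w x = (mfderiv 𝓘(ℝ, E) 𝓘(ℝ, E) φ x).inverse w := rfl

variable {φ : OpenPartialHomeomorph M E}

theorem coordField_add (u w : E) (x : M) :
    coordField φ (u + w) x = coordField φ u x + coordField φ w x :=
  map_add (mfderiv 𝓘(ℝ, E) 𝓘(ℝ, E) φ x).inverse u w

theorem coordField_smul (c : ℝ) (w : E) (x : M) :
    coordField φ (c • w) x = c • coordField φ w x :=
  map_smul (mfderiv 𝓘(ℝ, E) 𝓘(ℝ, E) φ x).inverse c w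

section Smooth

variable [IsManifold 𝓘(ℝ, E) ∞ M] (hφ : φ ∈ IsManifold.maximalAtlas 𝓘(ℝ, E) ∞ M)

include hφ

theorem contMDiffAt_chart {x : M} (hx : x ∈ φ.source) :
    ContMDiffAt 𝓘(ℝ, E) 𝓘(ℝ, E) ∞ φ x :=
  (contMDiffOn_of_mem_maximalAtlas hφ).contMDiffAt (φ.open_source.mem_nhds hx)

theorem contMDiffAt_chart_symm {x : E} (hx : x ∈ φ.target) :
    ContMDiffAt 𝓘(ℝ, E) 𝓘(ℝ, E) ∞ φ.symm x :=
  (contMDiffOn_symm_of_mem_maximalAtlas hφ).contMDiffAt (φ.open_target.mem_nhds hx)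

theorem mdifferentiable_chart : φ.MDifferentiable 𝓘(ℝ, E) 𝓘(ℝ, E) :=
  ⟨(contMDiffOn_of_mem_maximalAtlas hφ).mdifferentiableOn (by simp),
    (contMDiffOn_symm_of_mem_maximalAtlas hφ).mdifferentiableOn (by simp)⟩

theorem isInvertible_mfderiv_chart {x : M} (hx : x ∈ φ.source) :
    (mfderiv 𝓘(ℝ, E) 𝓘(ℝ, E) φ x).IsInvertible :=
  ⟨(mdifferentiable_chart hφ).mfderiv hx, rfl⟩

theorem mfderiv_coordField {x : M} (hx : x ∈ φ.source) (w : E) :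
    mfderiv 𝓘(ℝ, E) 𝓘(ℝ, E) φ x (coordField φ w x) = w := by
  rw [coordField_apply]
  exact (isInvertible_mfderiv_chart hφ hx).self_apply_inverse w

theorem exists_coordField_eq {x : M} (hx : x ∈ φ.source) (u : TangentSpace 𝓘(ℝ, E) x) :
    ∃ w : E, coordField φ w x = u :=
  ⟨mfderiv 𝓘(ℝ, E) 𝓘(ℝ, E) φ x u, (isInvertible_mfderiv_chart hφ hx).inverse_apply_self u⟩

theorem coordField_injective {x : M} (hx : x ∈ φ.source) {w : E} (h : coordField φ w x = 0) :
    w = 0 := by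
  have := mfderiv_coordField hφ hx w
  rw [h, map_zero] at this
  exact this.symm

theorem mfderiv_chart_symm {x : M} (hx : x ∈ φ.source) (w : E) :
    mfderiv 𝓘(ℝ, E) 𝓘(ℝ, E) φ.symm (φ x) w = coordField φ w x := by
  have h := (mdifferentiable_chart hφ).symm_comp_deriv hx
  have h1 := congrArg (fun L ↦ L (coordField φ w x)) h
  simp only [ContinuousLinearMap.comp_apply] at h1
  rw [mfderiv_coordField hφ hx] at h1
  exact h1

theorem contMDiffAt_chartField [FiniteDimensional ℝ E] {x : M} (hx : x ∈ φ.source) {n : E → E}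
    (hn : ContDiffAt ℝ ∞ n (φ x)) :
    ContMDiffAt 𝓘(ℝ, E) 𝓘(ℝ, E).tangent ∞ (T% (chartField φ n)) x := by
  have : CompleteSpace E := FiniteDimensional.complete ℝ E
  refine ContMDiffAt.mpullback_vectorField_preimage (n := ∞) ?_ (contMDiffAt_chart hφ hx)
    (isInvertible_mfderiv_chart hφ hx) (by simp)
  exact contMDiffAt_vectorSpace_iff_contDiffAt.2 hn

theorem mdifferentiableAt_chartField [FiniteDimensional ℝ E] {x : M} (hx : x ∈ φ.source)
    {n : E → E} (hn : ContDiffAt ℝ ∞ n (φ x)) :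
    MDiffAt (T% (chartField φ n)) x :=
  (contMDiffAt_chartField hφ hx hn).mdifferentiableAt (by simp)

theorem mdifferentiableAt_coordField [FiniteDimensional ℝ E] {x : M} (hx : x ∈ φ.source) (w : E) :
    MDiffAt (T% (coordField φ w)) x :=
  mdifferentiableAt_chartField hφ hx contDiffAt_const

/-- Coordinate fields are pullbacks of constant fields, and pullback commutes with the bracket. -/
theorem mlieBracket_coordField [FiniteDimensional ℝ E] {x : M} (hx : x ∈ φ.source) (u w : E) :
    VectorField.mlieBracket 𝓘(ℝ, E) (coordField φ u) (coordField φ w) x = 0 := by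
  have : CompleteSpace E := FiniteDimensional.complete ℝ E
  have h : ∀ w : E, MDiffAt (T% fun z : E ↦ (show TangentSpace 𝓘(ℝ, E) z from w)) (φ x) :=
    fun w ↦ (contMDiffAt_vectorSpace_iff_contDiffAt.2
      (contDiffAt_const (n := 1))).mdifferentiableAt (by simp)
  have : IsManifold 𝓘(ℝ, E) (minSmoothness ℝ 2) M := by
    rw [minSmoothness_of_isRCLikeNormedField]
    infer_instance
  have h2 : minSmoothness ℝ 2 ≤ (∞ : ℕ∞ω) := by
    rw [minSmoothness_of_isRCLikeNormedField]
    exact ENat.LEInfty.out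
  have := VectorField.mpullback_mlieBracket (h u) (h w) (contMDiffAt_chart hφ hx) h2
  have h0 : VectorField.mlieBracket 𝓘(ℝ, E)
      (fun z : E ↦ (show TangentSpace 𝓘(ℝ, E) z from u))
      (fun z : E ↦ (show TangentSpace 𝓘(ℝ, E) z from w)) (φ x) = 0 := by
    rw [← VectorField.mlieBracketWithin_univ, VectorField.mlieBracketWithin_eq_lieBracketWithin]
    change fderivWithin ℝ (fun _ : E ↦ w) univ (φ x) u
      - fderivWithin ℝ (fun _ : E ↦ u) univ (φ x) w = 0
    simp
  refine this.symm.trans ?_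
  exact (congrArg (mfderiv 𝓘(ℝ, E) 𝓘(ℝ, E) φ x).inverse h0).trans (map_zero _)

theorem contDiffAt_comp_chart_symm {g : M → ℝ} {x : E} (hx : x ∈ φ.target)
    (hg : ContMDiffAt 𝓘(ℝ, E) 𝓘(ℝ, ℝ) ∞ g (φ.symm x)) :
    ContDiffAt ℝ ∞ (g ∘ φ.symm) x :=
  (hg.comp x (contMDiffAt_chart_symm hφ hx)).contDiffAt

theorem mvfderiv_coordField {g : M → ℝ} {x : M} (hx : x ∈ φ.source)
    (hg : MDifferentiableAt 𝓘(ℝ, E) 𝓘(ℝ, ℝ) g x) (w : E) :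
    mvfderiv 𝓘(ℝ, E) g x (coordField φ w x) = fderiv ℝ (g ∘ φ.symm) (φ x) w := by
  have h1 : MDifferentiableAt 𝓘(ℝ, E) 𝓘(ℝ, E) φ.symm (φ x) :=
    (contMDiffAt_chart_symm hφ (φ.map_source hx)).mdifferentiableAt (by simp)
  have h2 := mvfderiv_comp_apply_of_eq (I := 𝓘(ℝ, E)) (I' := 𝓘(ℝ, E)) (f := φ.symm) (g := g)
    (φ x) hg h1 (φ.left_inv hx) w
  have h3 : mvfderiv 𝓘(ℝ, E) (g ∘ φ.symm) (φ x) = fderiv ℝ (g ∘ φ.symm) (φ x) :=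
    mfderiv_eq_fderiv
  rw [h3] at h2
  exact (congrArg (mvfderiv 𝓘(ℝ, E) g x) (mfderiv_chart_symm hφ hx w).symm).trans h2.symm

end Smooth
end ChartCoordinates

theorem contDiffAt_inverse_apply {X V W : Type*} [NormedAddCommGroup X] [NormedSpace ℝ X]
    [NormedAddCommGroup V] [NormedSpace ℝ V] [CompleteSpace V] [NormedAddCommGroup W]
    [NormedSpace ℝ W] {n : ℕ∞ω} {A : X → V →L[ℝ] W} {b : X → W} {x : X} (hA : ContDiffAt ℝ n A x)
    (hi : ContinuousLinearMap.IsInvertible (A x)) (hb : ContDiffAt ℝ n b x) :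
    ContDiffAt ℝ n (fun y ↦ (A y).inverse (b y)) x := by
  obtain ⟨e, he⟩ := hi
  have h1 : ContDiffAt ℝ n (fun y ↦ (A y).inverse) x := by
    refine ContDiffAt.comp (g := ContinuousLinearMap.inverse) x ?_ hA
    rw [← he]
    exact contDiffAt_map_inverse e
  exact h1.clm_apply hb

namespace ChartCoordinates

variable {E : Type*} [NormedAddCommGroup E] [NormedSpace ℝ E] [FiniteDimensional ℝ E]
  {M : Type*} [TopologicalSpace M] [ChartedSpace E M]
  [RiemannianBundle (fun x : M ↦ TangentSpace 𝓘(ℝ, E) x)]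
  {φ : OpenPartialHomeomorph M E} {τ : M → ℝ}

theorem inner_grad (τ : M → ℝ) (x : M) (w : TangentSpace 𝓘(ℝ, E) x) :
    inner ℝ (grad E τ x) w = mvfderiv 𝓘(ℝ, E) τ x w := by
  have := complete_tangent (E := E) x
  exact InnerProductSpace.toDual_symm_apply

theorem grad_eq_zero_iff {x : M} : grad E τ x = 0 ↔ mvfderiv 𝓘(ℝ, E) τ x = 0 := by
  have := complete_tangent (E := E) x
  exact LinearIsometryEquiv.map_eq_zero_iff _

theorem mem_critSet_iff {x : M} : x ∈ critSet E τ ↔ grad E τ x = 0 :=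
  grad_eq_zero_iff.symm

theorem gradSq_eq_zero_iff {x : M} : gradSq E τ x = 0 ↔ x ∈ critSet E τ := by
  rw [mem_critSet_iff, gradSq, inner_self_eq_zero]

theorem gradSq_nonneg (x : M) : 0 ≤ gradSq E τ x := real_inner_self_nonneg

/-- The Gram matrix of the metric in the chart `φ`, as a map into the dual space. -/
noncomputable def gram (φ : OpenPartialHomeomorph M E) (x : E) : E →L[ℝ] E →L[ℝ] ℝ :=
  LinearMap.toContinuousLinearMap
    { toFun := fun u ↦ LinearMap.toContinuousLinearMap
        { toFun := fun w ↦ inner ℝ (coordField φ u (φ.symm x)) (coordField φ w (φ.symm x))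
          map_add' := fun w w' ↦ by rw [coordField_add, inner_add_right]
          map_smul' := fun c w ↦ by rw [coordField_smul, inner_smul_right]; rfl }
      map_add' := fun u u' ↦ by
        ext w
        change inner ℝ (coordField φ (u + u') (φ.symm x)) (coordField φ w (φ.symm x)) =
          inner ℝ (coordField φ u (φ.symm x)) (coordField φ w (φ.symm x)) +
          inner ℝ (coordField φ u' (φ.symm x)) (coordField φ w (φ.symm x))
        rw [coordField_add, inner_add_left]
      map_smul' := fun c u ↦ by
        ext w
        change inner ℝ (coordField φ (c • u) (φ.symm x)) (coordField φ w (φ.symm x)) =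
          c * inner ℝ (coordField φ u (φ.symm x)) (coordField φ w (φ.symm x))
        rw [coordField_smul, real_inner_smul_left] }

theorem gram_apply (x u w : E) :
    gram φ x u w = inner ℝ (coordField φ u (φ.symm x)) (coordField φ w (φ.symm x)) := rfl

/-- The components of the gradient of `τ` in the chart `φ`. -/
noncomputable def gradCoord (φ : OpenPartialHomeomorph M E) (τ : M → ℝ) (x : E) : E :=
  (gram φ x).inverse (fderiv ℝ (τ ∘ φ.symm) x)

variable [IsManifold 𝓘(ℝ, E) ∞ M]
  [IsContMDiffRiemannianBundle 𝓘(ℝ, E) ∞ E (fun x : M ↦ TangentSpace 𝓘(ℝ, E) x)]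
  (hφ : φ ∈ IsManifold.maximalAtlas 𝓘(ℝ, E) ∞ M)

include hφ

theorem contDiffAt_gram {x : E} (hx : x ∈ φ.target) : ContDiffAt ℝ ∞ (gram φ) x := by
  have h : ContDiffOn ℝ ∞ (gram φ) φ.target := by
    rw [contDiffOn_clm_apply]
    intro u
    rw [contDiffOn_clm_apply]
    intro w y hy
    refine ContDiffAt.contDiffWithinAt ?_
    have hs := φ.map_target hy
    exact contDiffAt_comp_chart_symm hφ
      (g := fun p ↦ inner ℝ (coordField φ u p) (coordField φ w p)) hy
      (ContMDiffAt.inner_bundle (IB := 𝓘(ℝ, E)) (F := E)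
        (E := fun x : M ↦ TangentSpace 𝓘(ℝ, E) x) (b := fun p : M ↦ p)
        (contMDiffAt_chartField hφ hs contDiffAt_const)
        (contMDiffAt_chartField hφ hs contDiffAt_const))
  exact h.contDiffAt (φ.open_target.mem_nhds hx)

theorem isInvertible_gram {x : E} (hx : x ∈ φ.target) : (gram φ x).IsInvertible := by
  have hinj : Function.Injective (gram φ x) := by
    rw [injective_iff_map_eq_zero]
    intro u hu
    have h1 : gram φ x u u = 0 := by rw [hu]; rfl
    rw [gram_apply, inner_self_eq_zero] at h1
    exact coordField_injective hφ (φ.map_target hx) h1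
  have hfr : Module.finrank ℝ E = Module.finrank ℝ (E →L[ℝ] ℝ) := by
    rw [← (LinearMap.toContinuousLinearMap (𝕜 := ℝ) (E := E) (F' := ℝ)).finrank_eq]
    exact (Subspace.dual_finrank_eq (K := ℝ) (V := E)).symm
  let e : E ≃ₗ[ℝ] (E →L[ℝ] ℝ) :=
    LinearEquiv.ofInjectiveOfFinrankEq (gram φ x : E →ₗ[ℝ] E →L[ℝ] ℝ) hinj hfr
  exact ⟨e.toContinuousLinearEquiv, by ext; rfl⟩

theorem gram_gradCoord {x : E} (hx : x ∈ φ.target) :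
    gram φ x (gradCoord φ τ x) = fderiv ℝ (τ ∘ φ.symm) x :=
  (isInvertible_gram hφ hx).self_apply_inverse _

theorem contDiffAt_gradCoord {x : E} (hx : x ∈ φ.target)
    (hτ : ContMDiff 𝓘(ℝ, E) 𝓘(ℝ, ℝ) ∞ τ) : ContDiffAt ℝ ∞ (gradCoord φ τ) x := by
  have : CompleteSpace E := FiniteDimensional.complete ℝ E
  exact contDiffAt_inverse_apply (contDiffAt_gram hφ hx) (isInvertible_gram hφ hx)
    ((contDiffAt_comp_chart_symm hφ hx hτ.contMDiffAt).fderiv_right (by simp))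

theorem grad_eq_chartField (hτ : ContMDiff 𝓘(ℝ, E) 𝓘(ℝ, ℝ) ∞ τ) {x : M} (hx : x ∈ φ.source) :
    grad E τ x = chartField φ (gradCoord φ τ) x := by
  refine ext_inner_right ℝ fun w ↦ ?_
  obtain ⟨w, rfl⟩ := exists_coordField_eq hφ hx w
  rw [inner_grad, mvfderiv_coordField hφ hx (hτ.mdifferentiable (by simp) x),
    ← gram_gradCoord hφ (φ.map_source hx), gram_apply, φ.left_inv hx, chartField_eq_coordField]

/-- The gradient is defined pointwise by the Riesz isomorphism; smoothness comes from its chart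
components, the inverse Gram matrix applied to `dτ`. -/
theorem contMDiffAt_grad (hτ : ContMDiff 𝓘(ℝ, E) 𝓘(ℝ, ℝ) ∞ τ) {x : M} (hx : x ∈ φ.source) :
    ContMDiffAt 𝓘(ℝ, E) 𝓘(ℝ, E).tangent ∞ (T% (grad E τ)) x := by
  refine (contMDiffAt_chartField hφ hx (n := gradCoord φ τ)
    (contDiffAt_gradCoord hφ (φ.map_source hx) hτ)).congr_of_eventuallyEq ?_
  filter_upwards [φ.open_source.mem_nhds hx] with y hy
  rw [grad_eq_chartField hφ hτ hy]

theorem gradSq_comp_chart_symm (hτ : ContMDiff 𝓘(ℝ, E) 𝓘(ℝ, ℝ) ∞ τ) {x : E} (hx : x ∈ φ.target) :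
    gradSq E τ (φ.symm x) = fderiv ℝ (τ ∘ φ.symm) x (gradCoord φ τ x) := by
  have hs := φ.map_target hx
  rw [gradSq, inner_grad, grad_eq_chartField hφ hτ hs, chartField_eq_coordField,
    mvfderiv_coordField hφ hs (hτ.mdifferentiable (by simp) _), φ.right_inv hx]

theorem contDiffAt_gradSq (hτ : ContMDiff 𝓘(ℝ, E) 𝓘(ℝ, ℝ) ∞ τ) {x : E} (hx : x ∈ φ.target) :
    ContDiffAt ℝ ∞ (gradSq E τ ∘ φ.symm) x := by
  have h := ((contDiffAt_comp_chart_symm hφ hx hτ.contMDiffAt).fderiv_right (m := ∞)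
    (by simp)).clm_apply (contDiffAt_gradCoord hφ hx hτ)
  refine h.congr_of_eventuallyEq ?_
  filter_upwards [φ.open_target.mem_nhds hx] with y hy using gradSq_comp_chart_symm hφ hτ hy

theorem fderiv_eq_zero_iff_mem_critSet (hτ : ContMDiff 𝓘(ℝ, E) 𝓘(ℝ, ℝ) ∞ τ) {x : E}
    (hx : x ∈ φ.target) :
    fderiv ℝ (τ ∘ φ.symm) x = 0 ↔ φ.symm x ∈ critSet E τ := by
  have hs := φ.map_target hx
  have h : ∀ w, mvfderiv 𝓘(ℝ, E) τ (φ.symm x) (coordField φ w (φ.symm x)) =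
      fderiv ℝ (τ ∘ φ.symm) x w := fun w ↦ by
    rw [mvfderiv_coordField hφ hs (hτ.mdifferentiable (by simp) _), φ.right_inv hx]
  constructor
  · intro h0
    refine ContinuousLinearMap.ext fun u ↦ ?_
    obtain ⟨w, rfl⟩ := exists_coordField_eq hφ hs u
    rw [h, h0]
    rfl
  · intro h0
    ext w
    rw [← h, show mvfderiv 𝓘(ℝ, E) τ (φ.symm x) = 0 from h0]
    rfl

/-- The product rule for `dτ(Z)`, in a chart. -/
theorem fderiv_fderiv_eq (hτ : ContMDiff 𝓘(ℝ, E) 𝓘(ℝ, ℝ) ∞ τ) {x : M} (hx : x ∈ φ.source)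
    (u w : E) :
    fderiv ℝ (fderiv ℝ (τ ∘ φ.symm)) (φ x) u w =
      inner ℝ (hess E τ x (coordField φ u x)) (coordField φ w x) +
      inner ℝ (grad E τ x) (leviCivita (coordField φ w) x (coordField φ u x)) := by
  have ht := φ.map_source hx
  have h1 := leviCivita_metric (mdifferentiableAt_coordField hφ hx u)
    ((contMDiffAt_grad hφ hτ hx).mdifferentiableAt (by simp))
    (mdifferentiableAt_coordField hφ hx w)
  rw [hess, ← h1]
  have hf2 : ContDiffAt ℝ ∞ (fderiv ℝ (τ ∘ φ.symm)) (φ x) :=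
    (contDiffAt_comp_chart_symm hφ ht (hτ.contMDiffAt)).fderiv_right (by simp)
  have h2 : HasFDerivAt (fun y ↦ fderiv ℝ (τ ∘ φ.symm) y w)
      ((fderiv ℝ (fderiv ℝ (τ ∘ φ.symm)) (φ x)).flip w) (φ x) := by
    simpa using (hf2.differentiableAt (by simp)).hasFDerivAt.clm_apply (hasFDerivAt_const w _)
  rw [mvfderiv_coordField hφ hx (mdiff_inner
    ((contMDiffAt_grad hφ hτ hx).mdifferentiableAt (by simp))
    (mdifferentiableAt_coordField hφ hx w))]
  have e : (fun p ↦ inner ℝ (grad E τ p) (coordField φ w p)) ∘ φ.symm =ᶠ[𝓝 (φ x)]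
      fun y ↦ fderiv ℝ (τ ∘ φ.symm) y w := by
    filter_upwards [φ.open_target.mem_nhds ht] with y hy
    have hs := φ.map_target hy
    simp only [Function.comp]
    rw [inner_grad, mvfderiv_coordField hφ hs (hτ.mdifferentiable (by simp) _), φ.right_inv hy]
  rw [e.fderiv_eq, h2.fderiv]
  rfl

theorem fderiv_fderiv_eq_of_critical (hτ : ContMDiff 𝓘(ℝ, E) 𝓘(ℝ, ℝ) ∞ τ) {x : M}
    (hx : x ∈ φ.source) (hc : x ∈ critSet E τ) (u w : E) :
    fderiv ℝ (fderiv ℝ (τ ∘ φ.symm)) (φ x) u w =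
      inner ℝ (hess E τ x (coordField φ u x)) (coordField φ w x) := by
  rw [fderiv_fderiv_eq hφ hτ hx, mem_critSet_iff.1 hc, inner_zero_left, add_zero]

/-- The product rule for `dτ(Z)`, taken in both orders, reduces this to the symmetry of the second
derivative in the chart; the connection terms agree because `∇` is torsion-free and coordinate
fields commute. -/
theorem hess_symm (hτ : ContMDiff 𝓘(ℝ, E) 𝓘(ℝ, ℝ) ∞ τ) {x : M}
    (hx : x ∈ φ.source) (u w : TangentSpace 𝓘(ℝ, E) x) :
    inner ℝ (hess E τ x u) w = inner ℝ (hess E τ x w) u := by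
  have : CompleteSpace E := FiniteDimensional.complete ℝ E
  obtain ⟨u, rfl⟩ := exists_coordField_eq hφ hx u
  obtain ⟨w, rfl⟩ := exists_coordField_eq hφ hx w
  have h1 := fderiv_fderiv_eq hφ hτ hx u w
  have h2 := fderiv_fderiv_eq hφ hτ hx w u
  have hsymm : fderiv ℝ (fderiv ℝ (τ ∘ φ.symm)) (φ x) u w =
      fderiv ℝ (fderiv ℝ (τ ∘ φ.symm)) (φ x) w u := by
    have h := contDiffAt_comp_chart_symm hφ (φ.map_source hx) (hτ.contMDiffAt)
    refine (h.isSymmSndFDerivAt ?_).eq u w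
    rw [minSmoothness_of_isRCLikeNormedField]
    exact ENat.LEInfty.out
  have ht := (CovariantDerivative.torsion_eq_zero_iff _).1 (leviCivita_torsion (E := E) (M := M))
    (mdifferentiableAt_coordField hφ hx u) (mdifferentiableAt_coordField hφ hx w)
  rw [mlieBracket_coordField hφ hx, sub_eq_zero] at ht
  rw [hsymm, h2, ht] at h1
  linarith

/-- `dQ(u) = 2 g(∇_v v, u)` for the gradient `v`. -/
theorem mvfderiv_gradSq (hτ : ContMDiff 𝓘(ℝ, E) 𝓘(ℝ, ℝ) ∞ τ) {x : M}
    (hx : x ∈ φ.source) (u : TangentSpace 𝓘(ℝ, E) x) :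
    mvfderiv 𝓘(ℝ, E) (gradSq E τ) x u = 2 * inner ℝ (hess E τ x (grad E τ x)) u := by
  obtain ⟨u, rfl⟩ := exists_coordField_eq hφ hx u
  have hg : MDiffAt (T% (grad E τ)) x := (contMDiffAt_grad hφ hτ hx).mdifferentiableAt (by simp)
  have h1 := leviCivita_metric (mdifferentiableAt_coordField hφ hx u) hg hg
  refine h1.trans ?_
  have h2 := hess_symm hφ hτ hx (coordField φ u x) (grad E τ x)
  have h3 := real_inner_comm (grad E τ x) (leviCivita (grad E τ) x (coordField φ u x))
  rw [hess] at h2 ⊢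
  linarith

end ChartCoordinates

/-! ### Symmetric operators with `H² = aH`. -/

section Algebra

variable {V : Type*} [NormedAddCommGroup V] [InnerProductSpace ℝ V]

/-- A nonzero symmetric operator for which `H (H w)` and `H w` are proportional for all `w`, in a
weak form, is a multiple of a projection. -/
theorem exists_apply_apply_eq_smul {H : V →ₗ[ℝ] V} (hH : ∀ u w, inner ℝ (H u) w = inner ℝ (H w) u)
    (h : ∀ w u z, inner ℝ (H w) (H u) * inner ℝ (H w) z = inner ℝ (H w) (H z) * inner ℝ (H w) u)
    (h0 : H ≠ 0) : ∃ a : ℝ, a ≠ 0 ∧ ∀ w, H (H w) = a • H w := by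
  have hs : ∀ u w, inner ℝ (H u) w = inner ℝ u (H w) := fun u w ↦ by
    rw [hH, real_inner_comm]
  have hprop : ∀ w, H w ≠ 0 → ∃ μ : ℝ, H (H w) = μ • H w := by
    intro w hw
    have hw' : inner ℝ (H w) (H w) ≠ 0 := inner_self_ne_zero.2 hw
    refine ⟨inner ℝ (H w) (H (H w)) / inner ℝ (H w) (H w), ext_inner_right ℝ fun u ↦ ?_⟩
    rw [real_inner_smul_left, hs (H w) u, div_mul_eq_mul_div, eq_div_iff hw']
    exact h w u (H w)
  obtain ⟨w₀, hw₀⟩ : ∃ w, H w ≠ 0 := by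
    by_contra! hcon
    exact h0 (LinearMap.ext hcon)
  obtain ⟨a, ha⟩ := hprop w₀ hw₀
  refine ⟨a, ?_, fun w ↦ ?_⟩
  · rintro rfl
    have h1 : inner ℝ (H w₀) (H w₀) = 0 := by
      rw [← hs, ha, zero_smul, inner_zero_left]
    exact hw₀ (inner_self_eq_zero.1 h1)
  · by_cases hw : H w = 0
    · simp [hw]
    -- The eigenvalue `μ` at `w` is compared with `a` through the sum `w₀ + w`. If they differed, `H
    -- w` and `H w₀` would be orthogonal by symmetry, and pairing the relation for `w₀ + w` with
    -- each of them would give `μ = ν = a`.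
    by_cases hsum : H (w₀ + w) = 0
    · have h1 : H w = -H w₀ := by
        rw [map_add] at hsum
        exact (neg_eq_of_add_eq_zero_right hsum).symm
      rw [h1, map_neg, ha, smul_neg]
    · obtain ⟨μ, hμ⟩ := hprop w hw
      obtain ⟨ν, hν⟩ := hprop _ hsum
      rw [hμ]
      by_cases hne : μ = a
      · rw [hne]
      exfalso
      have hz : inner ℝ (H w) (H w₀) = 0 := by
        have h1 := hs (H w) (H w₀)
        rw [hμ, ha, real_inner_smul_left, real_inner_smul_right] at h1
        have h2 : (μ - a) * inner ℝ (H w) (H w₀) = 0 := by linarith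
        exact (mul_eq_zero.1 h2).resolve_left (sub_ne_zero.2 hne)
      have hz' : inner ℝ (H w₀) (H w) = 0 := by rw [real_inner_comm, hz]
      simp only [map_add, ha, hμ, smul_add] at hν
      have e1 := congrArg (fun v ↦ inner ℝ v (H w)) hν
      have e2 := congrArg (fun v ↦ inner ℝ v (H w₀)) hν
      simp only [inner_add_left, real_inner_smul_left, hz, hz', mul_zero, zero_add,
        add_zero] at e1 e2
      have f1 := mul_right_cancel₀ (inner_self_ne_zero.2 hw) e1
      have f2 := mul_right_cancel₀ (inner_self_ne_zero.2 hw₀) e2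
      exact hne (f1.trans f2.symm)

end Algebra

/-! ### Limits along lines, and functions with proportional differentials. -/

namespace RealCalculus

variable {E : Type*} [NormedAddCommGroup E] [NormedSpace ℝ E]

theorem tendsto_line_fderiv {F : E → ℝ} {x : E} (hF : ContDiffAt ℝ ∞ F x) (h0 : fderiv ℝ F x = 0)
    (w u : E) :
    Tendsto (fun r : ℝ ↦ r⁻¹ * fderiv ℝ F (x + r • w) u) (𝓝[≠] 0)
      (𝓝 (fderiv ℝ (fderiv ℝ F) x w u)) := by
  have h2 : HasFDerivAt (fun y ↦ fderiv ℝ F y u) ((fderiv ℝ (fderiv ℝ F) x).flip u) x := by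
    have h3 := ((hF.fderiv_right (m := ∞) (by simp)).differentiableAt (by simp)).hasFDerivAt
    simpa using h3.clm_apply (hasFDerivAt_const u x)
  have h3 := hasDerivAt_line (F := fun y ↦ fderiv ℝ F y u) (x := x) (w := w) (r := 0)
    (by simpa using h2.differentiableAt)
  have h4 := hasDerivAt_iff_tendsto_slope_zero.1 h3
  simpa [h0, h2.fderiv] using h4

/-- Near a regular point of `f`, a function whose derivative is a multiple of that of `f` is
constant on the level of `f`. -/
theorem eventually_eq_of_fderiv_proportional [CompleteSpace E] {f q : E → ℝ} {x : E}
    (hf : ContDiffAt ℝ ∞ f x) (hq : ∀ᶠ y in 𝓝 x, DifferentiableAt ℝ q y) (h0 : fderiv ℝ f x ≠ 0)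
    (h : ∀ᶠ y in 𝓝 x, ∀ u z, fderiv ℝ q y u * fderiv ℝ f y z = fderiv ℝ q y z * fderiv ℝ f y u) :
    ∀ᶠ y in 𝓝 x, f y = f x → q y = q x := by
  set ℓ := fderiv ℝ f x with hℓ
  obtain ⟨g, hg⟩ : ∃ g, ℓ g = 1 := by
    obtain ⟨g, hg⟩ : ∃ g, ℓ g ≠ 0 := by
      by_contra! hcon
      exact h0 (ContinuousLinearMap.ext hcon)
    exact ⟨(ℓ g)⁻¹ • g, by simp [hg]⟩
  -- A local diffeomorphism with identity derivative at `x`, built so that `ℓ(F y - x) = f y - f x`.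
  -- In the new coordinates `f` is affine, its level is a piece of a hyperplane, and points of it
  -- can be joined to `x` by segments.
  set F : E → E := fun y ↦ y + (f y - f x - ℓ (y - x)) • g with hF
  have hFx : F x = x := by simp [hF]
  have hFs : ContDiffAt ℝ ∞ F x := by
    refine contDiffAt_id.add (ContDiffAt.smul ?_ contDiffAt_const)
    exact (hf.sub contDiffAt_const).sub (by fun_prop)
  have hFd : HasFDerivAt F ((ContinuousLinearEquiv.refl ℝ E : E ≃L[ℝ] E) : E →L[ℝ] E) x := by
    have h1 : HasFDerivAt (fun y ↦ f y - f x - ℓ (y - x)) (0 : E →L[ℝ] ℝ) x := by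
      have h2 := ((hf.differentiableAt (by simp)).hasFDerivAt.sub_const (f x)).sub
        (ℓ.hasFDerivAt.comp x ((hasFDerivAt_id x).sub_const x))
      refine h2.congr_fderiv ?_
      ext v
      simp [hℓ]
    have h3 := (hasFDerivAt_id x).add (h1.smul_const g)
    refine h3.congr_fderiv ?_
    ext v
    simp
  set G : E → E := hFs.localInverse hFd (by simp) with hG
  have hGs : ContDiffAt ℝ ∞ G x := by
    have := hFs.to_localInverse hFd (by simp)
    rwa [hFx] at this
  have hGx : G x = x := by
    have := hFs.localInverse_apply_image hFd (by simp)
    rwa [hFx] at this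
  have hst := hFs.hasStrictFDerivAt' hFd (by simp)
  have hleft : ∀ᶠ y in 𝓝 x, G (F y) = y := hst.eventually_left_inverse
  have hright : ∀ᶠ y in 𝓝 x, F (G y) = y := by
    have := hst.eventually_right_inverse
    rwa [hFx] at this
  have hℓF : ∀ y, ℓ (F y - x) = f y - f x := fun y ↦ by
    simp only [hF, map_sub, map_add, map_smul, hg, smul_eq_mul, mul_one]
    ring
  have hfG : ∀ᶠ z in 𝓝 x, f (G z) = f x + ℓ (z - x) := by
    filter_upwards [hright] with z hz
    have := hℓF (G z)
    rw [hz] at this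
    linarith
  have hGt : Tendsto G (𝓝 x) (𝓝 x) := by simpa [ContinuousAt, hGx] using hGs.continuousAt
  have hFt : Tendsto F (𝓝 x) (𝓝 x) := by simpa [ContinuousAt, hFx] using hFs.continuousAt
  have hfd : ∀ᶠ y in 𝓝 x, DifferentiableAt ℝ f y :=
    ((hf.of_le (m := 1) (by simp)).eventually (by simp)).mono
      fun x hx ↦ hx.differentiableAt one_ne_zero
  have hGd : ∀ᶠ y in 𝓝 x, DifferentiableAt ℝ G y :=
    ((hGs.of_le (m := 1) (by simp)).eventually (by simp)).mono
      fun x hx ↦ hx.differentiableAt one_ne_zero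
  have hne : ∀ᶠ y in 𝓝 x, fderiv ℝ f y g ≠ 0 := by
    have hc : ContinuousAt (fun y ↦ fderiv ℝ f y g) x :=
      ((hf.fderiv_right (m := ∞) (by simp)).clm_apply contDiffAt_const).continuousAt
    refine hc.eventually_ne ?_
    change ℓ g ≠ 0
    rw [hg]
    exact one_ne_zero
  obtain ⟨r, hr, hball⟩ := Metric.eventually_nhds_iff_ball.1 (hfG.eventually_nhds.and
    (hGd.and (hGt.eventually (hfd.and (hq.and (h.and hne))))))
  have hconst : ∀ z ∈ Metric.ball x r, ℓ (z - x) = 0 → q (G z) = q x := by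
    intro z hz hℓz
    have hline : ∀ t ∈ Icc (0 : ℝ) 1, x + t • (z - x) ∈ Metric.ball x r := by
      intro t ht
      rw [Metric.mem_ball, dist_eq_norm] at hz ⊢
      simp only [add_sub_cancel_left, norm_smul, Real.norm_eq_abs, abs_of_nonneg ht.1]
      nlinarith [norm_nonneg (z - x), ht.2]
    have hd : ∀ t ∈ Icc (0 : ℝ) 1, HasDerivAt (fun t : ℝ ↦ q (G (x + t • (z - x)))) 0 t := by
      intro t ht
      obtain ⟨h1, h2, h3, h4, h5, h6⟩ := hball _ (hline t ht)
      set p := x + t • (z - x) with hp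
      have hqG : DifferentiableAt ℝ (q ∘ G) p := DifferentiableAt.comp p h4 h2
      have h7 := hasDerivAt_line (F := q ∘ G) (x := x) (w := z - x) (r := t) hqG
      have h8 : fderiv ℝ (q ∘ G) p (z - x) = fderiv ℝ q (G p) (fderiv ℝ G p (z - x)) := by
        rw [fderiv_comp p h4 h2]
        rfl
      have h9 : fderiv ℝ (f ∘ G) p (z - x) = fderiv ℝ f (G p) (fderiv ℝ G p (z - x)) := by
        rw [fderiv_comp p h3 h2]
        rfl
      have h10 : fderiv ℝ (f ∘ G) p (z - x) = 0 := by
        have e : f ∘ G =ᶠ[𝓝 p] fun z ↦ f x + ℓ (z - x) := h1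
        rw [e.fderiv_eq, fderiv_const_add, fderiv_comp_sub, ℓ.fderiv, hℓz]
      -- The second vector is `g`, on which `df` does not vanish; since `df` kills the velocity of
      -- the segment, so does `dq`.
      have h11 := h5 (fderiv ℝ G p (z - x)) g
      rw [← h9, h10, mul_zero] at h11
      have h12 := (mul_eq_zero.1 h11).resolve_right h6
      rw [← hp, h8, h12] at h7
      exact h7
    have := constant_of_has_deriv_right_zero
      (fun t ht ↦ (hd t ht).continuousAt.continuousWithinAt)
      (fun t ht ↦ (hd t ⟨ht.1, ht.2.le⟩).hasDerivWithinAt) 1 (right_mem_Icc.2 zero_le_one)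
    simpa [hGx] using this
  filter_upwards [hleft, hFt.eventually (Metric.ball_mem_nhds x hr)] with y hy1 hy2 hy3
  rw [← hconst (F y) hy2 (by rw [hℓF, hy3, sub_self]), hy1]

end RealCalculus

/-! ### The function `Q` in a chart and the Hessian at critical points. -/

namespace ChartCoordinates

variable {E : Type*} [NormedAddCommGroup E] [NormedSpace ℝ E] [FiniteDimensional ℝ E]
  {M : Type*} [TopologicalSpace M] [ChartedSpace E M]
  [RiemannianBundle (fun x : M ↦ TangentSpace 𝓘(ℝ, E) x)]
  {φ : OpenPartialHomeomorph M E} {τ : M → ℝ}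
  [IsManifold 𝓘(ℝ, E) ∞ M]
  [IsContMDiffRiemannianBundle 𝓘(ℝ, E) ∞ E (fun x : M ↦ TangentSpace 𝓘(ℝ, E) x)]
  (hφ : φ ∈ IsManifold.maximalAtlas 𝓘(ℝ, E) ∞ M)

include hφ

theorem mdifferentiableAt_gradSq (hτ : ContMDiff 𝓘(ℝ, E) 𝓘(ℝ, ℝ) ∞ τ) {x : M} (hx : x ∈ φ.source) :
    MDifferentiableAt 𝓘(ℝ, E) 𝓘(ℝ, ℝ) (gradSq E τ) x :=
  have hg : MDiffAt (T% (grad E τ)) x := (contMDiffAt_grad hφ hτ hx).mdifferentiableAt (by simp)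
  mdiff_inner hg hg

/-- For a geodesic gradient, `dQ` and `dτ` are proportional. -/
theorem fderiv_gradSq_proportional (hτ : ContMDiff 𝓘(ℝ, E) 𝓘(ℝ, ℝ) ∞ τ)
    (hgeo : HasGeodesicGradient E τ) {x : E} (hx : x ∈ φ.target) (u z : E) :
    fderiv ℝ (gradSq E τ ∘ φ.symm) x u * fderiv ℝ (τ ∘ φ.symm) x z =
      fderiv ℝ (gradSq E τ ∘ φ.symm) x z * fderiv ℝ (τ ∘ φ.symm) x u := by
  have hs := φ.map_target hx
  obtain ⟨ψ, hψ⟩ := hgeo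
  have h1 : ∀ u, fderiv ℝ (τ ∘ φ.symm) x u =
      inner ℝ (grad E τ (φ.symm x)) (coordField φ u (φ.symm x)) := fun u ↦ by
    rw [inner_grad, mvfderiv_coordField hφ hs (hτ.mdifferentiable (by simp) _), φ.right_inv hx]
  have h2 : ∀ u, fderiv ℝ (gradSq E τ ∘ φ.symm) x u =
      2 * inner ℝ (hess E τ (φ.symm x) (grad E τ (φ.symm x))) (coordField φ u (φ.symm x)) :=
    fun u ↦ by
    rw [← mvfderiv_gradSq hφ hτ hs, mvfderiv_coordField hφ hs (mdifferentiableAt_gradSq hφ hτ hs),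
      φ.right_inv hx]
  rw [h1, h1, h2, h2]
  by_cases hc : grad E τ (φ.symm x) = 0
  · simp [hc]
  · have h3 : hess E τ (φ.symm x) (grad E τ (φ.symm x)) = ψ (φ.symm x) • grad E τ (φ.symm x) :=
      hψ _ hc
    rw [h3, real_inner_smul_left, real_inner_smul_left]
    ring

/-- The second derivative of `Q` at a critical point is `2 g(H u, H w)`. -/
theorem fderiv_fderiv_gradSq (hτ : ContMDiff 𝓘(ℝ, E) 𝓘(ℝ, ℝ) ∞ τ) {x : M}
    (hx : x ∈ φ.source) (hc : x ∈ critSet E τ) :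
    fderiv ℝ (gradSq E τ ∘ φ.symm) (φ x) = 0 ∧ ∀ w u,
    fderiv ℝ (fderiv ℝ (gradSq E τ ∘ φ.symm)) (φ x) w u =
      2 * inner ℝ (hess E τ x (coordField φ w x)) (hess E τ x (coordField φ u x)) := by
  have ht := φ.map_source hx
  set f := τ ∘ φ.symm with hf
  set n := gradCoord φ τ with hn
  set x₀ := φ x with hx₀
  have hfs : ContDiffAt ℝ ∞ f x₀ := contDiffAt_comp_chart_symm hφ ht hτ.contMDiffAt
  have hns : ContDiffAt ℝ ∞ n x₀ := contDiffAt_gradCoord hφ ht hτ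
  have hf1 : ContDiffAt ℝ ∞ (fderiv ℝ f) x₀ := hfs.fderiv_right (by simp)
  have hdf : fderiv ℝ f x₀ = 0 :=
    (fderiv_eq_zero_iff_mem_critSet hφ hτ ht).2 (by rwa [φ.left_inv hx])
  have hn0 : n x₀ = 0 := by
    have : gram φ x₀ (n x₀) (n x₀) = 0 := by
      rw [gram_gradCoord hφ ht, ← hf, hdf]; rfl
    rw [gram_apply, inner_self_eq_zero] at this
    exact coordField_injective hφ (φ.map_target ht) this
  have hfd : ∀ᶠ y in 𝓝 x₀, DifferentiableAt ℝ (fderiv ℝ f) y :=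
    ((hf1.of_le (m := 1) (by simp)).eventually (by simp)).mono
      fun x hx ↦ hx.differentiableAt one_ne_zero
  have hnd : ∀ᶠ y in 𝓝 x₀, DifferentiableAt ℝ n y :=
    ((hns.of_le (m := 1) (by simp)).eventually (by simp)).mono
      fun x hx ↦ hx.differentiableAt one_ne_zero
  -- the first derivative
  have hq1 : ∀ u, ∀ᶠ y in 𝓝 x₀, fderiv ℝ (gradSq E τ ∘ φ.symm) y u =
      fderiv ℝ (fderiv ℝ f) y u (n y) + fderiv ℝ f y (fderiv ℝ n y u) := by
    intro u
    filter_upwards [hfd, hnd, φ.open_target.eventually_mem ht] with y h1 h2 h3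
    have e : gradSq E τ ∘ φ.symm =ᶠ[𝓝 y] fun y ↦ fderiv ℝ f y (n y) := by
      filter_upwards [φ.open_target.mem_nhds h3] with z hz using gradSq_comp_chart_symm hφ hτ hz
    rw [e.fderiv_eq, (h1.hasFDerivAt.clm_apply h2.hasFDerivAt).fderiv]
    simp [add_comm]
  -- Differentiating `gram · n = dτ` at a zero of `n` loses the term with the derivative of the Gram
  -- matrix, so the derivative of the components `n` is the Hessian endomorphism.
  have hDn : ∀ w, coordField φ (fderiv ℝ n x₀ w) x = hess E τ x (coordField φ w x) := by
    intro w
    refine ext_inner_right ℝ fun v ↦ ?_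
    obtain ⟨v, rfl⟩ := exists_coordField_eq hφ hx v
    rw [← fderiv_fderiv_eq_of_critical hφ hτ hx hc]
    have e : fderiv ℝ f =ᶠ[𝓝 x₀] fun y ↦ gram φ y (n y) := by
      filter_upwards [φ.open_target.mem_nhds ht] with y hy using (gram_gradCoord hφ hy).symm
    have hg := ((contDiffAt_gram hφ ht).differentiableAt (by simp)).hasFDerivAt
    have h1 := hg.clm_apply hnd.self_of_nhds.hasFDerivAt
    have h2 : fderiv ℝ (fderiv ℝ f) x₀ w v = gram φ x₀ (fderiv ℝ n x₀ w) v := by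
      rw [e.fderiv_eq, h1.fderiv]
      simp [hn0]
    rw [h2, gram_apply, φ.left_inv hx]
  have hDf : ∀ u w, fderiv ℝ (fderiv ℝ f) x₀ u (fderiv ℝ n x₀ w) =
      inner ℝ (hess E τ x (coordField φ u x)) (hess E τ x (coordField φ w x)) := by
    intro u w
    rw [fderiv_fderiv_eq_of_critical hφ hτ hx hc, hDn]
  refine ⟨?_, fun w u ↦ ?_⟩
  · ext u
    rw [(hq1 u).self_of_nhds, hn0, hdf]
    simp
  · have hqs : ContDiffAt ℝ ∞ (gradSq E τ ∘ φ.symm) x₀ := contDiffAt_gradSq hφ hτ ht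
    have h3 := ((hqs.fderiv_right (m := ∞) (by simp)).differentiableAt (by simp)).hasFDerivAt
    have h4 : HasFDerivAt (fun y ↦ fderiv ℝ (gradSq E τ ∘ φ.symm) y u)
        ((fderiv ℝ (fderiv ℝ (gradSq E τ ∘ φ.symm)) x₀).flip u) x₀ := by
      simpa using h3.clm_apply (hasFDerivAt_const u x₀)
    have hA : DifferentiableAt ℝ (fun y ↦ fderiv ℝ (fderiv ℝ f) y u) x₀ :=
      ((hf1.fderiv_right (m := ∞) (by simp)).clm_apply contDiffAt_const).differentiableAt (by simp)
    have hB : DifferentiableAt ℝ (fun y ↦ fderiv ℝ n y u) x₀ :=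
      ((hns.fderiv_right (m := ∞) (by simp)).clm_apply contDiffAt_const).differentiableAt (by simp)
    have h5 := (hA.hasFDerivAt.clm_apply hnd.self_of_nhds.hasFDerivAt).add
      (hfd.self_of_nhds.hasFDerivAt.clm_apply hB.hasFDerivAt)
    have h6 := (h4.congr_of_eventuallyEq (EventuallyEq.symm (hq1 u))).unique h5
    have h7 := congrArg (fun L ↦ L w) h6
    simp only [ContinuousLinearMap.flip_apply, add_apply, ContinuousLinearMap.comp_apply, hn0,
      hdf, map_zero, zero_apply, add_zero, zero_add] at h7
    rw [h7, hDf, hDf, real_inner_comm]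
    ring

/-- At a critical point of a function with geodesic gradient, the nonzero Hessian is a multiple of
a projection. -/
theorem exists_hess_hess_eq_smul (hτ : ContMDiff 𝓘(ℝ, E) 𝓘(ℝ, ℝ) ∞ τ)
    (hgeo : HasGeodesicGradient E τ) {x : M} (hx : x ∈ φ.source) (hc : x ∈ critSet E τ)
    (h0 : hess E τ x ≠ 0) :
    ∃ a : ℝ, a ≠ 0 ∧ ∀ w, hess E τ x (hess E τ x w) = a • hess E τ x w := by
  have ht := φ.map_source hx
  have hfs : ContDiffAt ℝ ∞ (τ ∘ φ.symm) (φ x) := contDiffAt_comp_chart_symm hφ ht hτ.contMDiffAt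
  have hqs : ContDiffAt ℝ ∞ (gradSq E τ ∘ φ.symm) (φ x) := contDiffAt_gradSq hφ hτ ht
  have hdf : fderiv ℝ (τ ∘ φ.symm) (φ x) = 0 :=
    (fderiv_eq_zero_iff_mem_critSet hφ hτ ht).2 (by rwa [φ.left_inv hx])
  obtain ⟨hdq, hq2⟩ := fderiv_fderiv_gradSq hφ hτ hx hc
  refine exists_apply_apply_eq_smul (H := (hess E τ x : TangentSpace 𝓘(ℝ, E) x →ₗ[ℝ] _))
    (fun u w ↦ hess_symm hφ hτ hx u w) (fun w u z ↦ ?_) fun h ↦ h0 (by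
      ext v; exact LinearMap.congr_fun h v)
  obtain ⟨w, rfl⟩ := exists_coordField_eq hφ hx w
  obtain ⟨u, rfl⟩ := exists_coordField_eq hφ hx u
  obtain ⟨z, rfl⟩ := exists_coordField_eq hφ hx z
  -- The two products in the proportionality of `dQ` and `dτ` at `φ x + r • w`, divided by `r²`;
  -- both differentials vanish at `r = 0`, so the limits are products of second derivatives.
  have l1 := (RealCalculus.tendsto_line_fderiv hqs hdq w u).mul
    (RealCalculus.tendsto_line_fderiv hfs hdf w z)
  have l2 := (RealCalculus.tendsto_line_fderiv hqs hdq w z).mul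
    (RealCalculus.tendsto_line_fderiv hfs hdf w u)
  have hlim : Tendsto (fun r : ℝ ↦ φ x + r • w) (𝓝[≠] 0) (𝓝 (φ x)) := by
    have : Continuous fun r : ℝ ↦ φ x + r • w := by fun_prop
    simpa using (this.tendsto 0).mono_left nhdsWithin_le_nhds
  have h1 := tendsto_nhds_unique_of_eventuallyEq l1 l2 (by
    filter_upwards [hlim.eventually (φ.open_target.mem_nhds ht)] with r hr
    have := fderiv_gradSq_proportional hφ hτ hgeo hr u z
    linear_combination (r⁻¹ * r⁻¹) * this)
  rw [hq2, hq2, fderiv_fderiv_eq_of_critical hφ hτ hx hc,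
    fderiv_fderiv_eq_of_critical hφ hτ hx hc] at h1
  simp only [ContinuousLinearMap.coe_coe]
  linarith

end ChartCoordinates

/-! ### Transfer of the local topology from charts to the manifold. -/

namespace LevelConnected

section Transfer

variable {E : Type*} [NormedAddCommGroup E] [NormedSpace ℝ E] [FiniteDimensional ℝ E]
  {M : Type*} [TopologicalSpace M] {φ : OpenPartialHomeomorph M E} {g : M → ℝ} {x : M}

theorem tendsto_chart_symm (hx : x ∈ φ.source) : Tendsto φ.symm (𝓝 (φ x)) (𝓝 x) := by
  have := φ.continuousAt_symm (φ.map_source hx)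
  rwa [ContinuousAt, φ.left_inv hx] at this

theorem tendsto_chart (hx : x ∈ φ.source) : Tendsto φ (𝓝 x) (𝓝 (φ x)) := φ.continuousAt hx

theorem isLocalMin_comp_chart_symm (hx : x ∈ φ.source) (h : IsLocalMin g x) :
    IsLocalMin (g ∘ φ.symm) (φ x) := by
  filter_upwards [(tendsto_chart_symm hx).eventually h] with y hy
  simpa [φ.left_inv hx] using hy

theorem exists_nhds_isPreconnected_of_chart (hx : x ∈ φ.source)
    (h : ∀ U ∈ 𝓝 (φ x), ∃ W ∈ 𝓝 (φ x), W ⊆ U ∧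
      IsPreconnected (W ∩ {q | (g ∘ φ.symm) q < (g ∘ φ.symm) (φ x)}))
    {U : Set M} (hU : U ∈ 𝓝 x) :
    ∃ W ∈ 𝓝 x, W ⊆ U ∧ IsPreconnected (W ∩ {q | g q < g x}) := by
  obtain ⟨W, hW, hWU, hWc⟩ := h (φ.symm ⁻¹' U ∩ φ.target)
    (inter_mem (tendsto_chart_symm hx hU) (φ.open_target.mem_nhds (φ.map_source hx)))
  refine ⟨φ.symm '' W, ?_, ?_, ?_⟩
  · filter_upwards [tendsto_chart hx hW, φ.open_source.mem_nhds hx] with y hy hys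
    exact ⟨φ y, hy, φ.left_inv hys⟩
  · rintro _ ⟨y, hy, rfl⟩
    exact (hWU hy).1
  · have : φ.symm '' W ∩ {q | g q < g x} =
        φ.symm '' (W ∩ {q | (g ∘ φ.symm) q < (g ∘ φ.symm) (φ x)}) := by
      simp only [Function.comp, φ.left_inv hx]
      ext q
      constructor
      · rintro ⟨⟨y, hy, rfl⟩, hq⟩
        exact ⟨y, ⟨hy, hq⟩, rfl⟩
      · rintro ⟨y, ⟨hy, hy'⟩, rfl⟩
        exact ⟨⟨y, hy, rfl⟩, hy'⟩
    rw [this]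
    exact hWc.image _ (φ.symm.continuousOn.mono fun y hy ↦ (hWU hy.1).2)

theorem eventually_mem_closure_of_chart (hx : x ∈ φ.source)
    (h : ∀ᶠ y in 𝓝 (φ x), y ∈ closure {z | (g ∘ φ.symm) z < (g ∘ φ.symm) (φ x)}) :
    ∀ᶠ q in 𝓝 x, q ∈ closure {z | g z < g x} := by
  filter_upwards [(tendsto_chart hx).eventually h, φ.open_source.mem_nhds hx] with q hq hqs
  rw [mem_closure_iff_frequently] at hq ⊢
  refine (tendsto_chart_symm hqs).frequently ?_
  refine hq.mono fun z hz ↦ ?_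
  have hz : g (φ.symm z) < g (φ.symm (φ x)) := hz
  rwa [φ.left_inv hx] at hz

/-- There are no local minima near a regular point; hence every nearby `q` has strictly lower points
arbitrarily near, which gives density of the strict sublevel set. -/
theorem sublevelConnectedAt_of_regular (hx : x ∈ φ.source)
    (hg : ContDiffAt ℝ ∞ (g ∘ φ.symm) (φ x)) (h0 : fderiv ℝ (g ∘ φ.symm) (φ x) ≠ 0) :
    SublevelConnectedAt g x := by
  have : CompleteSpace E := FiniteDimensional.complete ℝ E
  have hno : ∀ᶠ q in 𝓝 x, ¬ IsLocalMin g q := by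
    have hc : ContinuousAt (fderiv ℝ (g ∘ φ.symm)) (φ x) :=
      (hg.fderiv_right (m := ∞) (by simp)).continuousAt
    filter_upwards [(tendsto_chart hx).eventually (hc.eventually_ne h0),
      φ.open_source.mem_nhds hx] with q hq hqs hmin
    exact hq (isLocalMin_comp_chart_symm hqs hmin).fderiv_eq_zero
  refine ⟨Or.inr ⟨fun U hU ↦ exists_nhds_isPreconnected_of_chart hx (fun U' hU' ↦
    exists_nhds_isPreconnected_of_regular (hg.hasStrictFDerivAt (by simp)) h0 hU') hU, ?_⟩,
    hno.mono fun q hq hq' ↦ absurd hq' hq⟩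
  filter_upwards [hno] with q hq hle
  rw [mem_closure_iff_frequently]
  refine (not_eventually.1 hq).mono fun z hz ↦ ?_
  exact (not_le.1 hz).trans_le hle

variable {F : Submodule ℝ E}

theorem eventually_isLocalMin_eq (hx : x ∈ φ.source)
    (hcrit : ∀ᶠ y in 𝓝 (φ x), (fderiv ℝ (g ∘ φ.symm) y = 0 ↔ y - φ x ∈ F))
    (h : ∀ᶠ y in 𝓝 (φ x), y - φ x ∈ F → (g ∘ φ.symm) y = (g ∘ φ.symm) (φ x)) :
    ∀ᶠ q in 𝓝 x, IsLocalMin g q → g q = g x := by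
  filter_upwards [(tendsto_chart hx).eventually hcrit, (tendsto_chart hx).eventually h,
    φ.open_source.mem_nhds hx] with q h1 h2 h3 hmin
  have h4 := h2 (h1.1 (isLocalMin_comp_chart_symm h3 hmin).fderiv_eq_zero)
  simpa [φ.left_inv hx, φ.left_inv h3] using h4

theorem sublevelConnectedAt_of_critical_neg (hx : x ∈ φ.source)
    (hg : ContDiffAt ℝ ∞ (g ∘ φ.symm) (φ x)) (hF : 1 < Module.rank ℝ (E ⧸ F))
    (hcrit : ∀ᶠ y in 𝓝 (φ x), (fderiv ℝ (g ∘ φ.symm) y = 0 ↔ y - φ x ∈ F))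
    (hneg : ∀ w ∉ F, fderiv ℝ (fderiv ℝ (g ∘ φ.symm)) (φ x) w w < 0) :
    SublevelConnectedAt g x := by
  have h := eventually_eq_or_lt_of_critical hg hcrit hneg
  refine ⟨Or.inr ⟨fun U hU ↦ exists_nhds_isPreconnected_of_chart hx (fun U' hU' ↦
    exists_nhds_isPreconnected_of_critical hF h hU') hU, ?_⟩,
    eventually_isLocalMin_eq hx hcrit (h.mono fun y hy ↦ hy.1)⟩
  exact (eventually_mem_closure_of_chart hx (eventually_mem_closure_of_critical hF h)).mono
    fun q hq _ ↦ hq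

theorem fderiv_neg_fun (f : E → ℝ) : fderiv ℝ (fun y ↦ -f y) = fun y ↦ -fderiv ℝ f y :=
  funext fun _ ↦ fderiv_fun_neg

theorem fderiv_fderiv_neg_fun (f : E → ℝ) (y : E) :
    fderiv ℝ (fderiv ℝ fun y ↦ -f y) y = -fderiv ℝ (fderiv ℝ f) y := by
  rw [fderiv_neg_fun]
  exact fderiv_fun_neg

/-- The negative definite case applied to `-g`. At a local minimum the strict sublevel set plays no
role, so no condition on the codimension is needed. -/
theorem sublevelConnectedAt_of_critical_pos (hx : x ∈ φ.source)
    (hg : ContDiffAt ℝ ∞ (g ∘ φ.symm) (φ x))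
    (hcrit : ∀ᶠ y in 𝓝 (φ x), (fderiv ℝ (g ∘ φ.symm) y = 0 ↔ y - φ x ∈ F))
    (hpos : ∀ w ∉ F, 0 < fderiv ℝ (fderiv ℝ (g ∘ φ.symm)) (φ x) w w) :
    IsLocalMin g x ∧ SublevelConnectedAt g x := by
  have h := eventually_eq_or_lt_of_critical (f := fun y ↦ -(g ∘ φ.symm) y) hg.neg
    (hcrit.mono fun y hy ↦ by rw [fderiv_neg_fun]; simpa using hy)
    (fun w hw ↦ by rw [fderiv_fderiv_neg_fun]; simpa using hpos w hw)
  have hmin : IsLocalMin g x := by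
    filter_upwards [(tendsto_chart hx).eventually h, φ.open_source.mem_nhds hx] with q hq hqs
    by_cases hqF : φ q - φ x ∈ F
    · have := hq.1 hqF
      simp only [Function.comp, φ.left_inv hx, φ.left_inv hqs] at this
      linarith
    · have := hq.2 hqF
      simp only [Function.comp, φ.left_inv hx, φ.left_inv hqs] at this
      linarith
  exact ⟨hmin, Or.inl hmin, eventually_isLocalMin_eq hx hcrit
    (h.mono fun y hy hyF ↦ neg_injective (hy.1 hyF))⟩

end Transfer

end LevelConnected

/-! ### Charts adapted to a critical manifold, and the sign of the Hessian. -/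

namespace GeodesicGradient

open ChartCoordinates LevelConnected

variable {E : Type*} [NormedAddCommGroup E] [NormedSpace ℝ E] [FiniteDimensional ℝ E]
  {M : Type*} [TopologicalSpace M] [ChartedSpace E M] [IsManifold 𝓘(ℝ, E) ∞ M]
  [RiemannianBundle (fun x : M ↦ TangentSpace 𝓘(ℝ, E) x)]
  [IsContMDiffRiemannianBundle 𝓘(ℝ, E) ∞ E (fun x : M ↦ TangentSpace 𝓘(ℝ, E) x)]

/-- A chart adapted to the critical manifold through `y`; `a` is the nonzero eigenvalue of the
Hessian. -/
structure CriticalChart (τ : M → ℝ) (y : M) (φ : OpenPartialHomeomorph M E) (F : Submodule ℝ E)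
    (a : ℝ) : Prop where
  mem_atlas : φ ∈ IsManifold.maximalAtlas 𝓘(ℝ, E) ∞ M
  mem_source : y ∈ φ.source
  codim : 1 < Module.rank ℝ (E ⧸ F)
  ne_zero : a ≠ 0
  hess_hess : ∀ w, hess E τ y (hess E τ y w) = a • hess E τ y w
  hess_ne_zero : ∀ w ∉ F, hess E τ y (coordField φ w y) ≠ 0
  crit : ∀ᶠ z in 𝓝 (φ y), (fderiv ℝ (τ ∘ φ.symm) z = 0 ↔ z - φ y ∈ F)

/-- Since the critical manifolds are isolated, a submanifold chart describes all critical points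
near `y`. Along `F` the differential of `τ` vanishes, so `F` lies in the kernel of the Hessian; the
rank condition makes the dimensions agree, so the Hessian vanishes on no direction outside `F`. -/
theorem exists_criticalChart {τ : M → ℝ} (hMB : IsMorseBott E τ) (hgeo : HasGeodesicGradient E τ)
    (hcodim : ∀ y ∈ critSet E τ, ∀ k : ℕ,
      IsSubmanifoldOfCodim E k (critComponent E τ y) → 1 < k) {y : M} (hy : y ∈ critSet E τ) :
    ∃ (φ : OpenPartialHomeomorph M E) (F : Submodule ℝ E) (a : ℝ), CriticalChart τ y φ F a := by
  obtain ⟨hτ, hMB⟩ := hMB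
  obtain ⟨⟨U, hU, hUC⟩, k, hk, hrank⟩ := hMB y hy
  have hk1 := hcodim y hy k hk
  have hyC : y ∈ critComponent E τ y := mem_connectedComponentIn hy
  obtain ⟨φ, hφ, hys, F, hFk, hF⟩ := hk y hyC
  have hr := hrank y hyC
  have hcrit : ∀ᶠ z in 𝓝 (φ y), (fderiv ℝ (τ ∘ φ.symm) z = 0 ↔ z - φ y ∈ F) := by
    have hyU : y ∈ U := by
      have : y ∈ U ∩ critSet E τ := hUC ▸ hyC
      exact this.1
    filter_upwards [φ.open_target.mem_nhds (φ.map_source hys),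
      (tendsto_chart_symm hys).eventually (hU.mem_nhds hyU)] with z hz hzU
    rw [fderiv_eq_zero_iff_mem_critSet hφ hτ hz]
    have h1 := hF _ (φ.map_target hz)
    rw [φ.right_inv hz] at h1
    rw [← h1, ← hUC]
    exact ⟨fun h ↦ ⟨hzU, h⟩, fun h ↦ h.2⟩
  -- The rank of the Hessian is the codimension `k`, and `k > 1`.
  have h0 : hess E τ y ≠ 0 := by
    intro h
    rw [h] at hr
    have h2 : ((0 : TangentSpace 𝓘(ℝ, E) y →L[ℝ] TangentSpace 𝓘(ℝ, E) y) :
      TangentSpace 𝓘(ℝ, E) y →ₗ[ℝ] TangentSpace 𝓘(ℝ, E) y) = 0 := rfl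
    rw [h2, LinearMap.range_zero, finrank_bot] at hr
    omega
  obtain ⟨a, ha, haa⟩ := exists_hess_hess_eq_smul hφ hτ hgeo hys hy h0
  have : FiniteDimensional ℝ (TangentSpace 𝓘(ℝ, E) y) := inferInstanceAs (FiniteDimensional ℝ E)
  -- the Hessian in the chart
  let A : E →ₗ[ℝ] TangentSpace 𝓘(ℝ, E) y :=
    { toFun := fun w ↦ coordField φ w y
      map_add' := fun u w ↦ coordField_add u w y
      map_smul' := fun c w ↦ coordField_smul c w y }
  let H : TangentSpace 𝓘(ℝ, E) y →ₗ[ℝ] TangentSpace 𝓘(ℝ, E) y := hess E τ y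
  have hA : Function.Surjective A := exists_coordField_eq hφ hys
  have hfs : ContDiffAt ℝ ∞ (τ ∘ φ.symm) (φ y) :=
    contDiffAt_comp_chart_symm hφ (φ.map_source hys) hτ.contMDiffAt
  have hdf : fderiv ℝ (τ ∘ φ.symm) (φ y) = 0 :=
    (fderiv_eq_zero_iff_mem_critSet hφ hτ (φ.map_source hys)).2 (by rwa [φ.left_inv hys])
  have hFL : F ≤ LinearMap.ker (H ∘ₗ A) := by
    intro w hw
    change hess E τ y (coordField φ w y) = 0
    refine ext_inner_right ℝ fun v ↦ ?_
    obtain ⟨v, rfl⟩ := exists_coordField_eq hφ hys v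
    rw [← fderiv_fderiv_eq_of_critical hφ hτ hys hy, inner_zero_left]
    have hlim : Tendsto (fun r : ℝ ↦ φ y + r • w) (𝓝[≠] 0) (𝓝 (φ y)) := by
      have : Continuous fun r : ℝ ↦ φ y + r • w := by fun_prop
      simpa using (this.tendsto 0).mono_left nhdsWithin_le_nhds
    refine tendsto_nhds_unique_of_eventuallyEq
      (RealCalculus.tendsto_line_fderiv hfs hdf w v) (tendsto_const_nhds (x := 0)) ?_
    filter_upwards [hlim.eventually hcrit] with r hr
    rw [hr.2 (by simpa using F.smul_mem r hw)]
    simp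
  have hker : F = LinearMap.ker (H ∘ₗ A) := by
    refine Submodule.eq_of_le_of_finrank_eq hFL ?_
    have h1 := F.finrank_quotient_add_finrank
    have h2 := LinearMap.finrank_range_add_finrank_ker (H ∘ₗ A)
    have h3 : LinearMap.range (H ∘ₗ A) = LinearMap.range H :=
      LinearMap.range_comp_of_range_eq_top _ (LinearMap.range_eq_top.2 hA)
    rw [h3] at h2
    have h4 : Module.finrank ℝ (LinearMap.range H) = k := hr
    omega
  refine ⟨φ, F, a, hφ, hys, ?_, ha, haa, fun w hw h ↦ hw ?_, hcrit⟩
  · rw [← Module.finrank_eq_rank, hFk]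
    exact_mod_cast hk1
  · rw [hker]
    exact h

namespace CriticalChart

variable {τ : M → ℝ} {y : M} {φ : OpenPartialHomeomorph M E} {F : Submodule ℝ E} {a : ℝ}

/-- From `H² = aH` and symmetry, `a g(Hw, w) = g(H(Hw), w) = g(Hw, Hw)`. Hence the second derivative
of `τ` has the sign of `a` in every direction outside `F`. -/
theorem mul_fderiv_fderiv (h : CriticalChart τ y φ F a) (hτ : ContMDiff 𝓘(ℝ, E) 𝓘(ℝ, ℝ) ∞ τ)
    (hy : y ∈ critSet E τ) (w : E) :
    a * fderiv ℝ (fderiv ℝ (τ ∘ φ.symm)) (φ y) w w =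
      inner ℝ (hess E τ y (coordField φ w y)) (hess E τ y (coordField φ w y)) := by
  rw [fderiv_fderiv_eq_of_critical h.mem_atlas hτ h.mem_source hy, ← real_inner_smul_left,
    ← h.hess_hess, hess_symm h.mem_atlas hτ h.mem_source]

theorem mul_fderiv_fderiv_pos (h : CriticalChart τ y φ F a)
    (hτ : ContMDiff 𝓘(ℝ, E) 𝓘(ℝ, ℝ) ∞ τ) (hy : y ∈ critSet E τ) {w : E} (hw : w ∉ F) :
    0 < a * fderiv ℝ (fderiv ℝ (τ ∘ φ.symm)) (φ y) w w := by
  rw [h.mul_fderiv_fderiv hτ hy]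
  exact real_inner_self_pos.2 (h.hess_ne_zero w hw)

theorem exists_notMem (h : CriticalChart τ y φ F a) : ∃ w, w ∉ F := by
  by_contra! hcon
  have hF : F = ⊤ := eq_top_iff.2 fun v _ ↦ hcon v
  have := h.codim
  subst hF
  rw [rank_subsingleton'] at this
  exact absurd this (by simp)

theorem sublevelConnectedAt (h : CriticalChart τ y φ F a) (hτ : ContMDiff 𝓘(ℝ, E) 𝓘(ℝ, ℝ) ∞ τ)
    (hy : y ∈ critSet E τ) :
    SublevelConnectedAt τ y ∧ SublevelConnectedAt (fun x ↦ -τ x) y := by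
  have hfs : ContDiffAt ℝ ∞ (τ ∘ φ.symm) (φ y) :=
    contDiffAt_comp_chart_symm h.mem_atlas (φ.map_source h.mem_source) hτ.contMDiffAt
  have hfs' : ContDiffAt ℝ ∞ ((fun x ↦ -τ x) ∘ φ.symm) (φ y) := hfs.neg
  have hcrit' : ∀ᶠ z in 𝓝 (φ y), (fderiv ℝ ((fun x ↦ -τ x) ∘ φ.symm) z = 0 ↔ z - φ y ∈ F) :=
    h.crit.mono fun z hz ↦ by
      rw [show (fun x ↦ -τ x) ∘ φ.symm = fun z ↦ -(τ ∘ φ.symm) z from rfl, fderiv_neg_fun]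
      simpa using hz
  have h2 : ∀ w, fderiv ℝ (fderiv ℝ ((fun x ↦ -τ x) ∘ φ.symm)) (φ y) w w =
      -fderiv ℝ (fderiv ℝ (τ ∘ φ.symm)) (φ y) w w := fun w ↦ by
    rw [show (fun x ↦ -τ x) ∘ φ.symm = fun z ↦ -(τ ∘ φ.symm) z from rfl, fderiv_fderiv_neg_fun]
    rfl
  rcases lt_or_gt_of_ne h.ne_zero with ha | ha
  · have hneg : ∀ w ∉ F, fderiv ℝ (fderiv ℝ (τ ∘ φ.symm)) (φ y) w w < 0 := fun w hw ↦ by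
      have := h.mul_fderiv_fderiv_pos hτ hy hw
      exact neg_of_mul_pos_right this ha.le
    exact ⟨sublevelConnectedAt_of_critical_neg h.mem_source hfs h.codim h.crit hneg,
      (sublevelConnectedAt_of_critical_pos h.mem_source hfs' hcrit'
        fun w hw ↦ by rw [h2]; exact neg_pos.2 (hneg w hw)).2⟩
  · have hpos : ∀ w ∉ F, 0 < fderiv ℝ (fderiv ℝ (τ ∘ φ.symm)) (φ y) w w := fun w hw ↦ by
      have := h.mul_fderiv_fderiv_pos hτ hy hw
      exact pos_of_mul_pos_right this ha.le
    exact ⟨(sublevelConnectedAt_of_critical_pos h.mem_source hfs h.crit hpos).2,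
      sublevelConnectedAt_of_critical_neg h.mem_source hfs' h.codim hcrit'
        fun w hw ↦ by rw [h2]; exact neg_neg_iff_pos.2 (hpos w hw)⟩

/-- A critical point is a local minimum or a local maximum. -/
theorem isLocalMin_or_isLocalMax (h : CriticalChart τ y φ F a)
    (hτ : ContMDiff 𝓘(ℝ, E) 𝓘(ℝ, ℝ) ∞ τ) (hy : y ∈ critSet E τ) :
    IsLocalMin τ y ∨ IsLocalMax τ y := by
  have hfs : ContDiffAt ℝ ∞ (τ ∘ φ.symm) (φ y) :=
    contDiffAt_comp_chart_symm h.mem_atlas (φ.map_source h.mem_source) hτ.contMDiffAt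
  rcases lt_or_gt_of_ne h.ne_zero with ha | ha
  · have hneg : ∀ w ∉ F, fderiv ℝ (fderiv ℝ (τ ∘ φ.symm)) (φ y) w w < 0 := fun w hw ↦
      neg_of_mul_pos_right (h.mul_fderiv_fderiv_pos hτ hy hw) ha.le
    right
    filter_upwards [(tendsto_chart h.mem_source).eventually
      (eventually_eq_or_lt_of_critical hfs h.crit hneg), φ.open_source.mem_nhds h.mem_source]
      with q hq hqs
    by_cases hqF : φ q - φ y ∈ F
    · have := hq.1 hqF
      simp only [Function.comp, φ.left_inv h.mem_source, φ.left_inv hqs] at this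
      exact this.le
    · have := hq.2 hqF
      simp only [Function.comp, φ.left_inv h.mem_source, φ.left_inv hqs] at this
      exact this.le
  · have hpos : ∀ w ∉ F, 0 < fderiv ℝ (fderiv ℝ (τ ∘ φ.symm)) (φ y) w w := fun w hw ↦
      pos_of_mul_pos_right (h.mul_fderiv_fderiv_pos hτ hy hw) ha.le
    exact Or.inl (sublevelConnectedAt_of_critical_pos h.mem_source hfs h.crit hpos).1

/-- The second order behaviour of `Q` and `τ` at a critical point. -/
theorem exists_tendsto_line (h : CriticalChart τ y φ F a) (hτ : ContMDiff 𝓘(ℝ, E) 𝓘(ℝ, ℝ) ∞ τ)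
    (hy : y ∈ critSet E τ) {w : E} (hw : w ∉ F) :
    Tendsto (fun r : ℝ ↦ (gradSq E τ ∘ φ.symm) (φ y + r • w) /
      ((τ ∘ φ.symm) (φ y + r • w) - τ y)) (𝓝[≠] 0) (𝓝 (2 * a)) := by
  have ht := φ.map_source h.mem_source
  have hfs : ContDiffAt ℝ ∞ (fun z ↦ (τ ∘ φ.symm) z - τ y) (φ y) :=
    (contDiffAt_comp_chart_symm h.mem_atlas ht hτ.contMDiffAt).sub contDiffAt_const
  have hqs : ContDiffAt ℝ ∞ (gradSq E τ ∘ φ.symm) (φ y) := contDiffAt_gradSq h.mem_atlas hτ ht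
  have e : fderiv ℝ (fun z ↦ (τ ∘ φ.symm) z - τ y) = fderiv ℝ (τ ∘ φ.symm) :=
    funext fun z ↦ fderiv_sub_const _
  have hdf : fderiv ℝ (τ ∘ φ.symm) (φ y) = 0 :=
    (fderiv_eq_zero_iff_mem_critSet h.mem_atlas hτ ht).2 (by rwa [φ.left_inv h.mem_source])
  obtain ⟨hdq, hq2⟩ := fderiv_fderiv_gradSq h.mem_atlas hτ h.mem_source hy
  have hq0 : (gradSq E τ ∘ φ.symm) (φ y) = 0 := by
    simp only [Function.comp, φ.left_inv h.mem_source]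
    exact gradSq_eq_zero_iff.2 hy
  have l1 := RealCalculus.tendsto_line_div_sq hqs hq0 hdq w
  have l2 := RealCalculus.tendsto_line_div_sq hfs (by simp [φ.left_inv h.mem_source])
    (by rw [e, hdf]) w
  rw [e] at l2
  set D := fderiv ℝ (fderiv ℝ (τ ∘ φ.symm)) (φ y) w w with hD
  have hD0 : D ≠ 0 := by
    intro h0
    have := h.mul_fderiv_fderiv_pos hτ hy hw
    rw [← hD, h0, mul_zero] at this
    exact lt_irrefl _ this
  -- The second-order coefficients along the line are `g(Hw, Hw) = a D` for `Q` and `D / 2` for `τ -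
  -- τ y`; their ratio is `2a`.
  rw [hq2, ← h.mul_fderiv_fderiv hτ hy, ← hD] at l1
  have l3 := l1.div l2 (by simpa using hD0)
  have e2 : 2 * (a * D) / 2 / (D / 2) = 2 * a := by field_simp
  rw [e2] at l3
  refine l3.congr' ?_
  filter_upwards [self_mem_nhdsWithin] with r hr
  have hr : r ≠ 0 := hr
  exact div_div_div_cancel_right₀ (pow_ne_zero 2 hr) _ _

theorem hasEigenvalue_iff (h : CriticalChart τ y φ F a) {b : ℝ} (hb : b ≠ 0) :
    Module.End.HasEigenvalue
      (hess E τ y : TangentSpace 𝓘(ℝ, E) y →ₗ[ℝ] TangentSpace 𝓘(ℝ, E) y) b ↔ b = a := by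
  constructor
  · intro hev
    obtain ⟨v, hv⟩ := hev.exists_hasEigenvector
    have h1 : hess E τ y v = b • v := hv.apply_eq_smul
    have h2 := h.hess_hess v
    rw [h1, map_smul, h1, smul_smul, smul_smul] at h2
    exact mul_right_cancel₀ hb (smul_left_injective ℝ hv.2 h2)
  · rintro rfl
    obtain ⟨w, hw⟩ := h.exists_notMem
    refine Module.End.hasEigenvalue_of_hasEigenvector
      (x := hess E τ y (coordField φ w y)) ⟨?_, h.hess_ne_zero w hw⟩
    rw [Module.End.mem_eigenspace_iff]
    exact h.hess_hess _

end CriticalChart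

end GeodesicGradient

/-! ### `Q` as a smooth function of `τ`. -/

namespace GeodesicGradient

open ChartCoordinates LevelConnected

variable {E : Type*} [NormedAddCommGroup E] [NormedSpace ℝ E] [FiniteDimensional ℝ E]
  {M : Type*} [TopologicalSpace M] [ChartedSpace E M] [IsManifold 𝓘(ℝ, E) ∞ M]
  [RiemannianBundle (fun x : M ↦ TangentSpace 𝓘(ℝ, E) x)]
  [IsContMDiffRiemannianBundle 𝓘(ℝ, E) ∞ E (fun x : M ↦ TangentSpace 𝓘(ℝ, E) x)]
  {τ : M → ℝ}

theorem continuous_gradSq (hτ : ContMDiff 𝓘(ℝ, E) 𝓘(ℝ, ℝ) ∞ τ) : Continuous (gradSq E τ) :=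
  continuous_iff_continuousAt.2 fun x ↦
    (mdifferentiableAt_gradSq (IsManifold.chart_mem_maximalAtlas x) hτ
      (mem_chart_source E x)).continuousAt

theorem fderiv_chartAt_eq_zero_iff (hτ : ContMDiff 𝓘(ℝ, E) 𝓘(ℝ, ℝ) ∞ τ) (x : M) :
    fderiv ℝ (τ ∘ (chartAt E x).symm) (chartAt E x x) = 0 ↔ x ∈ critSet E τ := by
  rw [fderiv_eq_zero_iff_mem_critSet (IsManifold.chart_mem_maximalAtlas x) hτ
    (mem_chart_target E x), (chartAt E x).left_inv (mem_chart_source E x)]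

theorem mem_critSet_of_isLocalMin (hτ : ContMDiff 𝓘(ℝ, E) 𝓘(ℝ, ℝ) ∞ τ) {x : M}
    (h : IsLocalMin τ x) : x ∈ critSet E τ :=
  (fderiv_chartAt_eq_zero_iff hτ x).1
    (isLocalMin_comp_chart_symm (mem_chart_source E x) h).fderiv_eq_zero

theorem mem_critSet_of_isLocalMax (hτ : ContMDiff 𝓘(ℝ, E) 𝓘(ℝ, ℝ) ∞ τ) {x : M}
    (h : IsLocalMax τ x) : x ∈ critSet E τ := by
  refine (fderiv_chartAt_eq_zero_iff hτ x).1 ?_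
  have h1 := (isLocalMin_comp_chart_symm (mem_chart_source E x) (g := fun x ↦ -τ x)
    h.neg).fderiv_eq_zero
  rw [show (fun x ↦ -τ x) ∘ (chartAt E x).symm = fun z ↦ -(τ ∘ (chartAt E x).symm) z from rfl,
    fderiv_neg_fun] at h1
  exact neg_eq_zero.1 h1

namespace CriticalChart

variable {y : M} {φ : OpenPartialHomeomorph M E} {F : Submodule ℝ E} {a : ℝ}

/-- Off the critical subspace `τ` is strictly on one side of `τ y`, so near `y` the level of `y` is
the critical manifold. -/
theorem eventually_mem_critSet (h : CriticalChart τ y φ F a)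
    (hτ : ContMDiff 𝓘(ℝ, E) 𝓘(ℝ, ℝ) ∞ τ) (hy : y ∈ critSet E τ) :
    ∀ᶠ q in 𝓝 y, τ q = τ y → q ∈ critSet E τ := by
  have hfs : ContDiffAt ℝ ∞ (τ ∘ φ.symm) (φ y) :=
    contDiffAt_comp_chart_symm h.mem_atlas (φ.map_source h.mem_source) hτ.contMDiffAt
  have key : ∀ᶠ z in 𝓝 (φ y), z - φ y ∉ F → (τ ∘ φ.symm) z ≠ (τ ∘ φ.symm) (φ y) := by
    rcases lt_or_gt_of_ne h.ne_zero with ha | ha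
    · exact (eventually_eq_or_lt_of_critical hfs h.crit fun w hw ↦
        neg_of_mul_pos_right (h.mul_fderiv_fderiv_pos hτ hy hw) ha.le).mono
        fun z hz hzF ↦ (hz.2 hzF).ne
    · refine (eventually_eq_or_lt_of_critical (f := fun z ↦ -(τ ∘ φ.symm) z) hfs.neg
        (h.crit.mono fun z hz ↦ by rw [fderiv_neg_fun]; simpa using hz) (fun w hw ↦ ?_)).mono
        fun z hz hzF ↦ fun heq ↦ (hz.2 hzF).ne (by rw [heq])
      rw [fderiv_fderiv_neg_fun]
      exact neg_neg_iff_pos.2 (pos_of_mul_pos_right (h.mul_fderiv_fderiv_pos hτ hy hw) ha.le)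
  filter_upwards [(tendsto_chart h.mem_source).eventually key,
    (tendsto_chart h.mem_source).eventually h.crit, φ.open_source.mem_nhds h.mem_source]
    with q h1 h2 h3 hq
  by_cases hF : φ q - φ y ∈ F
  · have := (fderiv_eq_zero_iff_mem_critSet h.mem_atlas hτ (φ.map_source h3)).1 (h2.2 hF)
    rwa [φ.left_inv h3] at this
  · exact absurd (by simp [φ.left_inv h3, φ.left_inv h.mem_source, hq]) (h1 hF)

theorem tendsto_line (y : M) (φ : OpenPartialHomeomorph M E) (w : E) :
    Tendsto (fun r : ℝ ↦ φ y + r • w) (𝓝[≠] 0) (𝓝 (φ y)) := by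
  have : Continuous fun r : ℝ ↦ φ y + r • w := by fun_prop
  simpa using (this.tendsto 0).mono_left nhdsWithin_le_nhds

theorem tendsto_symm_line (h : CriticalChart τ y φ F a) (w : E) :
    Tendsto (fun r : ℝ ↦ φ.symm (φ y + r • w)) (𝓝[≠] 0) (𝓝 y) :=
  (tendsto_chart_symm h.mem_source).comp (tendsto_line y φ w)

theorem frequently_ne (h : CriticalChart τ y φ F a)
    (hτ : ContMDiff 𝓘(ℝ, E) 𝓘(ℝ, ℝ) ∞ τ) (hy : y ∈ critSet E τ) :
    ∃ᶠ q in 𝓝 y, τ q ≠ τ y := by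
  obtain ⟨w, hw⟩ := h.exists_notMem
  refine (h.tendsto_symm_line w).frequently (Eventually.frequently ?_)
  -- The quotient tends to `2a ≠ 0`, while division by `0` would give the value `0`; so the
  -- denominator `τ - τ y` is nonzero along the line.
  filter_upwards [(h.exists_tendsto_line hτ hy hw).eventually_ne
    (mul_ne_zero two_ne_zero h.ne_zero)] with r hr heq
  exact hr (by simp [heq])

theorem pos_of_isLocalMin (h : CriticalChart τ y φ F a) (hτ : ContMDiff 𝓘(ℝ, E) 𝓘(ℝ, ℝ) ∞ τ)
    (hy : y ∈ critSet E τ) (hmin : IsLocalMin τ y) : 0 < a := by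
  obtain ⟨w, hw⟩ := h.exists_notMem
  refine lt_of_le_of_ne ?_ h.ne_zero.symm
  have := ge_of_tendsto (h.exists_tendsto_line hτ hy hw)
    ((h.tendsto_symm_line w).eventually hmin |>.mono fun r hr ↦
      div_nonneg (gradSq_nonneg _) (sub_nonneg.2 hr))
  linarith

theorem neg_of_isLocalMax (h : CriticalChart τ y φ F a) (hτ : ContMDiff 𝓘(ℝ, E) 𝓘(ℝ, ℝ) ∞ τ)
    (hy : y ∈ critSet E τ) (hmax : IsLocalMax τ y) : a < 0 := by
  obtain ⟨w, hw⟩ := h.exists_notMem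
  refine lt_of_le_of_ne ?_ h.ne_zero
  have := le_of_tendsto (h.exists_tendsto_line hτ hy hw)
    ((h.tendsto_symm_line w).eventually hmax |>.mono fun r hr ↦
      div_nonpos_of_nonneg_of_nonpos (gradSq_nonneg _) (sub_nonpos.2 hr))
  linarith

/-- If `Q = χ ∘ τ`, then `χ` is smooth, from one side, at a critical value; `ε = ±1` gives the
side. -/
theorem contDiffWithinAt_profile (h : CriticalChart τ y φ F a)
    (hτ : ContMDiff 𝓘(ℝ, E) 𝓘(ℝ, ℝ) ∞ τ) (hy : y ∈ critSet E τ) {χ : ℝ → ℝ}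
    (hχ : ∀ x, gradSq E τ x = χ (τ x)) {ε : ℝ} (hε : ε * ε = 1) (ha : 0 < ε * a) {S : Set ℝ}
    (hS : ∀ t ∈ S, 0 ≤ ε * (t - τ y)) : ContDiffWithinAt ℝ ∞ χ S (τ y) := by
  obtain ⟨w, hw⟩ := h.exists_notMem
  have ht := φ.map_source h.mem_source
  have hfs : ContDiffAt ℝ ∞ (fun z ↦ ε * ((τ ∘ φ.symm) z - τ y)) (φ y) :=
    contDiffAt_const.mul
      ((contDiffAt_comp_chart_symm h.mem_atlas ht hτ.contMDiffAt).sub contDiffAt_const)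
  have hf : ContDiffAt ℝ ∞ (τ ∘ φ.symm) (φ y) :=
    contDiffAt_comp_chart_symm h.mem_atlas ht hτ.contMDiffAt
  have hqs : ContDiffAt ℝ ∞ (gradSq E τ ∘ φ.symm) (φ y) := contDiffAt_gradSq h.mem_atlas hτ ht
  have hdf : fderiv ℝ (τ ∘ φ.symm) (φ y) = 0 :=
    (fderiv_eq_zero_iff_mem_critSet h.mem_atlas hτ ht).2 (by rwa [φ.left_inv h.mem_source])
  -- Both `ε a` and `a D` are positive, so `a² (ε D) > 0`: the sign `ε` turns `y` into a
  -- nondegenerate minimum along the line.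
  have hD : 0 < ε * fderiv ℝ (fderiv ℝ (τ ∘ φ.symm)) (φ y) w w := by
    have h1 := mul_pos ha (h.mul_fderiv_fderiv_pos hτ hy hw)
    have h2 : 0 < a ^ 2 := by have := h.ne_zero; positivity
    refine pos_of_mul_pos_right (a := a ^ 2) ?_ h2.le
    linarith
  set T : ℝ → ℝ := fun r ↦ (τ ∘ φ.symm) (φ y + r • w) with hT
  have hTs : ContDiffAt ℝ ∞ T 0 := RealCalculus.contDiffAt_line hf w
  have hd : deriv (fun r ↦ ε * (T r - τ y)) = fun r ↦ ε * deriv T r := by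
    ext r
    rw [deriv_const_mul_field, deriv_sub_const]
  have main : ContDiffWithinAt ℝ ∞ (fun t ↦ χ (ε * t + τ y)) (Ici 0) 0 := by
    refine RealCalculus.contDiffWithinAt_of_comp_min (T := fun r ↦ ε * (T r - τ y))
      (q := fun r ↦ (gradSq E τ ∘ φ.symm) (φ y + r • w))
      (contDiffAt_const.mul (hTs.sub contDiffAt_const)) (RealCalculus.contDiffAt_line hqs w)
      (by simp [hT, φ.left_inv h.mem_source]) ?_ ?_ (Eventually.of_forall fun r ↦ ?_)
    · rw [hd]
      simp only [hT]
      rw [RealCalculus.deriv_line hf, hdf]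
      simp
    · rw [hd, deriv_const_mul_field, hT, RealCalculus.deriv_deriv_line hf]
      exact hD
    · rw [← mul_assoc, hε, one_mul, sub_add_cancel]
      exact hχ _
  have e : χ = (fun t ↦ χ (ε * t + τ y)) ∘ fun t ↦ ε * (t - τ y) := by
    ext t
    change χ t = χ (ε * (ε * (t - τ y)) + τ y)
    rw [← mul_assoc, hε, one_mul, sub_add_cancel]
  rw [e]
  refine ContDiffWithinAt.comp _ (t := Ici 0) (by simpa using main) ?_ hS
  fun_prop

/-- `Q` vanishes at `y`, so the slopes of `χ` at the values of `τ` on a transverse line are the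
quotients `Q / (τ - τ y)`, which tend to `2a`. One sequence of slopes suffices as differentiability
is already known. -/
theorem hasDerivWithinAt_profile (h : CriticalChart τ y φ F a)
    (hτ : ContMDiff 𝓘(ℝ, E) 𝓘(ℝ, ℝ) ∞ τ) (hy : y ∈ critSet E τ) {χ : ℝ → ℝ}
    (hχ : ∀ x, gradSq E τ x = χ (τ x)) {S : Set ℝ} (hS : ∀ x, τ x ∈ S)
    (hd : DifferentiableWithinAt ℝ χ S (τ y)) : HasDerivWithinAt χ (2 * a) S (τ y) := by
  obtain ⟨w, hw⟩ := h.exists_notMem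
  have h1 := hd.hasDerivWithinAt
  have hlim := h.exists_tendsto_line hτ hy hw
  have ht : Tendsto (fun r : ℝ ↦ τ (φ.symm (φ y + r • w))) (𝓝[≠] 0) (𝓝[S \ {τ y}] (τ y)) := by
    refine tendsto_nhdsWithin_iff.2
      ⟨(hτ.continuous.tendsto y).comp (h.tendsto_symm_line w), ?_⟩
    filter_upwards [hlim.eventually_ne (mul_ne_zero two_ne_zero h.ne_zero)] with r hr
    exact ⟨hS _, fun heq ↦ hr (by simp [mem_singleton_iff.1 heq])⟩
  have h2 := (hasDerivWithinAt_iff_tendsto_slope.1 h1).comp ht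
  have h3 : derivWithin χ S (τ y) = 2 * a := by
    refine tendsto_nhds_unique h2 (hlim.congr fun r ↦ ?_)
    simp only [Function.comp, slope_def_field, ← hχ]
    rw [gradSq_eq_zero_iff.2 hy, sub_zero]
  rwa [h3] at h1

end CriticalChart

section Global

variable (hMB : IsMorseBott E τ) (hgeo : HasGeodesicGradient E τ)
  (hcodim : ∀ y ∈ critSet E τ, ∀ k : ℕ,
      IsSubmanifoldOfCodim E k (critComponent E τ y) → 1 < k)

include hMB hgeo hcodim

theorem sublevelConnectedAt (p : M) :
    SublevelConnectedAt τ p ∧ SublevelConnectedAt (fun x ↦ -τ x) p := by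
  by_cases hp : p ∈ critSet E τ
  · obtain ⟨φ, F, a, h⟩ := exists_criticalChart hMB hgeo hcodim hp
    exact h.sublevelConnectedAt hMB.1 hp
  · have h0 : fderiv ℝ (τ ∘ (chartAt E p).symm) (chartAt E p p) ≠ 0 :=
      fun h ↦ hp ((fderiv_chartAt_eq_zero_iff hMB.1 p).1 h)
    have hf : ContDiffAt ℝ ∞ (τ ∘ (chartAt E p).symm) (chartAt E p p) :=
      contDiffAt_comp_chart_symm (IsManifold.chart_mem_maximalAtlas p) (mem_chart_target E p)
        hMB.1.contMDiffAt
    refine ⟨sublevelConnectedAt_of_regular (mem_chart_source E p) hf h0,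
      sublevelConnectedAt_of_regular (mem_chart_source E p) hf.neg ?_⟩
    change fderiv ℝ (fun z ↦ -(τ ∘ (chartAt E p).symm) z) _ ≠ 0
    rw [fderiv_neg_fun]
    exact neg_ne_zero.2 h0

theorem frequently_ne_of_mem_critSet {y : M} (hy : y ∈ critSet E τ) : ∃ᶠ q in 𝓝 y, τ q ≠ τ y := by
  obtain ⟨φ, F, a, h⟩ := exists_criticalChart hMB hgeo hcodim hy
  exact h.frequently_ne hMB.1 hy

variable [CompactSpace M] [T2Space M] [ConnectedSpace M]

theorem isPreconnected_level_morseBott (t : ℝ) : IsPreconnected {x | τ x = t} :=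
  isPreconnected_level hMB.1.continuous (fun p ↦ (sublevelConnectedAt hMB hgeo hcodim p).1)
    (fun p ↦ (sublevelConnectedAt hMB hgeo hcodim p).2) t

omit hMB hgeo hcodim [FiniteDimensional ℝ E] [ChartedSpace E M] [IsManifold 𝓘(ℝ, E) ∞ M]
  [RiemannianBundle (fun x : M ↦ TangentSpace 𝓘(ℝ, E) x)]
  [IsContMDiffRiemannianBundle 𝓘(ℝ, E) ∞ E (fun x : M ↦ TangentSpace 𝓘(ℝ, E) x)]
  [CompactSpace M] [T2Space M] [ConnectedSpace M] in
-- The target is an arbitrary type so that the same lemma serves for the proposition "is critical"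
-- and for the values of `Q`.
theorem eq_of_isPreconnected_level {X : Type*} {f : M → X} {t : ℝ}
    (ht : IsPreconnected {x | τ x = t})
    (h : ∀ x, τ x = t → ∀ᶠ y in 𝓝 x, τ y = τ x → f y = f x) {x y : M} (hx : τ x = t)
    (hy : τ y = t) : f x = f y := by
  have : PreconnectedSpace {x | τ x = t} := Subtype.preconnectedSpace ht
  have hl : IsLocallyConstant fun q : {x | τ x = t} ↦ f q := by
    rw [IsLocallyConstant.iff_eventually_eq]
    rintro ⟨q, hq⟩
    rw [nhds_subtype_eq_comap]
    exact (eventually_comap.2 ((h q hq).mono fun z hz p hp ↦ by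
      subst hp
      exact hz (p.2.trans (Eq.symm hq))))
  exact hl.apply_eq_of_preconnectedSpace ⟨x, hx⟩ ⟨y, hy⟩

/-- Being critical is an open condition within a level, by the shape of the level near a critical
manifold; so is being noncritical, since `Q` is continuous. -/
theorem mem_critSet_iff_of_eq {x y : M} (h : τ x = τ y) : x ∈ critSet E τ ↔ y ∈ critSet E τ := by
  refine iff_of_eq (eq_of_isPreconnected_level (f := fun q ↦ q ∈ critSet E τ)
    (isPreconnected_level_morseBott hMB hgeo hcodim (τ y)) (fun q _ ↦ ?_) h rfl)
  by_cases hq : q ∈ critSet E τ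
  · obtain ⟨φ, F, a, hc⟩ := exists_criticalChart hMB hgeo hcodim hq
    filter_upwards [hc.eventually_mem_critSet hMB.1 hq] with z hz hzq
    simp [hq, hz hzq]
  · have : gradSq E τ q ≠ 0 := fun h ↦ hq (gradSq_eq_zero_iff.1 h)
    filter_upwards [(continuous_gradSq hMB.1).continuousAt.eventually_ne this] with z hz _
    have hz' : z ∉ critSet E τ := fun h ↦ hz (gradSq_eq_zero_iff.2 h)
    simp [hq, hz']

/-- All points of the level of `y` are critical, and each is a local minimum or a local maximum,
never both because `τ` is not locally constant there. These two relatively open sets cannot both be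
nonempty in a connected level. If, say, all are local maxima, then `{τ ≤ τ y}` is open as well as
closed, hence all of `M`. -/
theorem isMin_or_isMax_of_mem_critSet {y : M} (hy : y ∈ critSet E τ) :
    (∀ x, τ y ≤ τ x) ∨ ∀ x, τ x ≤ τ y := by
  set L := {x | τ x = τ y}
  set U := interior {x | τ y ≤ τ x}
  set V := interior {x | τ x ≤ τ y}
  have hUV : L ⊆ U ∪ V := by
    intro x hx
    have hx : τ x = τ y := hx
    have hxc := (mem_critSet_iff_of_eq hMB hgeo hcodim hx).2 hy
    obtain ⟨φ, F, a, hc⟩ := exists_criticalChart hMB hgeo hcodim hxc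
    rcases hc.isLocalMin_or_isLocalMax hMB.1 hxc with h | h
    · left
      rw [mem_interior_iff_mem_nhds, ← hx]
      exact h
    · right
      rw [mem_interior_iff_mem_nhds, ← hx]
      exact h
  have hd : ¬ (L ∩ (U ∩ V)).Nonempty := by
    rintro ⟨x, hx, hxU, hxV⟩
    have hx : τ x = τ y := hx
    have hxc := (mem_critSet_iff_of_eq hMB hgeo hcodim hx).2 hy
    refine frequently_ne_of_mem_critSet hMB hgeo hcodim hxc ?_
    filter_upwards [mem_interior_iff_mem_nhds.1 hxU, mem_interior_iff_mem_nhds.1 hxV] with z h1 h2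
    simp only [not_not, hx]
    exact le_antisymm h2 h1
  have hL : L ∩ U = ∅ ∨ L ∩ V = ∅ := by
    by_contra! hcon
    exact hd (isPreconnected_level_morseBott hMB hgeo hcodim (τ y) U V isOpen_interior
      isOpen_interior hUV hcon.1 hcon.2)
  have hc := hMB.1.continuous
  rcases hL with h | h
  · right
    have hV : L ⊆ V := fun x hx ↦ (hUV hx).resolve_left fun hu ↦ h.subset ⟨hx, hu⟩
    have h1 : IsClopen {x | τ x ≤ τ y} := by
      refine ⟨isClosed_le hc continuous_const, isOpen_iff_mem_nhds.2 fun x hx ↦ ?_⟩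
      rcases (show τ x ≤ τ y from hx).eq_or_lt with h2 | h2
      · exact mem_interior_iff_mem_nhds.1 (hV h2)
      · exact (hc.continuousAt.eventually_lt_const h2).mono fun z hz ↦ hz.le
    have h2 := h1.eq_univ ⟨y, le_refl (τ y)⟩
    exact fun x ↦ (h2.symm ▸ mem_univ x :)
  · left
    have hV : L ⊆ U := fun x hx ↦ (hUV hx).resolve_right fun hu ↦ h.subset ⟨hx, hu⟩
    have h1 : IsClopen {x | τ y ≤ τ x} := by
      refine ⟨isClosed_le continuous_const hc, isOpen_iff_mem_nhds.2 fun x hx ↦ ?_⟩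
      rcases (show τ y ≤ τ x from hx).eq_or_lt with h2 | h2
      · exact mem_interior_iff_mem_nhds.1 (hV h2.symm)
      · exact (hc.continuousAt.eventually_const_lt h2).mono fun z hz ↦ hz.le
    have h2 := h1.eq_univ ⟨y, le_refl (τ y)⟩
    exact fun x ↦ (h2.symm ▸ mem_univ x :)

/-- On a critical level both values are `0`. On a regular one `dQ` is proportional to `dτ ≠ 0`, so
`Q` is locally constant on the connected level. -/
theorem gradSq_eq_of_eq {x y : M} (h : τ x = τ y) : gradSq E τ x = gradSq E τ y := by
  by_cases hy : y ∈ critSet E τ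
  · rw [gradSq_eq_zero_iff.2 hy,
      gradSq_eq_zero_iff.2 ((mem_critSet_iff_of_eq hMB hgeo hcodim h).2 hy)]
  refine eq_of_isPreconnected_level
    (isPreconnected_level_morseBott hMB hgeo hcodim (τ y)) (fun q hq ↦ ?_) h rfl
  have hq' : q ∉ critSet E τ := fun h ↦ hy ((mem_critSet_iff_of_eq hMB hgeo hcodim hq).1 h)
  have : CompleteSpace E := FiniteDimensional.complete ℝ E
  have hφ := IsManifold.chart_mem_maximalAtlas (I := 𝓘(ℝ, E)) (n := ∞) q
  have hs := mem_chart_source E q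
  have htar := (chartAt E q).open_target.mem_nhds (mem_chart_target E q)
  have hev := RealCalculus.eventually_eq_of_fderiv_proportional
    (contDiffAt_comp_chart_symm hφ (mem_chart_target E q) hMB.1.contMDiffAt)
    (by
      filter_upwards [htar] with z hz
      exact (contDiffAt_gradSq hφ hMB.1 hz).differentiableAt (by simp))
    (fun h ↦ hq' ((fderiv_chartAt_eq_zero_iff hMB.1 q).1 h))
    (by
      filter_upwards [htar] with z hz
      exact fderiv_gradSq_proportional hφ hMB.1 hgeo hz)
  filter_upwards [(tendsto_chart hs).eventually hev, (chartAt E q).open_source.mem_nhds hs]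
    with z hz hzs
  simpa [(chartAt E q).left_inv hs, (chartAt E q).left_inv hzs] using hz

/-- `Q` is a smooth function of `τ`, zero exactly at the extreme values of `τ`. -/
theorem exists_profile {tmin tmax : ℝ} (hmin : IsLeast (range τ) tmin)
    (hmax : IsGreatest (range τ) tmax) :
    tmin < tmax ∧ range τ = Icc tmin tmax ∧ (∀ y ∈ critSet E τ, τ y = tmin ∨ τ y = tmax) ∧
    ∃ χ : ℝ → ℝ, ContDiffOn ℝ ∞ χ (Icc tmin tmax) ∧ (∀ x : M, gradSq E τ x = χ (τ x)) ∧
      (∀ y ∈ critSet E τ, ∃ a : ℝ, a ≠ 0 ∧ (τ y = tmin → 0 < a) ∧ (τ y = tmax → a < 0) ∧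
        (∀ b : ℝ, b ≠ 0 →
          (Module.End.HasEigenvalue
            (hess E τ y : TangentSpace 𝓘(ℝ, E) y →ₗ[ℝ] TangentSpace 𝓘(ℝ, E) y) b ↔ b = a)) ∧
        HasDerivWithinAt χ (2 * a) (Icc tmin tmax) (τ y)) := by
  obtain ⟨⟨xmin, hxmin⟩, hmin⟩ := hmin
  obtain ⟨⟨xmax, hxmax⟩, hmax⟩ := hmax
  have hle : ∀ x, tmin ≤ τ x := fun x ↦ hmin (mem_range_self x)
  have hge : ∀ x, τ x ≤ tmax := fun x ↦ hmax (mem_range_self x)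
  have hmem : ∀ x, τ x ∈ Icc tmin tmax := fun x ↦ ⟨hle x, hge x⟩
  have hlmin : ∀ y, τ y = tmin → IsLocalMin τ y := fun y hy ↦
    Eventually.of_forall fun z ↦ hy ▸ hle z
  have hlmax : ∀ y, τ y = tmax → IsLocalMax τ y := fun y hy ↦
    Eventually.of_forall fun z ↦ hy ▸ hge z
  have hcmin : ∀ y, τ y = tmin → y ∈ critSet E τ := fun y hy ↦
    mem_critSet_of_isLocalMin hMB.1 (hlmin y hy)
  have hcmax : ∀ y, τ y = tmax → y ∈ critSet E τ := fun y hy ↦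
    mem_critSet_of_isLocalMax hMB.1 (hlmax y hy)
  have hlt : tmin < tmax := by
    refine lt_of_le_of_ne (hxmin ▸ hge xmin) fun heq ↦
      frequently_ne_of_mem_critSet hMB hgeo hcodim (hcmin xmin hxmin)
        (Eventually.of_forall fun z ↦ not_not.2 ?_)
    rw [hxmin]
    exact le_antisymm (heq ▸ hge z) (hle z)
  have hrange : range τ = Icc tmin tmax := by
    refine subset_antisymm (range_subset_iff.2 hmem) ?_
    have := intermediate_value_univ xmin xmax hMB.1.continuous
    rwa [hxmin, hxmax] at this
  have hcrit : ∀ y ∈ critSet E τ, τ y = tmin ∨ τ y = tmax := by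
    intro y hy
    rcases isMin_or_isMax_of_mem_critSet hMB hgeo hcodim hy with h | h
    · exact Or.inl (le_antisymm (hxmin ▸ h xmin) (hle y))
    · exact Or.inr (le_antisymm (hge y) (hxmax ▸ h xmax))
  have hfac : Function.FactorsThrough (gradSq E τ) τ := fun x y h ↦
    gradSq_eq_of_eq hMB hgeo hcodim h
  -- The default value `0` of the extension occurs only off the range of `τ`, that is, outside
  -- `[tmin, tmax]`.
  have hχ : ∀ x : M, gradSq E τ x = Function.extend τ (gradSq E τ) 0 (τ x) := fun x ↦
    (hfac.extend_apply 0 x).symm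
  have hsmooth : ContDiffOn ℝ ∞ (Function.extend τ (gradSq E τ) 0) (Icc tmin tmax) := by
    rintro t ht
    rw [← hrange] at ht
    obtain ⟨x, rfl⟩ := ht
    by_cases hx : x ∈ critSet E τ
    · obtain ⟨φ, F, a, h⟩ := exists_criticalChart hMB hgeo hcodim hx
      rcases hcrit x hx with hx' | hx'
      · refine h.contDiffWithinAt_profile hMB.1 hx hχ (ε := 1) (by norm_num) ?_ ?_
        · simpa using h.pos_of_isLocalMin hMB.1 hx (hlmin x hx')
        · intro t ht
          rw [hx']
          linarith [ht.1]
      · refine h.contDiffWithinAt_profile hMB.1 hx hχ (ε := -1) (by norm_num) ?_ ?_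
        · simpa using h.neg_of_isLocalMax hMB.1 hx (hlmax x hx')
        · intro t ht
          rw [hx']
          linarith [ht.2]
    · have hφ := IsManifold.chart_mem_maximalAtlas (I := 𝓘(ℝ, E)) (n := ∞) x
      have hs := mem_chart_source E x
      have hf : ContDiffAt ℝ ∞ (τ ∘ (chartAt E x).symm) (chartAt E x x) :=
        contDiffAt_comp_chart_symm hφ (mem_chart_target E x) hMB.1.contMDiffAt
      have h0 : fderiv ℝ (τ ∘ (chartAt E x).symm) (chartAt E x x) ≠ 0 := fun h ↦
        hx ((fderiv_chartAt_eq_zero_iff hMB.1 x).1 h)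
      -- On a line in such a direction `τ` is a local coordinate, so `χ` inherits the smoothness of
      -- `Q`.
      obtain ⟨w, hw⟩ : ∃ w, fderiv ℝ (τ ∘ (chartAt E x).symm) (chartAt E x x) w ≠ 0 := by
        by_contra! hcon
        exact h0 (ContinuousLinearMap.ext hcon)
      have h1 := RealCalculus.contDiffAt_of_comp_regular (RealCalculus.contDiffAt_line hf w)
        (RealCalculus.contDiffAt_line (contDiffAt_gradSq hφ hMB.1 (mem_chart_target E x)) w)
        (by rwa [RealCalculus.deriv_line hf])
        (Eventually.of_forall fun r ↦ hχ _)
      simp only [zero_smul, add_zero, Function.comp, (chartAt E x).left_inv hs] at h1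
      exact h1.contDiffWithinAt
  refine ⟨hlt, hrange, hcrit, _, hsmooth, hχ, fun y hy ↦ ?_⟩
  obtain ⟨φ, F, a, h⟩ := exists_criticalChart hMB hgeo hcodim hy
  exact ⟨a, h.ne_zero, fun h' ↦ h.pos_of_isLocalMin hMB.1 hy (hlmin y h'),
    fun h' ↦ h.neg_of_isLocalMax hMB.1 hy (hlmax y h'), fun b hb ↦ h.hasEigenvalue_iff hb,
    h.hasDerivWithinAt_profile hMB.1 hy hχ hmem
      ((hsmooth _ (hmem y)).differentiableWithinAt (by simp))⟩

end Global

end GeodesicGradient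

/-! ### Riemannian distance: Lipschitz bounds and descent along the gradient. -/

namespace RiemannianDistance

open ChartCoordinates Manifold
open scoped ENNReal

variable {E : Type*} [NormedAddCommGroup E] [NormedSpace ℝ E] [FiniteDimensional ℝ E]
  {M : Type*} [MetricSpace M] [ChartedSpace E M] [IsManifold 𝓘(ℝ, E) ∞ M]
  [RiemannianBundle (fun x : M ↦ TangentSpace 𝓘(ℝ, E) x)]
  [IsContMDiffRiemannianBundle 𝓘(ℝ, E) ∞ E (fun x : M ↦ TangentSpace 𝓘(ℝ, E) x)]
  [IsRiemannianManifold 𝓘(ℝ, E) M]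

omit [FiniteDimensional ℝ E] [IsManifold 𝓘(ℝ, E) ∞ M]
  [IsContMDiffRiemannianBundle 𝓘(ℝ, E) ∞ E (fun x : M ↦ TangentSpace 𝓘(ℝ, E) x)] in
/-- A `C^1` function with differential of norm at most `1` is `1`-Lipschitz. -/
theorem abs_sub_le_dist {f : M → ℝ} (hf : ContMDiff 𝓘(ℝ, E) 𝓘(ℝ, ℝ) 1 f)
    (h : ∀ x (w : TangentSpace 𝓘(ℝ, E) x), |mvfderiv 𝓘(ℝ, E) f x w| ≤ ‖w‖) (x y : M) :
    |f x - f y| ≤ dist x y := by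
  have key : edist (f x) (f y) ≤ edist x y := by
    rw [IsRiemannianManifold.out (I := 𝓘(ℝ, E)) x y]
    refine le_of_forall_gt fun r hr ↦ ?_
    obtain ⟨γ, h0, h1, hγ, hlen⟩ := exists_lt_of_riemannianEDist_lt hr
    refine lt_of_le_of_lt ?_ hlen
    have hfγ : ContDiffOn ℝ 1 (f ∘ γ) (Icc 0 1) :=
      contMDiffOn_iff_contDiffOn.1 (hf.comp_contMDiffOn hγ)
    rw [edist_comm, edist_eq_enorm_sub]
    have e := enorm_sub_le_lintegral_derivWithin_Icc_of_contDiffOn_Icc hfγ zero_le_one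
    simp only [Function.comp, h0, h1] at e
    refine e.trans ?_
    rw [pathELength_eq_lintegral_mfderivWithin_Icc]
    refine MeasureTheory.setLIntegral_mono' measurableSet_Icc fun t ht ↦ ?_
    have hu : UniqueMDiffWithinAt 𝓘(ℝ, ℝ) (Icc (0 : ℝ) 1) t :=
      uniqueMDiffWithinAt_iff_uniqueDiffWithinAt.2 (uniqueDiffOn_Icc zero_lt_one t ht)
    have h2 := mfderiv_comp_mfderivWithin t (hf.mdifferentiable one_ne_zero (γ t))
      (hγ.mdifferentiableOn one_ne_zero t ht) hu
    have h3 : derivWithin (f ∘ γ) (Icc 0 1) t =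
        mvfderiv 𝓘(ℝ, E) f (γ t) (mfderivWithin 𝓘(ℝ, ℝ) 𝓘(ℝ, E) γ (Icc 0 1) t 1) := by
      rw [← fderivWithin_derivWithin, ← mfderivWithin_eq_fderivWithin]
      exact congrArg (fun L ↦ L 1) h2
    rw [h3]
    rw [← ofReal_norm, ← ofReal_norm]
    exact ENNReal.ofReal_le_ofReal (h _ _)
  rw [← Real.dist_eq, dist_edist, dist_edist]
  exact ENNReal.toReal_mono (edist_ne_top x y) key

/-- Distances along a coordinate line, to first order. -/
theorem eventually_dist_line_le {φ : OpenPartialHomeomorph M E}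
    (hφ : φ ∈ IsManifold.maximalAtlas 𝓘(ℝ, E) ∞ M) {y : M} (hy : y ∈ φ.source) {w : E} {K : ℝ}
    (hK : ‖coordField φ w y‖ < K) :
    ∀ᶠ r in 𝓝[>] (0 : ℝ), dist y (φ.symm (φ y + r • w)) ≤ K * r := by
  have hline : Continuous fun r : ℝ ↦ φ y + r • w := by fun_prop
  have hl0 : φ y + (0 : ℝ) • w = φ y := by simp
  have hK0 : 0 < K := (norm_nonneg _).trans_lt hK
  -- The squared speed of the coordinate line at time `t`; by continuity it stays below `K²` near
  -- `y`.
  have hgram : ∀ᶠ t in 𝓝 (0 : ℝ), gram φ (φ y + t • w) w w < K ^ 2 := by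
    have h1 : ContinuousAt (fun z ↦ gram φ z w w) (φ y) :=
      (((contDiffAt_gram hφ (φ.map_source hy)).clm_apply contDiffAt_const).clm_apply
        contDiffAt_const).continuousAt
    have h2 : gram φ (φ y) w w < K ^ 2 := by
      rw [gram_apply, φ.left_inv hy, real_inner_self_eq_norm_sq]
      exact pow_lt_pow_left₀ hK (norm_nonneg _) two_ne_zero
    have h3 : Tendsto (fun r : ℝ ↦ φ y + r • w) (𝓝 0) (𝓝 (φ y)) := by
      simpa using hline.tendsto 0
    exact h3.eventually (h1.eventually_lt_const h2)
  have htar : ∀ᶠ t in 𝓝 (0 : ℝ), φ y + t • w ∈ φ.target := by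
    refine hline.continuousAt.eventually_mem ?_
    rw [hl0]
    exact φ.open_target.mem_nhds (φ.map_source hy)
  obtain ⟨δ, hδ, hball⟩ := Metric.eventually_nhds_iff.1 (hgram.and htar)
  filter_upwards [Ioo_mem_nhdsGT hδ] with r hr
  have hin : ∀ t ∈ Icc 0 r, gram φ (φ y + t • w) w w < K ^ 2 ∧ φ y + t • w ∈ φ.target := by
    intro t ht
    refine hball ?_
    rw [Real.dist_eq, sub_zero, abs_of_nonneg ht.1]
    exact ht.2.trans_lt hr.2
  set γ : ℝ → M := fun t ↦ φ.symm (φ y + t • w) with hγ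
  have hls : ∀ t, ContMDiffAt 𝓘(ℝ, ℝ) 𝓘(ℝ, E) ∞ (fun r : ℝ ↦ φ y + r • w) t := fun t ↦ by
    refine ContDiffAt.contMDiffAt ?_
    fun_prop
  have hγs : ContMDiffOn 𝓘(ℝ, ℝ) 𝓘(ℝ, E) 1 γ (Icc 0 r) := fun t ht ↦
    (((contMDiffAt_chart_symm hφ (hin t ht).2).comp t (hls t)).of_le (by simp)).contMDiffWithinAt
  have hlen : pathELength 𝓘(ℝ, E) γ 0 r ≤ ENNReal.ofReal (K * r) := by
    rw [pathELength_eq_lintegral_mfderiv_Icc]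
    calc ∫⁻ t in Icc 0 r, ‖mfderiv 𝓘(ℝ, ℝ) 𝓘(ℝ, E) γ t 1‖ₑ
        ≤ ∫⁻ _ in Icc 0 r, ENNReal.ofReal K := by
          refine MeasureTheory.setLIntegral_mono' measurableSet_Icc fun t ht ↦ ?_
          obtain ⟨h1, h2⟩ := hin t ht
          have h3 := mfderiv_comp t ((contMDiffAt_chart_symm hφ h2).mdifferentiableAt (by simp))
            ((hls t).mdifferentiableAt (by simp))
          have h4 : mfderiv 𝓘(ℝ, ℝ) 𝓘(ℝ, E) (fun r : ℝ ↦ φ y + r • w) t 1 = w := by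
            have : HasDerivAt (fun r : ℝ ↦ φ y + r • w) ((1 : ℝ) • w) t :=
              ((hasDerivAt_id t).smul_const w).const_add (φ y)
            rw [one_smul] at this
            have h0 : mfderiv 𝓘(ℝ, ℝ) 𝓘(ℝ, E) (fun r : ℝ ↦ φ y + r • w) t =
                fderiv ℝ (fun r : ℝ ↦ φ y + r • w) t := mfderiv_eq_fderiv
            have h8 : fderiv ℝ (fun r : ℝ ↦ φ y + r • w) t (1 : ℝ) = w :=
              fderiv_apply_one_eq_deriv.trans this.deriv
            rw [h0]
            exact h8
          have h5 : mfderiv 𝓘(ℝ, ℝ) 𝓘(ℝ, E) γ t 1 = coordField φ w (γ t) := by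
            have h6 := mfderiv_chart_symm hφ (φ.map_target h2) w
            rw [φ.right_inv h2] at h6
            refine Eq.trans ?_ h6
            refine (congrArg (fun L ↦ L 1) h3).trans ?_
            exact congrArg (mfderiv 𝓘(ℝ, E) 𝓘(ℝ, E) φ.symm (φ y + t • w)) h4
          rw [h5, ← ofReal_norm]
          refine ENNReal.ofReal_le_ofReal ?_
          rw [gram_apply, real_inner_self_eq_norm_sq] at h1
          exact (lt_of_pow_lt_pow_left₀ 2 hK0.le h1).le
      _ = ENNReal.ofReal (K * r) := by
          rw [MeasureTheory.setLIntegral_const, Real.volume_Icc, sub_zero,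
            ← ENNReal.ofReal_mul hK0.le]
  have h7 := (riemannianEDist_le_pathELength (x := y) hγs (by simp [hγ, φ.left_inv hy]) rfl hr.1.le).trans
    hlen
  rw [← IsRiemannianManifold.out] at h7
  rw [dist_edist]
  exact ENNReal.toReal_le_of_le_ofReal (by have := hr.1; positivity) h7

/-- At a regular point one can move so that `τ` decreases at rate `Q` per distance `√Q`. -/
theorem exists_lt_of_hasDerivAt {τ : M → ℝ} (hτ : ContMDiff 𝓘(ℝ, E) 𝓘(ℝ, ℝ) ∞ τ) {y : M}
    (hy : y ∉ critSet E τ) {s : ℝ → ℝ} {L : ℝ}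
    (hs : HasDerivAt s L (τ y)) (hL : 1 < L * √(gradSq E τ y)) :
    ∃ z, s (τ z) + dist y z < s (τ y) := by
  set φ := chartAt E y
  have hφ : φ ∈ IsManifold.maximalAtlas 𝓘(ℝ, E) ∞ M := IsManifold.chart_mem_maximalAtlas y
  have hys : y ∈ φ.source := mem_chart_source E y
  have hQ : 0 < gradSq E τ y := lt_of_le_of_ne (gradSq_nonneg y)
    fun h ↦ hy (gradSq_eq_zero_iff.1 h.symm)
  obtain ⟨w, hw⟩ := exists_coordField_eq hφ hys (-grad E τ y)
  have hnorm : ‖coordField φ w y‖ = √(gradSq E τ y) := by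
    rw [hw, norm_neg, gradSq, real_inner_self_eq_norm_sq, Real.sqrt_sq (norm_nonneg _)]
  have hf : ContDiffAt ℝ ∞ (τ ∘ φ.symm) (φ y) :=
    contDiffAt_comp_chart_symm hφ (φ.map_source hys) hτ.contMDiffAt
  have hd : fderiv ℝ (τ ∘ φ.symm) (φ y) w = -gradSq E τ y := by
    rw [← mvfderiv_coordField hφ hys (hτ.mdifferentiable (by simp) y), hw, ← inner_grad,
      inner_neg_right, gradSq]
  have hT : HasDerivAt (fun r : ℝ ↦ (τ ∘ φ.symm) (φ y + r • w)) (-gradSq E τ y) 0 := by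
    rw [← hd, ← RealCalculus.deriv_line hf]
    exact ((RealCalculus.contDiffAt_line hf w).differentiableAt (by simp)).hasDerivAt
  have hT0 : (τ ∘ φ.symm) (φ y + (0 : ℝ) • w) = τ y := by simp [φ.left_inv hys]
  have hsT : HasDerivAt (fun r : ℝ ↦ s ((τ ∘ φ.symm) (φ y + r • w))) (L * -gradSq E τ y) 0 :=
    HasDerivAt.comp 0 (by rw [hT0]; exact hs) hT
  have hlt : L * -gradSq E τ y < -√(gradSq E τ y) := by
    have h1 := Real.mul_self_sqrt hQ.le
    have h2 := mul_lt_mul_of_pos_right hL (Real.sqrt_pos.2 hQ)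
    rw [mul_assoc, h1] at h2
    linarith
  -- Along the line `s ∘ τ` initially drops at the rate `L Q`, and `L Q > √Q`, the initial speed.
  -- The number `-K` lies strictly between the two rates.
  obtain ⟨K, hK1, hK2⟩ := exists_between hlt
  have hslope := (hasDerivAt_iff_tendsto_slope.1 hsT).mono_left
    (nhdsWithin_mono 0 (show Ioi (0 : ℝ) ⊆ {0}ᶜ from fun r hr ↦ ne_of_gt hr))
  have ev1 := hslope.eventually_lt_const hK1
  have ev2 := eventually_dist_line_le hφ hys (w := w) (K := -K) (by rw [hnorm]; linarith)
  obtain ⟨r, h1, h2, hr⟩ := (ev1.and (ev2.and self_mem_nhdsWithin)).exists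
  have hr : 0 < r := hr
  refine ⟨φ.symm (φ y + r • w), ?_⟩
  rw [slope_def_field, hT0, sub_zero, div_lt_iff₀ hr] at h1
  have h1 : s (τ (φ.symm (φ y + r • w))) - s (τ y) < K * r := h1
  linarith

/-- If `ds/dτ = Q^(-1/2)` and `s = 0` on the minimum level, then the distance to the minimum level
is at most `s`. -/
theorem infDist_le [CompactSpace M] {τ : M → ℝ} (hτ : ContMDiff 𝓘(ℝ, E) 𝓘(ℝ, ℝ) ∞ τ)
    {tmin tmax : ℝ} (hmem : ∀ x, τ x ∈ Icc tmin tmax) {s : ℝ → ℝ} (hs0 : s tmin = 0)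
    (hsc : ContinuousOn s (Icc tmin tmax)) (hsm : StrictMonoOn s (Icc tmin tmax))
    (hreg : ∀ x, τ x ∈ Ioo tmin tmax → x ∉ critSet E τ)
    (hs : ∀ x, τ x ∈ Ioo tmin tmax → HasDerivAt s (√(gradSq E τ x))⁻¹ (τ x))
    (hmax : ∀ x, τ x = tmax → x ∈ closure {z | τ z < tmax}) (x : M) :
    Metric.infDist x {z | τ z = tmin} ≤ s (τ x) := by
  have hsτ : Continuous fun x ↦ s (τ x) := hsc.comp_continuous hτ.continuous hmem
  have key : ∀ x, τ x < tmax → Metric.infDist x {z | τ z = tmin} ≤ s (τ x) := by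
    intro x hx
    refine le_of_forall_gt_imp_ge_of_dense fun c hc ↦ ?_
    rcases (hmem x).1.eq_or_lt with h | h
    · rw [← h, hs0] at hc
      rw [Metric.infDist_zero_of_mem (show x ∈ {z | τ z = tmin} from h.symm)]
      exact hc.le
    have hlt : tmin < tmax := h.trans hx
    have hs0' : 0 < s (τ x) := by
      rw [← hs0]
      exact hsm ⟨le_rfl, hlt.le⟩ (hmem x) h
    -- With this `k > 1` the functional minimized below has the value `c` at `x` itself. A minimizer
    -- on the minimum level then gives the bound `c`, and the slack `k > 1` lets descent along the
    -- gradient strictly lower the functional at a regular point.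
    set k := c / s (τ x) with hk
    have hk1 : 1 < k := (one_lt_div hs0').2 hc
    have hkc : k * s (τ x) = c := div_mul_cancel₀ _ hs0'.ne'
    obtain ⟨y, -, hy⟩ := isCompact_univ.exists_isMinOn (f := fun y ↦ k * s (τ y) + dist x y)
      ⟨x, mem_univ x⟩
      ((hsτ.const_mul k).add (continuous_const.dist continuous_id)).continuousOn
    have hy : ∀ z, k * s (τ y) + dist x y ≤ k * s (τ z) + dist x z := fun z ↦ hy (mem_univ z)
    have hyx := hy x
    rw [dist_self, add_zero, hkc] at hyx
    rcases (hmem y).1.eq_or_lt with h1 | h1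
    · rw [← h1, hs0, mul_zero, zero_add] at hyx
      exact (Metric.infDist_le_dist_of_mem (show y ∈ {z | τ z = tmin} from h1.symm)).trans hyx
    exfalso
    -- On the maximum level `s ∘ τ` exceeds its value at `x`, so the functional would be larger than
    -- at `x`.
    rcases (hmem y).2.eq_or_lt with h2 | h2
    · have h3 := hsm (hmem x) (hmem y) (h2 ▸ hx)
      have h4 := mul_lt_mul_of_pos_left h3 (zero_lt_one.trans hk1)
      have := dist_nonneg (x := x) (y := y)
      linarith
    · have hyr := hreg y ⟨h1, h2⟩
      have hQ : 0 < gradSq E τ y := lt_of_le_of_ne (gradSq_nonneg y)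
        fun h ↦ hyr (gradSq_eq_zero_iff.1 h.symm)
      obtain ⟨z, hz⟩ := exists_lt_of_hasDerivAt hτ hyr ((hs y ⟨h1, h2⟩).const_mul k)
        (by rwa [inv_mul_cancel_right₀ (Real.sqrt_pos.2 hQ).ne'])
      have := hy z
      have := dist_triangle x y z
      linarith
  rcases (hmem x).2.eq_or_lt with h | h
  · refine (isClosed_le (Metric.continuous_infDist_pt _) hsτ).closure_subset_iff.2 ?_ (hmax x h)
    exact fun z hz ↦ key z hz
  · exact key x h

end RiemannianDistance

/-! ### The integral of `χ^(-1/2)`, its primitive `s` and the inverse of `s`. -/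

namespace RealCalculus

open MeasureTheory

theorem rpow_neg_half {x : ℝ} (hx : 0 ≤ x) : x ^ (-(1 / 2) : ℝ) = (√x)⁻¹ := by
  rw [Real.rpow_neg hx, Real.sqrt_eq_rpow]

theorem continuousOn_rpow_neg_half {χ : ℝ → ℝ} {S : Set ℝ} (hc : ContinuousOn χ S)
    (h : ∀ t ∈ S, 0 < χ t) : ContinuousOn (fun t ↦ χ t ^ (-(1 / 2) : ℝ)) S :=
  hc.rpow_const fun t ht ↦ Or.inl (h t ht).ne'

/-- `χ ^ (-1/2)` is integrable near a simple zero of `χ`. -/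
theorem exists_intervalIntegrable_left {χ : ℝ → ℝ} {a b p : ℝ} (hab : a < b)
    (hc : ContinuousOn χ (Ioo a b)) (ha : χ a = 0)
    (hd : HasDerivWithinAt χ p (Icc a b) a) (hp : 0 < p) :
    ∃ a' ∈ Ioo a b, IntervalIntegrable (fun t ↦ χ t ^ (-(1 / 2) : ℝ)) volume a a' := by
  have h1 := hasDerivWithinAt_iff_tendsto_slope.1 hd
  have h2 : ∀ᶠ t in 𝓝[>] a, p / 2 < slope χ a t := by
    refine (h1.mono_left ?_).eventually_const_lt (half_lt_self hp)
    rw [← nhdsWithin_Ioo_eq_nhdsGT hab]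
    exact nhdsWithin_mono a fun t ht ↦ ⟨Ioo_subset_Icc_self ht, ht.1.ne'⟩
  obtain ⟨u, hu, hu'⟩ := (mem_nhdsGT_iff_exists_mem_Ioc_Ioo_subset hab).1 h2
  obtain ⟨a', ha1, ha2⟩ := exists_between hu.1
  -- Half of the slope at the zero is a safe linear lower bound; it dominates `χ^(-1/2)` by a
  -- multiple of `(t - a)^(-1/2)`, which is integrable.
  have hle : ∀ t ∈ Ioc a a', p / 2 * (t - a) ≤ χ t := by
    intro t ht
    have h3 : p / 2 < slope χ a t := hu' ⟨ht.1, ht.2.trans_lt ha2⟩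
    rw [slope_def_field, ha, sub_zero, lt_div_iff₀ (sub_pos.2 ht.1)] at h3
    exact h3.le
  refine ⟨a', ⟨ha1, ha2.trans_le hu.2⟩, ?_⟩
  have hI : IntervalIntegrable (fun t ↦ (p / 2) ^ (-(1 / 2) : ℝ) * (t - a) ^ (-(1 / 2) : ℝ))
      volume a a' := by
    have h4 := (intervalIntegral.intervalIntegrable_rpow' (a := 0) (b := a' - a)
      (r := -(1 / 2)) (by norm_num)).comp_sub_right a
    rw [zero_add, sub_add_cancel] at h4
    exact h4.const_mul _
  refine hI.mono_fun' ?_ ?_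
  · rw [uIoc_of_le ha1.le]
    refine ContinuousOn.aestronglyMeasurable (continuousOn_rpow_neg_half (hc.mono fun t ht ↦
      ⟨ht.1, ht.2.trans_lt (ha2.trans_le hu.2)⟩) fun t ht ↦ ?_) measurableSet_Ioc
    exact (mul_pos (half_pos hp) (sub_pos.2 ht.1)).trans_le (hle t ht)
  · rw [uIoc_of_le ha1.le]
    filter_upwards [ae_restrict_mem measurableSet_Ioc] with t ht
    have h5 := mul_pos (half_pos hp) (sub_pos.2 ht.1)
    rw [← Real.mul_rpow (half_pos hp).le (sub_pos.2 ht.1).le, Real.norm_of_nonneg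
      (Real.rpow_nonneg (h5.le.trans (hle t ht)) _)]
    exact Real.rpow_le_rpow_of_nonpos h5 (hle t ht) (by norm_num)

theorem intervalIntegrable_rpow_neg_half {χ : ℝ → ℝ} {a b p q : ℝ} (hab : a < b)
    (hc : ContinuousOn χ (Ioo a b)) (hpos : ∀ t ∈ Ioo a b, 0 < χ t) (ha : χ a = 0) (hb : χ b = 0)
    (hda : HasDerivWithinAt χ p (Icc a b) a) (hp : 0 < p)
    (hdb : HasDerivWithinAt χ q (Icc a b) b) (hq : q < 0) :
    IntervalIntegrable (fun t ↦ χ t ^ (-(1 / 2) : ℝ)) volume a b := by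
  obtain ⟨a', ha', h1⟩ := exists_intervalIntegrable_left hab hc ha hda hp
  have hmaps : MapsTo (fun t ↦ -t) (Ioo (-b) (-a)) (Ioo a b) := fun t ht ↦
    ⟨by linarith [ht.2], by linarith [ht.1]⟩
  obtain ⟨b', hb', h2⟩ := exists_intervalIntegrable_left (χ := fun t ↦ χ (-t)) (a := -b) (b := -a)
    (p := -q) (neg_lt_neg hab) (hc.comp continuous_neg.continuousOn hmaps) (by simpa using hb)
    (by
      have h3 : HasDerivWithinAt χ q (Icc a b) (- -b) := by rwa [neg_neg]
      have h4 := h3.comp (-b) (hasDerivAt_neg (-b)).hasDerivWithinAt (s := Icc (-b) (-a))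
        (fun t ht ↦ ⟨by linarith [ht.2], by linarith [ht.1]⟩)
      exact h4.congr_deriv (by ring)) (neg_pos.2 hq)
  have h3 : IntervalIntegrable (fun t ↦ χ t ^ (-(1 / 2) : ℝ)) volume (-b') b := by
    have := (IntervalIntegrable.iff_comp_neg (f := fun t ↦ χ (-t) ^ (-(1 / 2) : ℝ))).1 h2
    simp only [neg_neg] at this
    exact this.symm
  have hb'' := hmaps hb'
  have hsub : uIcc a' (-b') ⊆ Ioo a b := ordConnected_Ioo.uIcc_subset ha' hb''
  have h4 : IntervalIntegrable (fun t ↦ χ t ^ (-(1 / 2) : ℝ)) volume a' (-b') :=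
    (continuousOn_rpow_neg_half (hc.mono hsub) fun t ht ↦ hpos t (hsub ht)).intervalIntegrable
  exact (h1.trans h4).trans h3

section Primitive

variable {χ : ℝ → ℝ} {a b : ℝ}

theorem hasDerivAt_primitive (hc : ContinuousOn χ (Ioo a b)) (hpos : ∀ t ∈ Ioo a b, 0 < χ t)
    (hint : IntervalIntegrable (fun t ↦ χ t ^ (-(1 / 2) : ℝ)) volume a b) {t : ℝ}
    (ht : t ∈ Ioo a b) :
    HasDerivAt (fun t ↦ ∫ u in a..t, χ u ^ (-(1 / 2) : ℝ)) (χ t ^ (-(1 / 2) : ℝ)) t := by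
  have hg := continuousOn_rpow_neg_half hc hpos
  have hab : a ≤ b := (ht.1.trans ht.2).le
  refine intervalIntegral.integral_hasDerivAt_right (hint.mono_set ?_)
    (hg.stronglyMeasurableAtFilter isOpen_Ioo t ht) (hg.continuousAt (Ioo_mem_nhds ht.1 ht.2))
  rw [uIcc_of_le ht.1.le, uIcc_of_le hab]
  exact Icc_subset_Icc_right ht.2.le

theorem continuousOn_primitive (hab : a ≤ b)
    (hint : IntervalIntegrable (fun t ↦ χ t ^ (-(1 / 2) : ℝ)) volume a b) :
    ContinuousOn (fun t ↦ ∫ u in a..t, χ u ^ (-(1 / 2) : ℝ)) (Icc a b) := by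
  have := intervalIntegral.continuousOn_primitive_interval
    ((intervalIntegrable_iff' (μ := volume)).1 hint)
  rwa [uIcc_of_le hab] at this

theorem strictMonoOn_primitive (hab : a ≤ b) (hc : ContinuousOn χ (Ioo a b))
    (hpos : ∀ t ∈ Ioo a b, 0 < χ t)
    (hint : IntervalIntegrable (fun t ↦ χ t ^ (-(1 / 2) : ℝ)) volume a b) :
    StrictMonoOn (fun t ↦ ∫ u in a..t, χ u ^ (-(1 / 2) : ℝ)) (Icc a b) := by
  refine strictMonoOn_of_deriv_pos (convex_Icc a b) (continuousOn_primitive hab hint)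
    fun t ht ↦ ?_
  rw [interior_Icc] at ht
  rw [(hasDerivAt_primitive hc hpos hint ht).deriv]
  exact Real.rpow_pos_of_pos (hpos t ht) _

/-- The primitive of `χ ^ (-1/2)` is a limit of `C^1` functions on the line with derivative at most
`χ ^ (-1/2)`. -/
theorem exists_contDiff_tendsto_primitive (hab : a ≤ b) (hc : ContinuousOn χ (Icc a b))
    (hpos : ∀ t ∈ Ioo a b, 0 < χ t) (h0 : ∀ t ∈ Icc a b, 0 ≤ χ t)
    (hint : IntervalIntegrable (fun t ↦ χ t ^ (-(1 / 2) : ℝ)) volume a b) :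
    ∃ S : ℕ → ℝ → ℝ, (∀ n, ContDiff ℝ 1 (S n)) ∧
      (∀ n, ∀ t ∈ Icc a b, |deriv (S n) t| * √(χ t) ≤ 1) ∧
      ∀ t ∈ Icc a b, Tendsto (fun n ↦ S n t) atTop
        (𝓝 (∫ u in a..t, χ u ^ (-(1 / 2) : ℝ))) := by
  -- `χ` is extended to the line by its endpoint values. Adding `1 / (n + 1)` under the root keeps
  -- the integrand continuous at the zeros of `χ`, so its primitives are `C^1`; dominated
  -- convergence gives the limit.
  set X : ℝ → ℝ := IccExtend hab ((Icc a b).domRestrict χ)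
  have hX : Continuous X := (continuousOn_iff_continuous_domRestrict.1 hc).Icc_extend'
  have hXe : ∀ t ∈ Icc a b, X t = χ t := fun t ht ↦ IccExtend_of_mem hab _ ht
  have hX0 : ∀ t, 0 ≤ X t := fun t ↦ h0 _ (projIcc a b hab t).2
  set f : ℕ → ℝ → ℝ := fun n t ↦ (√(X t + 1 / ((n : ℝ) + 1)))⁻¹ with hf
  have hpos' : ∀ (n : ℕ) t, 0 < X t + 1 / ((n : ℝ) + 1) := fun n t ↦ by
    have := hX0 t
    positivity
  have hfc : ∀ n, Continuous (f n) := fun n ↦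
    ((hX.add continuous_const).sqrt).inv₀ fun t ↦ (Real.sqrt_pos.2 (hpos' n t)).ne'
  have hderiv : ∀ n, deriv (fun t ↦ ∫ u in a..t, f n u) = f n := fun n ↦
    funext fun t ↦ ((hfc n).integral_hasStrictDerivAt a t).hasDerivAt.deriv
  have hf0 : ∀ n t, 0 ≤ f n t := fun n t ↦ inv_nonneg.2 (Real.sqrt_nonneg _)
  refine ⟨fun n t ↦ ∫ u in a..t, f n u, fun n ↦ ?_, fun n t ht ↦ ?_, fun t ht ↦ ?_⟩
  · refine contDiff_one_iff_deriv.2 ⟨fun t ↦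
      ((hfc n).integral_hasStrictDerivAt a t).hasDerivAt.differentiableAt, ?_⟩
    rw [hderiv]
    exact hfc n
  · rw [hderiv, abs_of_nonneg (hf0 n t), ← hXe t ht]
    refine (inv_mul_le_iff₀ (Real.sqrt_pos.2 (hpos' n t))).2 ?_
    rw [mul_one]
    refine Real.sqrt_le_sqrt ?_
    have : (0 : ℝ) < 1 / ((n : ℝ) + 1) := by positivity
    linarith
  · have hae : ∀ᵐ u : ℝ, u ∈ uIoc a t → u ∈ Ioo a b := by
      filter_upwards [(countable_singleton b).ae_notMem volume] with u hu hut
      rw [uIoc_of_le ht.1] at hut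
      exact ⟨hut.1, lt_of_le_of_ne (hut.2.trans ht.2) hu⟩
    refine intervalIntegral.tendsto_integral_filter_of_dominated_convergence
      (fun u ↦ χ u ^ (-(1 / 2) : ℝ))
      (Eventually.of_forall fun n ↦ (hfc n).aestronglyMeasurable) (Eventually.of_forall fun n ↦ ?_)
      (hint.mono_set ?_) ?_
    · filter_upwards [hae] with u hu hut
      have hu := hu hut
      have hu' := Ioo_subset_Icc_self hu
      rw [Real.norm_of_nonneg (hf0 n u), rpow_neg_half (hpos u hu).le]
      refine inv_anti₀ (Real.sqrt_pos.2 (hpos u hu)) (Real.sqrt_le_sqrt ?_)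
      rw [hXe u hu']
      have : (0 : ℝ) < 1 / ((n : ℝ) + 1) := by positivity
      linarith
    · rw [uIcc_of_le ht.1, uIcc_of_le hab]
      exact Icc_subset_Icc_right ht.2
    · filter_upwards [hae] with u hu hut
      have hu := hu hut
      rw [rpow_neg_half (hpos u hu).le]
      refine Tendsto.inv₀ ?_ (Real.sqrt_pos.2 (hpos u hu)).ne'
      refine (Real.continuous_sqrt.tendsto _).comp ?_
      have := (tendsto_one_div_add_atTop_nhds_zero_nat (𝕜 := ℝ)).const_add (χ u)
      rw [add_zero] at this
      rwa [hXe u (Ioo_subset_Icc_self hu)]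

end Primitive

theorem isHomeoOn_of_strictMonoOn {s : ℝ → ℝ} {a b : ℝ} (hab : a ≤ b)
    (hc : ContinuousOn s (Icc a b)) (hm : StrictMonoOn s (Icc a b)) :
    IsHomeoOn s (Icc a b) (Icc (s a) (s b)) := by
  have ha : a ∈ Icc a b := left_mem_Icc.2 hab
  have hb : b ∈ Icc a b := right_mem_Icc.2 hab
  have hmaps : MapsTo s (Icc a b) (Icc (s a) (s b)) := fun t ht ↦
    ⟨hm.monotoneOn ha ht ht.1, hm.monotoneOn ht hb ht.2⟩
  have hsurj : SurjOn s (Icc a b) (Icc (s a) (s b)) := hc.surjOn_Icc ha hb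
  have hinv : InvOn (Function.invFunOn s (Icc a b)) s (Icc a b) (Icc (s a) (s b)) :=
    ⟨hm.injOn.leftInvOn_invFunOn, hsurj.rightInvOn_invFunOn⟩
  have hmaps' : MapsTo (Function.invFunOn s (Icc a b)) (Icc (s a) (s b)) (Icc a b) :=
    hsurj.mapsTo_invFunOn
  refine ⟨Function.invFunOn s (Icc a b), hmaps, hmaps', hinv, hc, ?_⟩
  rw [continuousOn_iff_isClosed]
  intro C hC
  -- A continuous injection of a compact interval is a closed map, so the inverse is continuous.
  refine ⟨s '' (C ∩ Icc a b),
    ((isCompact_Icc.inter_left hC).image_of_continuousOn (hc.mono inter_subset_right)).isClosed, ?_⟩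
  ext r
  constructor
  · rintro ⟨h1, h2⟩
    exact ⟨⟨_, ⟨h1, hmaps' h2⟩, hinv.2 h2⟩, h2⟩
  · rintro ⟨⟨t, ⟨h1, h2⟩, rfl⟩, h3⟩
    refine ⟨?_, h3⟩
    rw [mem_preimage, hinv.1 h2]
    exact h1

theorem isDiffeoOn_of_deriv_ne_zero {s : ℝ → ℝ} {a b : ℝ} (hab : a < b)
    (hc : ContinuousOn s (Icc a b)) (hm : StrictMonoOn s (Icc a b))
    (hs : ContDiffOn ℝ ∞ s (Ioo a b)) (hd : ∀ t ∈ Ioo a b, deriv s t ≠ 0) :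
    IsDiffeoOn s (Ioo a b) (Ioo (s a) (s b)) := by
  obtain ⟨h, hmaps, hmaps', hinv, -, -⟩ := isHomeoOn_of_strictMonoOn hab.le hc hm
  have ha : a ∈ Icc a b := left_mem_Icc.2 hab.le
  have hb : b ∈ Icc a b := right_mem_Icc.2 hab.le
  have hmaps1 : MapsTo h (Ioo (s a) (s b)) (Ioo a b) := by
    intro r hr
    have hr' := Ioo_subset_Icc_self hr
    have h1 := hmaps' hr'
    have h2 : s (h r) = r := hinv.2 hr'
    constructor
    · exact (hm.lt_iff_lt ha h1).1 (by rw [h2]; exact hr.1)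
    · exact (hm.lt_iff_lt h1 hb).1 (by rw [h2]; exact hr.2)
  refine ⟨h, fun t ht ↦ ?_, hmaps1,
    hinv.mono Ioo_subset_Icc_self Ioo_subset_Icc_self, hs, fun r hr ↦ ?_⟩
  · have ht' := Ioo_subset_Icc_self ht
    exact ⟨hm ha ht' ht.1, hm ht' hb ht.2⟩
  · have h1 := hmaps1 hr
    have h2 : s (h r) = r := hinv.2 (Ioo_subset_Icc_self hr)
    obtain ⟨ρ, hρ, hρx, hρi⟩ := exists_local_inverse
      ((hs _ h1).contDiffAt (Ioo_mem_nhds h1.1 h1.2)) (hd _ h1)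
    rw [h2] at hρ hρx hρi
    refine (hρ.congr_of_eventuallyEq ?_).contDiffWithinAt
    have h3 : ∀ᶠ t in 𝓝 r, ρ t ∈ Ioo a b := by
      refine hρ.continuousAt.eventually_mem ?_
      rw [hρx]
      exact Ioo_mem_nhds h1.1 h1.2
    filter_upwards [hρi, h3] with t ht1 ht2
    have h4 := hinv.1 (Ioo_subset_Icc_self ht2)
    rwa [ht1] at h4

end RealCalculus

/-! ### Functions of `τ` compared with the distance, and the theorem. -/

namespace GeodesicGradient

open ChartCoordinates RiemannianDistance RealCalculus

variable {E : Type*} [NormedAddCommGroup E] [NormedSpace ℝ E] [FiniteDimensional ℝ E]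
  {M : Type*} [MetricSpace M] [ChartedSpace E M]
  [RiemannianBundle (fun x : M ↦ TangentSpace 𝓘(ℝ, E) x)]
  {τ : M → ℝ}

theorem abs_mvfderiv_le (x : M) (w : TangentSpace 𝓘(ℝ, E) x) :
    |mvfderiv 𝓘(ℝ, E) τ x w| ≤ √(gradSq E τ x) * ‖w‖ := by
  rw [← inner_grad, gradSq, ← norm_eq_sqrt_real_inner]
  exact abs_real_inner_le_norm _ _

variable [IsRiemannianManifold 𝓘(ℝ, E) M]

/-- The gradient of `h ∘ τ` has norm `|h'(τ)| √Q`. This is applied to `C^1` approximations of `s`,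
since `s` itself need not be differentiable at the endpoints. -/
theorem abs_sub_comp_le_dist (hτ : ContMDiff 𝓘(ℝ, E) 𝓘(ℝ, ℝ) ∞ τ) {h : ℝ → ℝ}
    (hh : ContDiff ℝ 1 h) (hd : ∀ x, |deriv h (τ x)| * √(gradSq E τ x) ≤ 1) (x y : M) :
    |h (τ x) - h (τ y)| ≤ dist x y := by
  refine abs_sub_le_dist (E := E) (f := h ∘ τ)
    (hh.contMDiff.comp (hτ.of_le (by simp))) (fun x w ↦ ?_) x y
  have h1 : mvfderiv 𝓘(ℝ, E) (h ∘ τ) x w = deriv h (τ x) * mvfderiv 𝓘(ℝ, E) τ x w := by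
    have h2 : HasMFDerivAt 𝓘(ℝ, ℝ) 𝓘(ℝ, ℝ) h (τ x) (fderiv ℝ h (τ x)) :=
      ((hh.differentiable one_ne_zero) (τ x)).hasFDerivAt.hasMFDerivAt
    have h3 := (h2.comp x (hτ.mdifferentiable (by simp) x).hasMFDerivAt).mfderiv
    refine (congrArg (fun L ↦ L w) h3).trans ?_
    refine (fderiv_eq_smul_deriv (f := h) (x := τ x) (mvfderiv 𝓘(ℝ, E) τ x w)).trans ?_
    rw [smul_eq_mul, mul_comm]
  rw [h1, abs_mul]
  calc |deriv h (τ x)| * |mvfderiv 𝓘(ℝ, E) τ x w|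
      ≤ |deriv h (τ x)| * (√(gradSq E τ x) * ‖w‖) :=
        mul_le_mul_of_nonneg_left (abs_mvfderiv_le x w) (abs_nonneg _)
    _ = |deriv h (τ x)| * √(gradSq E τ x) * ‖w‖ := (mul_assoc _ _ _).symm
    _ ≤ 1 * ‖w‖ := mul_le_mul_of_nonneg_right (hd x) (norm_nonneg _)
    _ = ‖w‖ := one_mul _

end GeodesicGradient

end

open Set Filter MeasureTheory ChartCoordinates RealCalculus RiemannianDistance GeodesicGradient in
theorem theorem9p2
    {E : Type*} [NormedAddCommGroup E] [NormedSpace ℝ E] [FiniteDimensional ℝ E]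
    {M : Type*} [MetricSpace M] [CompactSpace M] [ConnectedSpace M]
    [ChartedSpace E M] [IsManifold 𝓘(ℝ, E) ∞ M]
    [RiemannianBundle (fun x : M ↦ TangentSpace 𝓘(ℝ, E) x)]
    [IsContMDiffRiemannianBundle 𝓘(ℝ, E) ∞ E (fun x : M ↦ TangentSpace 𝓘(ℝ, E) x)]
    [IsRiemannianManifold 𝓘(ℝ, E) M]
    (τ : M → ℝ) (hMB : IsMorseBott E τ) (hgeo : HasGeodesicGradient E τ)
    (hcodim : ∀ y ∈ critSet E τ, ∀ k : ℕ,
      IsSubmanifoldOfCodim E k (critComponent E τ y) → 1 < k)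
    (tmin tmax : ℝ) (hmin : IsLeast (Set.range τ) tmin) (hmax : IsGreatest (Set.range τ) tmax) :
    tmin < tmax ∧ Set.range τ = Set.Icc tmin tmax ∧
    ∃ χ : ℝ → ℝ,
      -- (i) `Q` is a smooth function of `τ`
      (ContDiffOn ℝ ∞ χ (Set.Icc tmin tmax) ∧ ∀ x : M, gradSq E τ x = χ (τ x)) ∧
      -- (ii) `dQ/dτ = 2a` at each critical point, `a` being the nonzero Hessian eigenvalue there
      (∀ y ∈ critSet E τ, ∃ a : ℝ, a ≠ 0 ∧
        (∀ b : ℝ, b ≠ 0 →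
          (Module.End.HasEigenvalue
            (hess E τ y : TangentSpace 𝓘(ℝ, E) y →ₗ[ℝ] TangentSpace 𝓘(ℝ, E) y) b ↔ b = a)) ∧
        HasDerivWithinAt χ (2 * a) (Set.Icc tmin tmax) (τ y)) ∧
      -- (iii) the integral `lam` of `Q ^ (-1/2)` is finite
      (∀ t ∈ Set.Ioo tmin tmax, 0 < χ t) ∧
      MeasureTheory.IntegrableOn (fun t ↦ χ t ^ (-(1 / 2) : ℝ)) (Set.Icc tmin tmax) ∧
      ∃ lam : ℝ, lam = (∫ t in Set.Icc tmin tmax, χ t ^ (-(1 / 2) : ℝ)) ∧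
        -- (iv) `lam` is the distance between the extreme levels
        IsGLB {d : ℝ | ∃ x y : M, τ x = tmin ∧ τ y = tmax ∧ d = dist x y} lam ∧
        -- (v) the function `s` with `ds/dτ = Q ^ (-1/2)` and `s = 0` at `tmin`
        ∃ s : ℝ → ℝ, s tmin = 0 ∧
          (∀ t ∈ Set.Ioo tmin tmax, HasDerivAt s (χ t ^ (-(1 / 2) : ℝ)) t) ∧
          IsHomeoOn s (Set.Icc tmin tmax) (Set.Icc 0 lam) ∧
          IsDiffeoOn s (Set.Ioo tmin tmax) (Set.Ioo 0 lam) ∧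
          -- (vi) `s` is the distance from the minimum level
          ∀ x : M, s (τ x) = Metric.infDist x {z : M | τ z = tmin} := by
  have hτ := hMB.1
  obtain ⟨hlt, hrange, hcrit, χ, hχs, hχ, hχc⟩ := exists_profile hMB hgeo hcodim hmin hmax
  obtain ⟨⟨xmin, hxmin⟩, hmin⟩ := hmin
  obtain ⟨⟨xmax, hxmax⟩, hmax⟩ := hmax
  have hmem : ∀ x, τ x ∈ Icc tmin tmax := fun x ↦ hrange ▸ mem_range_self x
  have hcmin : ∀ y, τ y = tmin → y ∈ critSet E τ := fun y hy ↦
    mem_critSet_of_isLocalMin hτ (Eventually.of_forall fun z ↦ hy ▸ (hmem z).1)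
  have hcmax : ∀ y, τ y = tmax → y ∈ critSet E τ := fun y hy ↦
    mem_critSet_of_isLocalMax hτ (Eventually.of_forall fun z ↦ hy ▸ (hmem z).2)
  have hreg : ∀ x, τ x ∈ Ioo tmin tmax → x ∉ critSet E τ := fun x hx hc ↦
    (hcrit x hc).elim hx.1.ne' hx.2.ne
  have h0 : ∀ t ∈ Icc tmin tmax, 0 ≤ χ t := by
    intro t ht
    rw [← hrange] at ht
    obtain ⟨x, rfl⟩ := ht
    exact hχ x ▸ gradSq_nonneg x
  have hpos : ∀ t ∈ Ioo tmin tmax, 0 < χ t := by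
    intro t ht
    obtain ⟨x, rfl⟩ := hrange.symm.subset (Ioo_subset_Icc_self ht)
    refine lt_of_le_of_ne (h0 _ (hmem x)) fun h ↦ hreg x ht (gradSq_eq_zero_iff.1 ?_)
    rw [hχ, ← h]
  have hc : ContinuousOn χ (Icc tmin tmax) := hχs.continuousOn
  have hc' : ContinuousOn χ (Ioo tmin tmax) := hc.mono Ioo_subset_Icc_self
  obtain ⟨p, hp, hχp⟩ : ∃ p, 0 < p ∧ HasDerivWithinAt χ p (Icc tmin tmax) tmin := by
    obtain ⟨a, -, ha, -, -, hd⟩ := hχc xmin (hcmin xmin hxmin)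
    exact ⟨2 * a, by linarith [ha hxmin], hxmin ▸ hd⟩
  obtain ⟨q, hq, hχq⟩ : ∃ q, q < 0 ∧ HasDerivWithinAt χ q (Icc tmin tmax) tmax := by
    obtain ⟨a, -, -, ha, -, hd⟩ := hχc xmax (hcmax xmax hxmax)
    exact ⟨2 * a, by linarith [ha hxmax], hxmax ▸ hd⟩
  have hint := intervalIntegrable_rpow_neg_half hlt hc' hpos
    (by rw [← hxmin, ← hχ, gradSq_eq_zero_iff.2 (hcmin xmin hxmin)])
    (by rw [← hxmax, ← hχ, gradSq_eq_zero_iff.2 (hcmax xmax hxmax)]) hχp hp hχq hq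
  set s : ℝ → ℝ := fun t ↦ ∫ u in tmin..t, χ u ^ (-(1 / 2) : ℝ) with hs
  have hs0 : s tmin = 0 := intervalIntegral.integral_same
  have hsc : ContinuousOn s (Icc tmin tmax) := continuousOn_primitive hlt.le hint
  have hsm : StrictMonoOn s (Icc tmin tmax) := strictMonoOn_primitive hlt.le hc' hpos hint
  have hsd : ∀ t ∈ Ioo tmin tmax, HasDerivAt s (χ t ^ (-(1 / 2) : ℝ)) t := fun t ht ↦
    hasDerivAt_primitive hc' hpos hint ht
  have hdist : ∀ x : M, s (τ x) = Metric.infDist x {z : M | τ z = tmin} := by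
    refine fun x ↦ le_antisymm ?_ ?_
    -- The approximations are `1`-Lipschitz after composition with `τ`, and the bound passes to the
    -- limit `s`, which vanishes on the minimum level.
    · obtain ⟨S, hS1, hS2, hS3⟩ := exists_contDiff_tendsto_primitive hlt.le hc hpos h0 hint
      refine (Metric.le_infDist ⟨xmin, hxmin⟩).2 fun z hz ↦ ?_
      have hz : τ z = tmin := hz
      have h1 := ((hS3 _ (hmem x)).sub (hS3 _ (hmem z))).abs
      have h2 := le_of_tendsto h1 (Eventually.of_forall fun n ↦
        abs_sub_comp_le_dist (E := E) hτ (hS1 n) (fun y ↦ by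
          rw [hχ]
          exact hS2 n _ (hmem y)) x z)
      have h3 : |s (τ x) - s (τ z)| ≤ dist x z := h2
      rw [hz, hs0, sub_zero] at h3
      exact (le_abs_self _).trans h3
    · refine infDist_le hτ hmem hs0 hsc hsm hreg (fun y hy ↦ ?_) (fun y hy ↦ ?_) x
      · have h1 := hsd _ hy
        rwa [rpow_neg_half (hpos _ hy).le, ← hχ] at h1
      -- `τ` is not locally constant at a critical point, and near a maximum point every different
      -- value is lower.
      · rw [mem_closure_iff_frequently]
        refine (frequently_ne_of_mem_critSet hMB hgeo hcodim (hcmax y hy)).mono fun z hz ↦ ?_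
        exact lt_of_le_of_ne (hmem z).2 (hy ▸ hz)
  refine ⟨hlt, hrange, χ, ⟨hχs, hχ⟩, fun y hy ↦ ?_, hpos,
    (intervalIntegrable_iff_integrableOn_Icc_of_le hlt.le).1 hint, s tmax, ?_, ⟨?_, ?_⟩, s, hs0,
    hsd, ?_, ?_, hdist⟩
  · obtain ⟨a, ha, -, -, h1, h2⟩ := hχc y hy
    exact ⟨a, ha, h1, h2⟩
  · rw [integral_Icc_eq_integral_Ioc, ← intervalIntegral.integral_of_le hlt.le]
  · rintro _ ⟨x, y, hx, hy, rfl⟩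
    rw [← hy, hdist, dist_comm]
    exact Metric.infDist_le_dist_of_mem hx
  · intro d hd
    -- The minimum level is compact, so the distance from one fixed point of the maximum level is
    -- attained; its value is `s tmax`, so the infimum is a minimum.
    obtain ⟨z, hz, hz'⟩ := (isClosed_eq hτ.continuous continuous_const).isCompact.exists_infDist_eq_dist
      (s := {z : M | τ z = tmin}) ⟨xmin, hxmin⟩ xmax
    rw [← hxmax, hdist, hz', dist_comm]
    exact hd ⟨z, xmax, hz, hxmax, rfl⟩
  · rw [← hs0]
    exact isHomeoOn_of_strictMonoOn hlt.le hsc hsm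
  · rw [← hs0]
    refine isDiffeoOn_of_deriv_ne_zero hlt hsc hsm ?_ fun t ht ↦ ?_
    · refine (contDiffOn_infty_iff_deriv_of_isOpen isOpen_Ioo).2
        ⟨fun t ht ↦ (hsd t ht).differentiableAt.differentiableWithinAt, ?_⟩
      refine ContDiffOn.congr ?_ fun t ht ↦ (hsd t ht).deriv
      exact (hχs.mono Ioo_subset_Icc_self).rpow_const_of_ne fun t ht ↦ (hpos t ht).ne'
    · rw [(hsd t ht).deriv]
      exact (Real.rpow_pos_of_pos (hpos t ht) _).ne'
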